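/- **Setting.** Let $n\ge 1$, $s\in(0,1)$, $\gamma\in(0,1]$, $n\neq 2s$, let $\Omega\subset\mathbb R^n$ be a non-empty bounded open set (e.g. of class $C^{1,1}$), and let $\delta(x)=\operatorname{dist}(x,\partial\Omega)$. Let $\mathcal L$ be a non-negative linear operator on $L^2(\Omega)$ (with a domain) which has a Green's function $\mathcal G_0$: for $u,f\in L^2(\Omega)$, $u\in\operatorname{dom}\mathcal L$ and $\mathcal Lu=f$ if and only if $u(x)=\int_\Omega \mathcal G_0(x,y)f(y)\,dy$ for a.e. $x$. Assume that $\mathcal G_0$ is measurable and satisfies (K1): for some $c>0$ and all $x\ne y$ in $\Omega$, $\mathcal G_0(x,y)=\mathcal G_0(y,x)$ and $c^{-1}k(x,y)\le\mathcal G_0(x,y)\le c\,k(x,y)$, where $$k(x,y)=\frac1{|x-y|^{n-2s}}\Big(\frac{\delta(x)^\gamma}{|x-y|^\gamma}\wedge1\Big)\Big(\frac{\delta(y)^\gamma}{|x-y|^\gamma}\wedge1\Big).$$ Then $\mathcal L$ has eigenvalues $\lambda_1\le\lambda_2\le\cdots\to+\infty$, repeated according to multiplicity, with an orthonormal basis $(\varphi_j)_{j\ge1}$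 of $L^2(\Omega)$ made of eigenfunctions, $\mathcal L\varphi_j=\lambda_j\varphi_j$. Fix any such $(\lambda_j,\varphi_j)$ and write $\Sigma=\{\lambda_j\}$. For $\lambda\in\mathbb R\setminus\Sigma$ put $I=\min\{j\ge 1:\lambda_j\ge\lambda,\ \lambda_{j+1}>\lambda_j\}$, $\bar\lambda=\lambda_{I+1}$, and $\mathbb G_\lambda(\psi)=\sum_{j\ge1}\frac{\langle\psi,\varphi_j\rangle}{\lambda_j-\lambda}\varphi_j$ for $\psi\in L^2(\Omega)$. For $f\in L^1(\Omega;\delta^\gamma)$ (that is, $f\delta^\gamma\in L^1(\Omega)$), a *weak solution* of $\mathcal Lu-\lambda u=f$ in $\Omega$, $Bu=0$ on $\partial\Omega$ (homogeneous boundary condition) is a function $u\in L^1(\Omega;\delta^\gamma)$ with $\int_\Omega u\psi=\int_\Omega f\,\mathbb G_\lambda(\psi)$ for all $\psi\in\delta^\gamma L^\infty(\Omega)$, the integral on the right being absolutely convergent. **Theorem (Projection and uniform estimates).** Let $\lambda\in\mathbb R\setminus\Sigma$ and $f\in L^1(\Omega;\delta^\gamma)$. There is a weak solution $u$ with datum $f$,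 unique up to null sets. The integrals $\langle f,\varphi_j\rangle=\int_\Omega f\varphi_j$ converge absolutely. With $$f^\perp=f-\sum_{j=1}^I\langle f,\varphi_j\rangle\varphi_j\in L^1(\Omega;\delta^\gamma)$$ there is a weak solution $u^\perp=\mathbb G_\lambda(f^\perp)$ with datum $f^\perp$, unique up to null sets, and $$u=\sum_{j=1}^I\frac{\langle f,\varphi_j\rangle}{\lambda_j-\lambda}\varphi_j+u^\perp\quad\text{a.e. in }\Omega.$$ Moreover the following estimates hold for all $\lambda\in\mathbb R\setminus\Sigma$ with $\lambda\ge-\Lambda$, where $\Lambda\in\mathbb R$ is arbitrary. The constants $C$ depend, besides the fixed setting above (including the choice of $(\lambda_j,\varphi_j)$), only on $\bar\lambda$, on $\Lambda$ and on the arguments shown; in particular they do not depend on $f$ or on the distance from $\lambda$ to $\Sigma$. 1. $\|u^\perp\delta^\gamma\|_{L^1(\Omega)}\le C(\bar\lambda,\Lambda)\,\|f\delta^\gamma\|_{L^1(\Omega)}$ for $f\in L^1(\Omega;\delta^\gamma)$. 2. $\|u^\perp\|_{L^p(\Omega)}\le C(p,\bar\lambda,\Lambda)\,\|f\|_{L^1(\Omega)}$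 for $f\in L^1(\Omega)$ and $p\in[1,\frac n{n-2s})$. 3. $\|u^\perp\|_{L^{p_1}(\Omega)}\le C(p_0,p_1,\bar\lambda,\Lambda)\,\|f\|_{L^{p_0}(\Omega)}$ for $f\in L^{p_0}(\Omega)$, $p_0\in(1,\frac n{2s})$ and $\frac1{p_1}=\frac1{p_0}-\frac{2s}n$. 4. $\|u^\perp\|_{L^\infty(K)}\le C(\bar\lambda,\Lambda,K,K_0)\,\big(\|f\|_{L^\infty(K_0)}+\|f\delta^\gamma\|_{L^1(\Omega)}\big)$ for $f\in L^1(\Omega;\delta^\gamma)\cap L^\infty_{\rm loc}(\Omega)$ and $K\Subset K_0\Subset\Omega$, where $A\Subset B$ means that the closure of $A$ lies in the interior of $B$. -/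

import Mathlib

open MeasureTheory Set Filter
open scoped ENNReal NNReal

noncomputable section

namespace GreenEig

/-- Points of `ℝⁿ` with the Euclidean norm. -/
abbrev Pt (n : ℕ) : Type := EuclideanSpace ℝ (Fin n)

/-- Lebesgue measure on `Ω`. -/
abbrev mu {n : ℕ} (Ω : Set (Pt n)) : Measure (Pt n) := volume.restrict Ω

/-- The real Hilbert space `L²(Ω)`. -/
abbrev L2 {n : ℕ} (Ω : Set (Pt n)) : Type := Lp ℝ 2 (mu Ω)

/-- The distance to the boundary, `δ(x) = dist(x, ∂Ω)`. -/
def bdist {n : ℕ} (Ω : Set (Pt n)) (x : Pt n) : ℝ := Metric.infDist x (frontier Ω)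

/-- The model kernel
`|x-y|^{-(n-2s)} (δ(x)^γ / |x-y|^γ ∧ 1) (δ(y)^γ / |x-y|^γ ∧ 1)`. -/
def modelKernel {n : ℕ} (s γ : ℝ) (Ω : Set (Pt n)) (x y : Pt n) : ℝ :=
  1 / dist x y ^ ((n : ℝ) - 2 * s)
    * min (bdist Ω x ^ γ / dist x y ^ γ) 1 * min (bdist Ω y ^ γ / dist x y ^ γ) 1

/-- Condition (K1) on a kernel `G` on `Ω × Ω` off the diagonal: it is measurable, symmetric, and
comparable to the model kernel (the values on the diagonal and outside `Ω × Ω` play no role). -/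
structure GreenBounds {n : ℕ} (s γ : ℝ) (Ω : Set (Pt n)) (G : Pt n → Pt n → ℝ) : Prop where
  measurable : Measurable (Function.uncurry G)
  symm : ∀ x ∈ Ω, ∀ y ∈ Ω, x ≠ y → G x y = G y x
  comparable : ∃ c : ℝ, 0 < c ∧ ∀ x ∈ Ω, ∀ y ∈ Ω, x ≠ y →
    c⁻¹ * modelKernel s γ Ω x y ≤ G x y ∧ G x y ≤ c * modelKernel s γ Ω x y

/-- `G` is the Green function of the operator `L` on `L²(Ω)`: the solutions of `L u = f` are
exactly given by `u(x) = ∫_Ω G(x,y) f(y) dy`. -/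
def IsGreenFunction {n : ℕ} {Ω : Set (Pt n)} (L : L2 Ω →ₗ.[ℝ] L2 Ω) (G : Pt n → Pt n → ℝ) : Prop :=
  ∀ u f : L2 Ω, (∃ h : u ∈ L.domain, L ⟨u, h⟩ = f) ↔
    (u : Pt n → ℝ) =ᵐ[mu Ω] fun x => ∫ y in Ω, G x y * f y

/-- `L` is a non-negative operator: `⟨L u, u⟩ ≥ 0` on its domain. -/
def IsNonneg {n : ℕ} {Ω : Set (Pt n)} (L : L2 Ω →ₗ.[ℝ] L2 Ω) : Prop :=
  ∀ u : L.domain, 0 ≤ inner ℝ (L u) (u : L2 Ω)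

/-- The eigenvalues of `L`, in non-decreasing order, repeated according to multiplicity and tending
to infinity, with an orthonormal basis of `L²(Ω)` made of eigenfunctions.
Indices start at `0`: `lam j` and `φ j` are `λ_{j+1}` and `φ_{j+1}` of the usual numbering. -/
structure IsEigenSystem {n : ℕ} {Ω : Set (Pt n)} (L : L2 Ω →ₗ.[ℝ] L2 Ω)
    (lam : ℕ → ℝ) (φ : HilbertBasis ℕ ℝ (L2 Ω)) : Prop where
  mono : Monotone lam
  tendsto : Tendsto lam atTop atTop
  eigen : ∀ j, ∃ h : φ j ∈ L.domain, L ⟨φ j, h⟩ = lam j • φ j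

/-- `f ∈ L¹(Ω; δ^γ)`. -/
def MemL1w {n : ℕ} (γ : ℝ) (Ω : Set (Pt n)) (f : Pt n → ℝ) : Prop :=
  Integrable (fun x => f x * bdist Ω x ^ γ) (mu Ω)

/-- `ψ ∈ δ^γ L^∞(Ω)`, for `ψ` given as an element of `L²(Ω)`
(on a bounded `Ω`, `δ^γ L^∞(Ω)` is contained in `L²(Ω)`). -/
def MemWLinf {n : ℕ} (γ : ℝ) {Ω : Set (Pt n)} (ψ : L2 Ω) : Prop :=
  ∃ M : ℝ, ∀ᵐ x ∂(mu Ω), |ψ x| ≤ M * bdist Ω x ^ γ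

/-- `f ∈ L^∞_loc(Ω)`. -/
def MemLinfLoc {n : ℕ} (Ω : Set (Pt n)) (f : Pt n → ℝ) : Prop :=
  ∀ K : Set (Pt n), IsCompact K → K ⊆ Ω → MemLp f ∞ (volume.restrict K)

/-- The solution operator `𝔾_l` on `L²(Ω)`, for `l` outside the spectrum:
`𝔾_l(g) = ∑_j ⟨g, φ_j⟩ / (λ_j - l) φ_j`, the series converging in `L²(Ω)`. -/
def solOp {n : ℕ} {Ω : Set (Pt n)} (lam : ℕ → ℝ) (φ : HilbertBasis ℕ ℝ (L2 Ω)) (l : ℝ)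
    (g : L2 Ω) : L2 Ω :=
  ∑' j, (inner ℝ (φ j) g / (lam j - l)) • φ j

/-- `u` is a `𝔾_l(δ^γ L^∞(Ω))`-weak solution of `L u - l u = f` in `Ω`, `B u = 0` on `∂Ω`:
`f, u ∈ L¹(Ω; δ^γ)` and `∫ u ψ = ∫ f 𝔾_l(ψ)` for all `ψ ∈ δ^γ L^∞(Ω)`, the integral on the right
being absolutely convergent. -/
structure IsWeakSol {n : ℕ} (γ : ℝ) {Ω : Set (Pt n)} (lam : ℕ → ℝ)
    (φ : HilbertBasis ℕ ℝ (L2 Ω)) (l : ℝ) (f u : Pt n → ℝ) : Prop where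
  data_mem : MemL1w γ Ω f
  sol_mem : MemL1w γ Ω u
  integrable : ∀ ψ : L2 Ω, MemWLinf γ ψ → Integrable (fun x => f x * solOp lam φ l ψ x) (mu Ω)
  weak : ∀ ψ : L2 Ω, MemWLinf γ ψ → ∫ x in Ω, u x * ψ x = ∫ x in Ω, f x * solOp lam φ l ψ x

/-- The number `I = min {j ≥ 1 : λ_j ≥ l and λ_{j+1} > λ_j}` of low eigenfunctions
(`λ_j` is `lam (j - 1)`). -/
def lowCount (lam : ℕ → ℝ) (l : ℝ) : ℕ := sInf {j : ℕ | l ≤ lam j ∧ lam j < lam (j + 1)} + 1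

/-- The eigenvalue `λ_{I+1}`, usually written with a bar over `l`. -/
def lamBar (lam : ℕ → ℝ) (l : ℝ) : ℝ := lam (lowCount lam l)

/-- The pairing `⟨f, φ⟩ = ∫_Ω f φ`. -/
def pairing {n : ℕ} {Ω : Set (Pt n)} (f : Pt n → ℝ) (e : L2 Ω) : ℝ := ∫ x in Ω, f x * e x

/-- `f^⊥ = f - ∑_{j ≤ I} ⟨f, φ_j⟩ φ_j`. -/
def perp {n : ℕ} {Ω : Set (Pt n)} (lam : ℕ → ℝ) (φ : HilbertBasis ℕ ℝ (L2 Ω)) (l : ℝ)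
    (f : Pt n → ℝ) : Pt n → ℝ :=
  fun x => f x - ∑ j ∈ Finset.range (lowCount lam l), pairing f (φ j) * φ j x

end GreenEig

end

/-! Write 𝒦 for the potential operator with kernel |G|, T for its signed version on `L²(Ω)`, and P
for the projection that removes the first I modes. Two mechanisms carry the proof.

Regularisation. By (K1), 𝒦 has a kernel of Riesz type with exponent β = max(n - 2s, 0) < n, and it
may trade a further singularity |x-y|^{-ε} for a factor δ(x)^ε (`KernelBounds.gain`). Composing
Riesz kernels lowers the exponent, so a power of 𝒦 maps L¹ to L^∞; the trade gives 𝒦^M 1 ≤ C δ^γ,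
and by duality 𝒦^M maps L¹(δ^γ) to L¹. Together, some power of 𝒦 maps L¹(Ω; δ^γ) to δ^γ L^∞(Ω)
(`exists_pot_iterate_le`). Hence whatever satisfies V ≤ 𝒦F + A𝒦V is bounded by finitely many
potentials of F plus C ‖V δ^γ‖₁ δ^γ (`AdmissibleKernel.exists_apriori`). Eigenfunctions and
resolvents satisfy z = Tg + l Tz, so the φ_j lie in δ^γ L^∞ and 𝔾_l preserves that space. Existence
of weak solutions also follows: replacing f by Tf often enough puts the datum in L², where the
resolvent series solves the problem.

Uniformity. Only modes with λ_j ≥ λ̄ survive P, and λ < λ_I < λ̄, so ‖P 𝔾_l ψ‖₂ ≤ (λ̄ - λ_I)⁻¹ ‖ψ‖₂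
however close λ is to the spectrum. As P commutes with the resolvent, the a priori bound turns this
into |P 𝔾_l ψ| ≤ C δ^γ for |ψ| ≤ δ^γ (`GreenSpectrum.exists_highPart_solOp_le`). Testing u^⊥ with ψ
= sign(u^⊥) δ^γ and moving the projection from the datum to the test function gives estimate 1.
Inserting estimate 1 in the iterated integral equation bounds |u^⊥| pointwise by finitely many
potentials of |f| plus C ‖f δ^γ‖₁ δ^γ (`GreenSpectrum.exists_enorm_le`), and estimates 2 to 4 become
mapping properties of potentials: Jensen's inequality, Hardy-Littlewood-Sobolev, and an interior sup
bound.

The spectral decomposition itself comes from compactness of T: the kernel is cut off near the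
diagonal, which leaves a Hilbert-Schmidt operator and an error of small norm. -/

namespace GreenEig

/-! ### The weight δ^γ and Riesz kernels on a bounded set. -/

variable {n : ℕ}

/-- The Riesz kernel `|x - y|^{-a}`. -/
noncomputable def rieszKernel (a : ℝ) (x y : Pt n) : ℝ≥0∞ := ENNReal.ofReal (dist x y ^ (-a))

/-- The potential `x ↦ ∫_Ω κ(x, y) F(y) dy` of a non-negative function. -/
noncomputable def pot (Ω : Set (Pt n)) (κ : Pt n → Pt n → ℝ≥0∞) (F : Pt n → ℝ≥0∞) (x : Pt n) :
    ℝ≥0∞ := ∫⁻ y in Ω, κ x y * F y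

/-- The weight `δ^γ`. -/
noncomputable def wt (γ : ℝ) (Ω : Set (Pt n)) (x : Pt n) : ℝ≥0∞ := ENNReal.ofReal (bdist Ω x ^ γ)

lemma measurable_bdist (Ω : Set (Pt n)) : Measurable (bdist Ω) :=
  (Metric.continuous_infDist_pt _).measurable

lemma bdist_nonneg (Ω : Set (Pt n)) (x : Pt n) : 0 ≤ bdist Ω x := Metric.infDist_nonneg

lemma bdist_le_add_dist (Ω : Set (Pt n)) (x y : Pt n) : bdist Ω y ≤ bdist Ω x + dist x y := by
  rw [dist_comm]; exact Metric.infDist_le_infDist_add_dist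

lemma measurable_wt (γ : ℝ) (Ω : Set (Pt n)) : Measurable (wt γ Ω) :=
  ((measurable_bdist Ω).pow_const γ).ennreal_ofReal

lemma wt_ne_top (γ : ℝ) (Ω : Set (Pt n)) (x : Pt n) : wt γ Ω x ≠ ⊤ := ENNReal.ofReal_ne_top

lemma frontier_nonempty_of_isBounded (hn : 1 ≤ n) {Ω : Set (Pt n)}
    (hΩb : Bornology.IsBounded Ω) (hΩne : Ω.Nonempty) : (frontier Ω).Nonempty := by
  have : Nonempty (Fin n) := ⟨⟨0, hn⟩⟩
  rw [nonempty_frontier_iff]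
  refine ⟨hΩne, fun h => ?_⟩
  rw [h] at hΩb
  exact NormedSpace.unbounded_univ ℝ (Pt n) hΩb

lemma bdist_pos (hn : 1 ≤ n) {Ω : Set (Pt n)} (hΩo : IsOpen Ω)
    (hΩb : Bornology.IsBounded Ω) {x : Pt n} (hx : x ∈ Ω) : 0 < bdist Ω x := by
  refine (isClosed_frontier.notMem_iff_infDist_pos
    (frontier_nonempty_of_isBounded hn hΩb ⟨x, hx⟩)).1 fun h => ?_
  rw [hΩo.frontier_eq] at h
  exact h.2 hx

lemma bdist_le_diam (hn : 1 ≤ n) {Ω : Set (Pt n)} (hΩb : Bornology.IsBounded Ω)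
    {x : Pt n} (hx : x ∈ Ω) : bdist Ω x ≤ Metric.diam (closure Ω) := by
  obtain ⟨z, hz⟩ := frontier_nonempty_of_isBounded hn hΩb ⟨x, hx⟩
  exact (Metric.infDist_le_dist_of_mem hz).trans
    (Metric.dist_le_diam_of_mem hΩb.closure (subset_closure hx) (frontier_subset_closure hz))

lemma exists_wt_le (hn : 1 ≤ n) {Ω : Set (Pt n)} (hΩb : Bornology.IsBounded Ω) {γ : ℝ}
    (hγ : 0 ≤ γ) : ∃ C : ℝ≥0, ∀ x ∈ Ω, wt γ Ω x ≤ C :=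
  ⟨(Metric.diam (closure Ω) ^ γ).toNNReal, fun _ hx =>
    ENNReal.ofReal_le_ofReal (Real.rpow_le_rpow (bdist_nonneg _ _) (bdist_le_diam hn hΩb hx) hγ)⟩

lemma measurable_rieszKernel (a : ℝ) :
    Measurable (Function.uncurry (rieszKernel (n := n) a)) :=
  ((measurable_dist (α := Pt n)).pow_const (-a)).ennreal_ofReal

lemma rieszKernel_comm (a : ℝ) (x y : Pt n) : rieszKernel a x y = rieszKernel a y x := by
  rw [rieszKernel, rieszKernel, dist_comm]

lemma rieszKernel_zero (x y : Pt n) : rieszKernel 0 x y = 1 := by simp [rieszKernel]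

/-- `∫_{B(x,r)} |x-y|^{-a} dy` is finite and does not depend on `x`. -/
lemma lintegral_ball_rieszKernel (a r : ℝ) (x : Pt n) :
    ∫⁻ y in Metric.ball x r, rieszKernel a x y
      = ∫⁻ z in Metric.ball (0 : Pt n) r, ENNReal.ofReal (‖z‖ ^ (-a)) := by
  have h := (Measure.measurePreserving_sub_left (volume : Measure (Pt n)) x).setLIntegral_comp_preimage_emb
    (MeasurableEquiv.subLeft x).measurableEmbedding (fun z => ENNReal.ofReal (‖z‖ ^ (-a)))
    (Metric.ball 0 r)
  rw [← h]
  have : (fun y => x - y) ⁻¹' Metric.ball (0 : Pt n) r = Metric.ball x r := by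
    ext y; simp [dist_eq_norm, norm_sub_rev]
  rw [this]
  simp [rieszKernel, dist_eq_norm]

lemma lintegral_ball_norm_rpow_lt_top (hn : 1 ≤ n) {a : ℝ} (ha : a < n) (r : ℝ) :
    ∫⁻ z in Metric.ball (0 : Pt n) r, ENNReal.ofReal (‖z‖ ^ (-a)) < ⊤ := by
  have := integrableOn_ball_of_norm_le_rpow (E := Pt n) (μ := volume) (F := ℝ)
    (f := fun z => ‖z‖ ^ (-a)) (C := 1) (α := a) (r := r) (by simpa using hn) (by simpa using ha)
    (by
      refine Eventually.of_forall fun z => ?_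
      rw [one_mul, Real.norm_of_nonneg (by positivity)])
    (measurable_norm.pow_const _).aestronglyMeasurable
  exact this.lintegral_lt_top

lemma exists_lintegral_rieszKernel_le (hn : 1 ≤ n) {Ω : Set (Pt n)}
    (hΩb : Bornology.IsBounded Ω) {a : ℝ} (ha : a < n) :
    ∃ C : ℝ≥0, ∀ x ∈ Ω, ∫⁻ y in Ω, rieszKernel a x y ≤ C := by
  obtain ⟨D, hD⟩ := Metric.isBounded_iff.1 hΩb
  refine ⟨(∫⁻ z in Metric.ball (0 : Pt n) (D + 1), ENNReal.ofReal (‖z‖ ^ (-a))).toNNReal,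
    fun x hx => ?_⟩
  rw [ENNReal.coe_toNNReal (lintegral_ball_norm_rpow_lt_top hn ha _).ne,
    ← lintegral_ball_rieszKernel a (D + 1) x]
  refine lintegral_mono_set fun y hy => ?_
  rw [Metric.mem_ball']
  exact (hD hx hy).trans_lt (by linarith)

lemma ae_ne (hn : 1 ≤ n) (Ω : Set (Pt n)) (x : Pt n) : ∀ᵐ y ∂(mu Ω), y ≠ x := by
  have : Nonempty (Fin n) := ⟨⟨0, hn⟩⟩
  exact ae_restrict_of_ae (Measure.ae_ne volume x)

/-- One of the distances from z to x and to y is at least half of |x-y|. That factor gives up the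
power α - θ, which is bounded by a power of |x-y|; the powers left over have total exponent β + θ.
Thus θ is the amount of singularity removed by composing with the exponent β. -/
lemma rieszKernel_mul_le {α β θ : ℝ} (hθ : 0 ≤ θ) (hθα : θ ≤ α) (hαβ : α ≤ β) {x y z : Pt n}
    (hxy : x ≠ y) (hzx : z ≠ x) (hzy : z ≠ y) :
    rieszKernel α x z * rieszKernel β z y ≤ ENNReal.ofReal (2 ^ (α - θ)) * rieszKernel (α - θ) x y
      * (rieszKernel (β + θ) x z + rieszKernel (β + θ) y z) := by
  have hd : 0 < dist x y := dist_pos.2 hxy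
  have hu : 0 < dist x z := dist_pos.2 hzx.symm
  have hv : 0 < dist z y := dist_pos.2 hzy
  have htri : dist x y ≤ dist x z + dist z y := dist_triangle _ _ _
  simp only [rieszKernel]
  rw [dist_comm y z]
  generalize dist x y = d at *
  generalize dist x z = u at *
  generalize dist z y = v at *
  rw [← ENNReal.ofReal_mul (by positivity), ← ENNReal.ofReal_mul (by positivity),
    ← ENNReal.ofReal_add (by positivity) (by positivity), ← ENNReal.ofReal_mul (by positivity)]
  apply ENNReal.ofReal_le_ofReal
  have h2 : (2 : ℝ) ^ (α - θ) * d ^ (-(α - θ)) = (d / 2) ^ (-(α - θ)) := by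
    rw [Real.div_rpow hd.le (by norm_num), Real.rpow_neg (by norm_num : (0:ℝ) ≤ 2)]
    field_simp
  rw [h2]
  -- A product of two negative powers is at most the one in which both bases are the smaller
  -- distance.
  have mixed : ∀ a b : ℝ, 0 ≤ a → 0 ≤ b → u ^ (-a) * v ^ (-b) ≤ u ^ (-(a + b)) + v ^ (-(a + b)) := by
    intro a b ha hb
    have e1 : u ^ (-(a + b)) = u ^ (-a) * u ^ (-b) := by rw [← Real.rpow_add hu]; ring_nf
    have e2 : v ^ (-(a + b)) = v ^ (-a) * v ^ (-b) := by rw [← Real.rpow_add hv]; ring_nf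
    rcases le_total u v with h | h
    · have : v ^ (-b) ≤ u ^ (-b) := Real.rpow_le_rpow_of_nonpos hu h (by linarith)
      have h3 : u ^ (-a) * v ^ (-b) ≤ u ^ (-a) * u ^ (-b) := by gcongr
      have h4 : 0 ≤ v ^ (-(a + b)) := by positivity
      linarith
    · have : u ^ (-a) ≤ v ^ (-a) := Real.rpow_le_rpow_of_nonpos hv h (by linarith)
      have h3 : u ^ (-a) * v ^ (-b) ≤ v ^ (-a) * v ^ (-b) := by gcongr
      have h4 : 0 ≤ u ^ (-(a + b)) := by positivity
      linarith
  rcases le_total (d / 2) u with h | h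
  · have e : u ^ (-α) = u ^ (-(α - θ)) * u ^ (-θ) := by rw [← Real.rpow_add hu]; ring_nf
    have h1 : u ^ (-(α - θ)) ≤ (d / 2) ^ (-(α - θ)) :=
      Real.rpow_le_rpow_of_nonpos (by linarith) h (by linarith)
    calc u ^ (-α) * v ^ (-β) = u ^ (-(α - θ)) * (u ^ (-θ) * v ^ (-β)) := by rw [e]; ring
      _ ≤ (d / 2) ^ (-(α - θ)) * (u ^ (-(θ + β)) + v ^ (-(θ + β))) := by
        gcongr
        exact mixed θ β hθ (by linarith)
      _ = _ := by rw [add_comm θ β]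
  -- Here α ≤ β ensures that the exponent β - α + θ left on v is non-negative.
  · have h' : d / 2 ≤ v := by linarith
    have e : v ^ (-β) = v ^ (-(α - θ)) * v ^ (-(β - α + θ)) := by
      rw [← Real.rpow_add hv]; ring_nf
    have h1 : v ^ (-(α - θ)) ≤ (d / 2) ^ (-(α - θ)) :=
      Real.rpow_le_rpow_of_nonpos (by linarith) h' (by linarith)
    calc u ^ (-α) * v ^ (-β) = v ^ (-(α - θ)) * (u ^ (-α) * v ^ (-(β - α + θ))) := by rw [e]; ring
      _ ≤ (d / 2) ^ (-(α - θ)) * (u ^ (-(α + (β - α + θ))) + v ^ (-(α + (β - α + θ)))) := by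
        gcongr
        exact mixed α _ (by linarith) (by linarith)
      _ = _ := by ring_nf

/-! ### Potentials -/

lemma pot_congr {Ω : Set (Pt n)} (κ : Pt n → Pt n → ℝ≥0∞) {F F' : Pt n → ℝ≥0∞}
    (h : F =ᵐ[mu Ω] F') : pot Ω κ F = pot Ω κ F' := by
  ext x
  refine lintegral_congr_ae ?_
  filter_upwards [h] with y hy
  rw [hy]

lemma pot_mono {Ω : Set (Pt n)} (κ : Pt n → Pt n → ℝ≥0∞) {F F' : Pt n → ℝ≥0∞}
    (h : F ≤ᵐ[mu Ω] F') (x : Pt n) : pot Ω κ F x ≤ pot Ω κ F' x := by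
  refine lintegral_mono_ae ?_
  filter_upwards [h] with y hy
  gcongr

lemma measurable_pot {Ω : Set (Pt n)} {κ : Pt n → Pt n → ℝ≥0∞}
    (hκ : Measurable (Function.uncurry κ)) {F : Pt n → ℝ≥0∞} (hF : AEMeasurable F (mu Ω)) :
    Measurable (pot Ω κ F) := by
  rw [pot_congr κ hF.ae_eq_mk]
  exact Measurable.lintegral_prod_right (f := fun x y => κ x y * hF.mk F y)
    (hκ.mul (hF.measurable_mk.comp measurable_snd))

lemma aemeasurable_kernel_mul {Ω : Set (Pt n)} {κ : Pt n → Pt n → ℝ≥0∞}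
    (hκ : Measurable (Function.uncurry κ)) {F : Pt n → ℝ≥0∞} (hF : AEMeasurable F (mu Ω))
    (x : Pt n) : AEMeasurable (fun y => κ x y * F y) (mu Ω) :=
  hκ.of_uncurry_left.aemeasurable.mul hF

lemma measurable_pot_iterate {Ω : Set (Pt n)} {κ : Pt n → Pt n → ℝ≥0∞}
    (hκ : Measurable (Function.uncurry κ)) {F : Pt n → ℝ≥0∞} (hF : AEMeasurable F (mu Ω)) (i : ℕ) :
    AEMeasurable ((pot Ω κ)^[i] F) (mu Ω) := by
  induction i with
  | zero => exact hF
  | succ i ih =>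
    rw [Function.iterate_succ_apply']
    exact (measurable_pot hκ ih).aemeasurable

lemma pot_const_mul {Ω : Set (Pt n)} {κ : Pt n → Pt n → ℝ≥0∞} (c : ℝ≥0) (F : Pt n → ℝ≥0∞)
    (x : Pt n) : pot Ω κ (fun y => c * F y) x = c * pot Ω κ F x := by
  rw [pot, pot, ← lintegral_const_mul' _ _ ENNReal.coe_ne_top]
  simp_rw [mul_left_comm]

lemma pot_add {Ω : Set (Pt n)} {κ : Pt n → Pt n → ℝ≥0∞}
    (hκ : Measurable (Function.uncurry κ)) {F F' : Pt n → ℝ≥0∞} (hF : AEMeasurable F (mu Ω))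
    (x : Pt n) : pot Ω κ (fun y => F y + F' y) x = pot Ω κ F x + pot Ω κ F' x := by
  simp_rw [pot, mul_add]
  exact lintegral_add_left' (aemeasurable_kernel_mul hκ hF x) _

lemma pot_mono_on {Ω : Set (Pt n)} (hΩ : MeasurableSet Ω) (κ : Pt n → Pt n → ℝ≥0∞)
    {F F' : Pt n → ℝ≥0∞} (h : ∀ x ∈ Ω, F x ≤ F' x) (x : Pt n) : pot Ω κ F x ≤ pot Ω κ F' x :=
  pot_mono κ ((ae_restrict_iff' hΩ).2 (Eventually.of_forall h)) x

lemma pot_iterate_mono {Ω : Set (Pt n)} (κ : Pt n → Pt n → ℝ≥0∞) {F F' : Pt n → ℝ≥0∞}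
    (h : F ≤ᵐ[mu Ω] F') (i : ℕ) : (pot Ω κ)^[i] F ≤ᵐ[mu Ω] (pot Ω κ)^[i] F' := by
  induction i with
  | zero => exact h
  | succ i ih =>
    simp_rw [Function.iterate_succ_apply']
    exact Eventually.of_forall fun x => pot_mono κ ih x

/-- Composition of Riesz potentials on a bounded set. -/
lemma exists_pot_rieszKernel_comp_le (hn : 1 ≤ n) {Ω : Set (Pt n)} (hΩo : MeasurableSet Ω)
    (hΩb : Bornology.IsBounded Ω) {α β θ : ℝ} (hθ : 0 ≤ θ) (hθα : θ ≤ α) (hαβ : α ≤ β)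
    (hβ : β + θ < n) :
    ∃ C : ℝ≥0, ∀ F : Pt n → ℝ≥0∞, AEMeasurable F (mu Ω) → ∀ x ∈ Ω,
      pot Ω (rieszKernel α) (pot Ω (rieszKernel β) F) x ≤ C * pot Ω (rieszKernel (α - θ)) F x := by
  obtain ⟨C₀, hC₀⟩ := exists_lintegral_rieszKernel_le hn hΩb hβ
  refine ⟨((2 : ℝ) ^ (α - θ)).toNNReal * (C₀ + C₀), fun F hF x hx => ?_⟩
  -- The composed kernel, off the diagonal. Both integrals with exponent β + θ are finite uniformly
  -- because β + θ < n.
  have key : ∀ᵐ y ∂(mu Ω), ∫⁻ z in Ω, rieszKernel α x z * rieszKernel β z y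
      ≤ (((2 : ℝ) ^ (α - θ)).toNNReal * (C₀ + C₀) : ℝ≥0) * rieszKernel (α - θ) x y := by
    filter_upwards [ae_ne hn Ω x, ae_restrict_mem hΩo] with y hyx hy
    calc ∫⁻ z in Ω, rieszKernel α x z * rieszKernel β z y
        ≤ ∫⁻ z in Ω, ENNReal.ofReal (2 ^ (α - θ)) * rieszKernel (α - θ) x y
          * (rieszKernel (β + θ) x z + rieszKernel (β + θ) y z) := by
          refine lintegral_mono_ae ?_
          filter_upwards [ae_ne hn Ω x, ae_ne hn Ω y] with z hzx hzy
          exact rieszKernel_mul_le hθ hθα hαβ hyx.symm hzx hzy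
      _ = ENNReal.ofReal (2 ^ (α - θ)) * rieszKernel (α - θ) x y
          * ((∫⁻ z in Ω, rieszKernel (β + θ) x z) + ∫⁻ z in Ω, rieszKernel (β + θ) y z) := by
          rw [lintegral_const_mul', lintegral_add_left]
          · exact (measurable_rieszKernel _).of_uncurry_left
          · exact ENNReal.mul_ne_top ENNReal.ofReal_ne_top ENNReal.ofReal_ne_top
      _ ≤ ENNReal.ofReal (2 ^ (α - θ)) * rieszKernel (α - θ) x y * (C₀ + C₀) := by
          gcongr
          · exact hC₀ x hx
          · exact hC₀ y hy
      _ = _ := by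
          push_cast
          rw [ENNReal.ofReal]; ring
  have hm : ∀ a, Measurable (Function.uncurry (rieszKernel (n := n) a)) := measurable_rieszKernel
  calc pot Ω (rieszKernel α) (pot Ω (rieszKernel β) F) x
      = ∫⁻ z in Ω, ∫⁻ y in Ω, rieszKernel α x z * (rieszKernel β z y * F y) := by
        refine lintegral_congr fun z => ?_
        exact (lintegral_const_mul' _ _ ENNReal.ofReal_ne_top).symm
    _ = ∫⁻ y in Ω, ∫⁻ z in Ω, rieszKernel α x z * (rieszKernel β z y * F y) := by
        refine lintegral_lintegral_swap ?_
        exact (((hm α).comp (measurable_const.prodMk measurable_fst)).aemeasurable).mul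
          ((hm β).aemeasurable.mul hF.comp_snd)
    _ ≤ ∫⁻ y in Ω, (((2 : ℝ) ^ (α - θ)).toNNReal * (C₀ + C₀) : ℝ≥0)
          * (rieszKernel (α - θ) x y * F y) := by
        refine lintegral_mono_ae ?_
        filter_upwards [key] with y hy
        simp_rw [← mul_assoc]
        rw [lintegral_mul_const (f := fun z => rieszKernel α x z * rieszKernel β z y) _
          (((hm α).of_uncurry_left).mul ((hm β).of_uncurry_right))]
        gcongr
    _ = _ := lintegral_const_mul' _ _ ENNReal.coe_ne_top

end GreenEig

/-! ### Trading singularity for boundary decay, and powers of the potential operator. -/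

namespace GreenEig

variable {n : ℕ}

/-- The properties of the Green function used in the estimates: `κ` is measurable, symmetric, and
`κ(x, y) δ(y)^a ≤ c δ(x)^{a + ε} |x - y|^{-β-ε}` for `a, ε ≥ 0` with `a + ε ≤ γ`. -/
structure KernelBounds (β γ : ℝ) (Ω : Set (Pt n)) (κ : Pt n → Pt n → ℝ≥0∞) : Prop where
  measurable : Measurable (Function.uncurry κ)
  symm : ∀ x ∈ Ω, ∀ y ∈ Ω, x ≠ y → κ x y = κ y x
  gain : ∃ c : ℝ≥0, ∀ a ε : ℝ, 0 ≤ a → 0 ≤ ε → a + ε ≤ γ → ∀ x ∈ Ω, ∀ y ∈ Ω, x ≠ y →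
    κ x y * wt a Ω y ≤ c * wt (a + ε) Ω x * rieszKernel (β + ε) x y

/-- Here p, q, d stand for δ(x), δ(y), |x-y|, and the second minimum is simply bounded by 1. If d ≤
p then q ≤ 2p and (p/d)^ε ≥ 1. If p ≤ d then q ≤ 2d, and (p/d)^γ ≤ (p/d)^{a+ε} since p/d ≤ 1. The
factor 2 absorbs 2^a, as a ≤ γ ≤ 1. -/
lemma min_mul_min_mul_rpow_le {p q d γ a ε : ℝ} (hp : 0 ≤ p) (hq : 0 ≤ q) (hd : 0 < d)
    (hqp : q ≤ p + d) (hγ1 : γ ≤ 1) (ha : 0 ≤ a) (hε : 0 ≤ ε) (haε : a + ε ≤ γ) :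
    min (p ^ γ / d ^ γ) 1 * min (q ^ γ / d ^ γ) 1 * q ^ a ≤ 2 * (p ^ (a + ε) * d ^ (-ε)) := by
  have hγ0 : 0 ≤ γ := by linarith
  have hmin : min (q ^ γ / d ^ γ) 1 ≤ 1 := min_le_right _ _
  have hmin0 : 0 ≤ min (p ^ γ / d ^ γ) 1 := le_min (by positivity) zero_le_one
  have h2 : (2 : ℝ) ^ a ≤ 2 := by
    calc (2 : ℝ) ^ a ≤ 2 ^ (1 : ℝ) := Real.rpow_le_rpow_of_exponent_le (by norm_num) (by linarith)
      _ = 2 := Real.rpow_one 2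
  have step : min (p ^ γ / d ^ γ) 1 * min (q ^ γ / d ^ γ) 1 * q ^ a
      ≤ min (p ^ γ / d ^ γ) 1 * q ^ a := by
    have : min (p ^ γ / d ^ γ) 1 * min (q ^ γ / d ^ γ) 1 ≤ min (p ^ γ / d ^ γ) 1 * 1 := by gcongr
    rw [mul_one] at this
    gcongr
  refine step.trans ?_
  rcases le_total d p with h | h
  · have hp' : 0 < p := hd.trans_le h
    have h1 : q ^ a ≤ 2 * p ^ a := by
      calc q ^ a ≤ (2 * p) ^ a := Real.rpow_le_rpow hq (by linarith) ha
        _ = 2 ^ a * p ^ a := Real.mul_rpow (by norm_num) hp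
        _ ≤ 2 * p ^ a := by gcongr
    have h3 : 1 ≤ p ^ ε * d ^ (-ε) := by
      rw [Real.rpow_neg hd.le, ← div_eq_mul_inv, ← Real.div_rpow hp hd.le]
      exact Real.one_le_rpow ((one_le_div hd).2 h) hε
    calc min (p ^ γ / d ^ γ) 1 * q ^ a ≤ 1 * (2 * p ^ a) := by
          gcongr
          exact min_le_right _ _
      _ ≤ (2 * p ^ a) * (p ^ ε * d ^ (-ε)) := by
          rw [one_mul]; exact le_mul_of_one_le_right (by positivity) h3
      _ = _ := by rw [Real.rpow_add hp']; ring
  · have h1 : q ^ a ≤ 2 * d ^ a := by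
      calc q ^ a ≤ (2 * d) ^ a := Real.rpow_le_rpow hq (by linarith) ha
        _ = 2 ^ a * d ^ a := Real.mul_rpow (by norm_num) hd.le
        _ ≤ 2 * d ^ a := by gcongr
    have h3 : min (p ^ γ / d ^ γ) 1 ≤ p ^ (a + ε) / d ^ (a + ε) := by
      refine (min_le_left _ _).trans ?_
      rw [← Real.div_rpow hp hd.le, ← Real.div_rpow hp hd.le]
      -- At p = 0 the comparison of powers is done by hand, because of the convention `0 ^ 0 = 1`.
      rcases hp.eq_or_lt with rfl | hp'
      · rw [zero_div]
        rcases (add_nonneg ha hε).eq_or_lt with h0 | h0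
        · rw [← h0, Real.rpow_zero]
          exact Real.zero_rpow_le_one _
        · rw [Real.zero_rpow h0.ne', Real.zero_rpow (h0.trans_le haε).ne']
      · exact Real.rpow_le_rpow_of_exponent_ge (by positivity) ((div_le_one hd).2 h) haε
    calc min (p ^ γ / d ^ γ) 1 * q ^ a ≤ (p ^ (a + ε) / d ^ (a + ε)) * (2 * d ^ a) := by gcongr
      _ = _ := by
          rw [Real.rpow_add hd, Real.rpow_neg hd.le]
          field_simp

lemma GreenBounds.kernelBounds {s γ : ℝ} (hγ1 : γ ≤ 1)
    {Ω : Set (Pt n)} (hΩb : Bornology.IsBounded Ω) {G : Pt n → Pt n → ℝ}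
    (hG : GreenBounds s γ Ω G) :
    KernelBounds (max ((n : ℝ) - 2 * s) 0) γ Ω (fun x y => ‖G x y‖ₑ) := by
  obtain ⟨c, hc, hcomp⟩ := hG.comparable
  obtain ⟨D, hD⟩ := Metric.isBounded_iff.1 hΩb
  set b := (n : ℝ) - 2 * s
  set D' := max D 1
  -- If n - 2s < 0 the model kernel has no singularity: the positive power of the distance is
  -- bounded on Ω, and the exponent 0 serves instead.
  have hexp : ∀ d : ℝ, 0 < d → d ≤ D' → d ^ (-b) ≤ D' ^ |b| * d ^ (-(max b 0)) := by
    intro d hd hdD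
    have hD1 : 1 ≤ D' := le_max_right _ _
    rcases le_total 0 b with h | h
    · rw [max_eq_left h]
      exact le_mul_of_one_le_left (by positivity) (Real.one_le_rpow hD1 (abs_nonneg _))
    · rw [max_eq_right h, neg_zero, Real.rpow_zero, mul_one, abs_of_nonpos h]
      exact Real.rpow_le_rpow hd.le hdD (by linarith)
  refine ⟨hG.measurable.enorm, fun x hx y hy hxy => by rw [hG.symm x hx y hy hxy],
    ⟨(c * D' ^ |b| * 2).toNNReal, fun a ε ha hε haε x hx y hy hxy => ?_⟩⟩
  have hd : 0 < dist x y := dist_pos.2 hxy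
  have hmk : 0 ≤ modelKernel s γ Ω x y := by
    have := bdist_nonneg Ω x
    have := bdist_nonneg Ω y
    unfold modelKernel
    positivity
  have hGnn : 0 ≤ G x y := (by positivity : 0 ≤ c⁻¹ * modelKernel s γ Ω x y).trans
    (hcomp x hx y hy hxy).1
  have hGle := (hcomp x hx y hy hxy).2
  have hgeom := min_mul_min_mul_rpow_le (bdist_nonneg Ω x) (bdist_nonneg Ω y) hd
    (bdist_le_add_dist Ω x y) hγ1 ha hε haε
  have hb := hexp (dist x y) hd ((hD hx hy).trans (le_max_left _ _))
  have hqa : 0 ≤ bdist Ω y ^ a := Real.rpow_nonneg (bdist_nonneg _ _) _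
  have hpa : 0 ≤ bdist Ω x ^ (a + ε) := Real.rpow_nonneg (bdist_nonneg _ _) _
  rw [Real.enorm_of_nonneg hGnn, wt, wt, rieszKernel, ← ENNReal.ofReal_mul hGnn]
  -- The coercion of `Real.toNNReal` is `ENNReal.ofReal` by definition.
  change _ ≤ ENNReal.ofReal _ * _ * _
  rw [← ENNReal.ofReal_mul (by positivity), ← ENNReal.ofReal_mul (by positivity)]
  apply ENNReal.ofReal_le_ofReal
  calc G x y * bdist Ω y ^ a ≤ c * modelKernel s γ Ω x y * bdist Ω y ^ a := by gcongr
    _ = c * dist x y ^ (-b) * (min (bdist Ω x ^ γ / dist x y ^ γ) 1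
          * min (bdist Ω y ^ γ / dist x y ^ γ) 1 * bdist Ω y ^ a) := by
        rw [modelKernel, Real.rpow_neg hd.le]; ring
    _ ≤ c * (D' ^ |b| * dist x y ^ (-(max b 0)))
          * (2 * (bdist Ω x ^ (a + ε) * dist x y ^ (-ε))) := by
        have := bdist_nonneg Ω x
        have := bdist_nonneg Ω y
        gcongr
    _ = _ := by
        rw [neg_add, Real.rpow_add hd]; ring

section Bounds

variable {β γ : ℝ} {Ω : Set (Pt n)} {κ : Pt n → Pt n → ℝ≥0∞}

lemma KernelBounds.ae_symm (hn : 1 ≤ n) (hΩ : MeasurableSet Ω) (hκ : KernelBounds β γ Ω κ)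
    {x : Pt n} (hx : x ∈ Ω) : ∀ᵐ y ∂(mu Ω), κ x y = κ y x := by
  filter_upwards [ae_ne hn Ω x, ae_restrict_mem hΩ] with y hyx hy
  exact hκ.symm x hx y hy hyx.symm

lemma KernelBounds.exists_pot_le (hn : 1 ≤ n) (hΩ : MeasurableSet Ω) (hγ : 0 ≤ γ)
    (hκ : KernelBounds β γ Ω κ) :
    ∃ c : ℝ≥0, ∀ F : Pt n → ℝ≥0∞, ∀ x ∈ Ω, pot Ω κ F x ≤ c * pot Ω (rieszKernel β) F x := by
  obtain ⟨c, hc⟩ := hκ.gain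
  refine ⟨c, fun F x hx => ?_⟩
  rw [pot, pot, ← lintegral_const_mul' _ _ ENNReal.coe_ne_top]
  refine lintegral_mono_ae ?_
  filter_upwards [ae_ne hn Ω x, ae_restrict_mem hΩ] with y hyx hy
  have := hc 0 0 le_rfl le_rfl (by simpa using hγ) x hx y hy hyx.symm
  simp only [wt, Real.rpow_zero, ENNReal.ofReal_one, mul_one, add_zero] at this
  rw [← mul_assoc]
  gcongr

/-- Each potential raises the power of δ by ε, as long as the kernel with the extra singularity
|x-y|^{-ε} stays integrable. -/
lemma KernelBounds.exists_pot_wt_le (hn : 1 ≤ n) (hΩ : MeasurableSet Ω)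
    (hΩb : Bornology.IsBounded Ω)
    (hκ : KernelBounds β γ Ω κ) {a ε : ℝ} (ha : 0 ≤ a) (hε : 0 ≤ ε) (haε : a + ε ≤ γ)
    (hβ : β + ε < n) :
    ∃ C : ℝ≥0, ∀ x ∈ Ω, pot Ω κ (wt a Ω) x ≤ C * wt (a + ε) Ω x := by
  obtain ⟨c, hc⟩ := hκ.gain
  obtain ⟨C₀, hC₀⟩ := exists_lintegral_rieszKernel_le hn hΩb hβ
  refine ⟨c * C₀, fun x hx => ?_⟩
  calc pot Ω κ (wt a Ω) x
      ≤ ∫⁻ y in Ω, (c * wt (a + ε) Ω x) * rieszKernel (β + ε) x y := by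
        refine lintegral_mono_ae ?_
        filter_upwards [ae_ne hn Ω x, ae_restrict_mem hΩ] with y hyx hy
        exact hc a ε ha hε haε x hx y hy hyx.symm
    _ = (c * wt (a + ε) Ω x) * ∫⁻ y in Ω, rieszKernel (β + ε) x y :=
        lintegral_const_mul' _ _ (ENNReal.mul_ne_top ENNReal.coe_ne_top (wt_ne_top _ _ _))
    _ ≤ (c * wt (a + ε) Ω x) * C₀ := by gcongr; exact hC₀ x hx
    _ = _ := by push_cast; ring

/-- Tonelli and the symmetry of the kernel. This self-adjointness converts pointwise bounds for
potentials of weights into weighted L¹ bounds for potentials of arbitrary functions. -/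
lemma lintegral_pot_mul (hn : 1 ≤ n) (hΩ : MeasurableSet Ω) (hκ : KernelBounds β γ Ω κ)
    {F g : Pt n → ℝ≥0∞} (hF : AEMeasurable F (mu Ω)) (hg : AEMeasurable g (mu Ω)) :
    ∫⁻ x in Ω, pot Ω κ F x * g x = ∫⁻ x in Ω, F x * pot Ω κ g x := by
  have hm := hκ.measurable
  calc ∫⁻ x in Ω, pot Ω κ F x * g x = ∫⁻ x in Ω, ∫⁻ y in Ω, κ x y * F y * g x := by
        refine lintegral_congr fun x => ?_
        rw [pot, lintegral_mul_const'' _ (aemeasurable_kernel_mul hm hF x)]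
    _ = ∫⁻ y in Ω, ∫⁻ x in Ω, κ x y * F y * g x :=
        lintegral_lintegral_swap ((hm.aemeasurable.mul hF.comp_snd).mul hg.comp_fst)
    _ = ∫⁻ y in Ω, F y * pot Ω κ g y := by
        refine lintegral_congr_ae ?_
        filter_upwards [ae_restrict_mem hΩ] with y hy
        rw [pot, ← lintegral_const_mul'' _ (aemeasurable_kernel_mul hm hg y)]
        refine lintegral_congr_ae ?_
        filter_upwards [hκ.ae_symm hn hΩ hy] with x hx
        rw [hx]; ring

lemma lintegral_pot_iterate_mul (hn : 1 ≤ n) (hΩ : MeasurableSet Ω) (hκ : KernelBounds β γ Ω κ)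
    {F g : Pt n → ℝ≥0∞} (hF : AEMeasurable F (mu Ω)) (hg : AEMeasurable g (mu Ω)) (i : ℕ) :
    ∫⁻ x in Ω, (pot Ω κ)^[i] F x * g x = ∫⁻ x in Ω, F x * (pot Ω κ)^[i] g x := by
  induction i generalizing g with
  | zero => rfl
  | succ i ih =>
    rw [Function.iterate_succ_apply', lintegral_pot_mul hn hΩ hκ
      (measurable_pot_iterate hκ.measurable hF i) hg,
      ih (measurable_pot hκ.measurable hg).aemeasurable, Function.iterate_succ_apply]

lemma pot_iterate_const_mul (c : ℝ≥0) (F : Pt n → ℝ≥0∞) (i : ℕ) :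
    (pot Ω κ)^[i] (fun y => c * F y) = fun x => c * (pot Ω κ)^[i] F x := by
  induction i generalizing F with
  | zero => rfl
  | succ i ih =>
    rw [Function.iterate_succ_apply, Function.iterate_succ_apply, ← ih]
    congr 1
    ext x
    exact pot_const_mul c F x

lemma exists_pot_iterate_wt_le (hn : 1 ≤ n) (hΩ : MeasurableSet Ω) (hΩb : Bornology.IsBounded Ω)
    (hκ : KernelBounds β γ Ω κ) (hγ : 0 ≤ γ) (hβn : β < n) (i : ℕ) :
    ∃ C : ℝ≥0, ∀ x ∈ Ω, (pot Ω κ)^[i] (wt γ Ω) x ≤ C * wt γ Ω x := by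
  obtain ⟨C, hC⟩ := hκ.exists_pot_wt_le hn hΩ hΩb hγ le_rfl (by simp) (by simpa using hβn)
  simp only [add_zero] at hC
  refine ⟨C ^ i, ?_⟩
  induction i with
  | zero => simp
  | succ i ih =>
    intro x hx
    rw [Function.iterate_succ_apply']
    calc pot Ω κ ((pot Ω κ)^[i] (wt γ Ω)) x ≤ pot Ω κ (fun y => (C ^ i : ℝ≥0) * wt γ Ω y) x :=
          pot_mono_on hΩ κ ih x
      _ = (C ^ i : ℝ≥0) * pot Ω κ (wt γ Ω) x := pot_const_mul _ _ _
      _ ≤ (C ^ i : ℝ≥0) * (C * wt γ Ω x) := by gcongr; exact hC x hx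
      _ = _ := by push_cast; ring

/-- The potentials of functions in `L¹(Ω; δ^γ)` are in `L¹(Ω; δ^γ)`. -/
lemma exists_lintegral_pot_iterate_mul_wt_le (hn : 1 ≤ n) (hΩ : MeasurableSet Ω)
    (hΩb : Bornology.IsBounded Ω)
    (hκ : KernelBounds β γ Ω κ) (hγ : 0 ≤ γ) (hβn : β < n) (i : ℕ) :
    ∃ C : ℝ≥0, ∀ F : Pt n → ℝ≥0∞, AEMeasurable F (mu Ω) →
      ∫⁻ x in Ω, (pot Ω κ)^[i] F x * wt γ Ω x ≤ C * ∫⁻ x in Ω, F x * wt γ Ω x := by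
  obtain ⟨C, hC⟩ := exists_pot_iterate_wt_le hn hΩ hΩb hκ hγ hβn i
  refine ⟨C, fun F hF => ?_⟩
  rw [lintegral_pot_iterate_mul hn hΩ hκ hF (measurable_wt γ Ω).aemeasurable,
    ← lintegral_const_mul' _ _ ENNReal.coe_ne_top]
  refine lintegral_mono_ae ?_
  filter_upwards [ae_restrict_mem hΩ] with x hx
  rw [mul_left_comm]
  gcongr
  exact hC x hx

lemma exists_nat_div_lt {b d : ℝ} (hb : 0 ≤ b) (hd : 0 < d) : ∃ N : ℕ, 0 < N ∧ b / N < d := by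
  obtain ⟨N, hN⟩ := exists_nat_gt (b / d)
  have hN0 : (0 : ℝ) < N := (by positivity : 0 ≤ b / d).trans_lt hN
  refine ⟨N, by exact_mod_cast hN0, ?_⟩
  rw [div_lt_iff₀ hd] at hN
  rw [div_lt_iff₀ hN0]
  linarith

/-- A power of the potential operator maps `L¹(Ω)` to bounded functions. -/
lemma exists_pot_iterate_le_lintegral (hn : 1 ≤ n) (hΩ : MeasurableSet Ω)
    (hΩb : Bornology.IsBounded Ω) (hκ : KernelBounds β γ Ω κ) (hγ : 0 ≤ γ) (hβ : 0 ≤ β)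
    (hβn : β < n) :
    ∃ (N : ℕ) (C : ℝ≥0), ∀ F : Pt n → ℝ≥0∞, AEMeasurable F (mu Ω) → ∀ x ∈ Ω,
      (pot Ω κ)^[N] F x ≤ C * ∫⁻ y in Ω, F y := by
  -- N steps of size θ = β/N < n - β lower the exponent from β to 0, where the Riesz kernel is
  -- constant.
  obtain ⟨N, hN, hθ⟩ := exists_nat_div_lt hβ (sub_pos.2 hβn)
  set θ := β / N
  have hNθ : N * θ = β := by simp only [θ]; field_simp
  have hθ0 : 0 ≤ θ := by positivity
  obtain ⟨c, hc⟩ := hκ.exists_pot_le hn hΩ hγ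
  have key : ∀ i : ℕ, i ≤ N → ∃ C : ℝ≥0, ∀ F : Pt n → ℝ≥0∞, AEMeasurable F (mu Ω) → ∀ x ∈ Ω,
      (pot Ω κ)^[i + 1] F x ≤ C * pot Ω (rieszKernel (β - i * θ)) F x := by
    intro i
    induction i with
    | zero => exact fun _ => ⟨c, fun F _ x hx => by simpa using hc F x hx⟩
    | succ i ih =>
      intro hi
      obtain ⟨C, hC⟩ := ih (by omega)
      have h1 : ((i : ℝ) + 1) * θ ≤ β := by
        rw [← hNθ]
        gcongr
        exact_mod_cast hi
      obtain ⟨C', hC'⟩ := exists_pot_rieszKernel_comp_le hn hΩ hΩb (α := β - i * θ) (β := β)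
        hθ0 (by linarith) (by nlinarith [Nat.cast_nonneg (α := ℝ) i]) (by linarith)
      refine ⟨C * c * C', fun F hF x hx => ?_⟩
      rw [Function.iterate_succ_apply]
      calc (pot Ω κ)^[i + 1] (pot Ω κ F) x
          ≤ C * pot Ω (rieszKernel (β - i * θ)) (pot Ω κ F) x :=
            hC _ (measurable_pot hκ.measurable hF).aemeasurable x hx
        _ ≤ C * pot Ω (rieszKernel (β - i * θ)) (fun y => c * pot Ω (rieszKernel β) F y) x := by
            gcongr
            exact pot_mono_on hΩ _ (hc F) x
        _ = C * (c * pot Ω (rieszKernel (β - i * θ)) (pot Ω (rieszKernel β) F) x) := by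
            rw [pot_const_mul]
        _ ≤ C * (c * (C' * pot Ω (rieszKernel (β - i * θ - θ)) F x)) := by
            gcongr
            exact hC' F hF x hx
        _ = _ := by
            push_cast
            rw [show β - (i + 1) * θ = β - i * θ - θ by ring]; ring
  obtain ⟨C, hC⟩ := key N le_rfl
  refine ⟨N + 1, C, fun F hF x hx => (hC F hF x hx).trans_eq ?_⟩
  simp [hNθ, pot, rieszKernel_zero]

/-- The weight 1 is δ^0. Each potential gains ε = γ/M, with M so large that β + ε < n, and M of them
reach δ^γ. -/
lemma exists_pot_iterate_one_le (hn : 1 ≤ n) (hΩ : MeasurableSet Ω) (hΩb : Bornology.IsBounded Ω)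
    (hκ : KernelBounds β γ Ω κ) (hγ : 0 ≤ γ) (hβn : β < n) :
    ∃ (M : ℕ) (C : ℝ≥0), ∀ x ∈ Ω, (pot Ω κ)^[M] (fun _ => 1) x ≤ C * wt γ Ω x := by
  obtain ⟨M, hM, hε⟩ := exists_nat_div_lt hγ (sub_pos.2 hβn)
  set ε := γ / M
  have hMε : M * ε = γ := by simp only [ε]; field_simp
  have hε0 : 0 ≤ ε := by positivity
  have key : ∀ i : ℕ, i ≤ M → ∃ C : ℝ≥0, ∀ x ∈ Ω,
      (pot Ω κ)^[i] (fun _ => 1) x ≤ C * wt (i * ε) Ω x := by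
    intro i
    induction i with
    | zero => exact fun _ => ⟨1, fun x _ => by simp [wt]⟩
    | succ i ih =>
      intro hi
      obtain ⟨C, hC⟩ := ih (by omega)
      have h1 : (i : ℝ) * ε + ε ≤ γ := by
        rw [← hMε, ← add_one_mul]
        gcongr
        exact_mod_cast hi
      obtain ⟨C', hC'⟩ := hκ.exists_pot_wt_le hn hΩ hΩb (a := i * ε) (by positivity) hε0 h1
        (by linarith)
      refine ⟨C * C', fun x hx => ?_⟩
      rw [Function.iterate_succ_apply']
      calc pot Ω κ ((pot Ω κ)^[i] (fun _ => 1)) x ≤ pot Ω κ (fun y => C * wt (i * ε) Ω y) x :=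
            pot_mono_on hΩ κ hC x
        _ = C * pot Ω κ (wt (i * ε) Ω) x := pot_const_mul _ _ _
        _ ≤ C * (C' * wt (i * ε + ε) Ω x) := by gcongr; exact hC' x hx
        _ = _ := by
            push_cast
            rw [show ((i : ℝ) + 1) * ε = i * ε + ε by ring]; ring
  obtain ⟨C, hC⟩ := key M le_rfl
  exact ⟨M, C, by rwa [hMε] at hC⟩

/-- A power of the potential operator maps `L¹(Ω; δ^γ)` to `δ^γ L^∞(Ω)`. -/
theorem exists_pot_iterate_le (hn : 1 ≤ n) (hΩ : MeasurableSet Ω) (hΩb : Bornology.IsBounded Ω)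
    (hκ : KernelBounds β γ Ω κ) (hγ : 0 ≤ γ) (hβ : 0 ≤ β) (hβn : β < n) :
    ∃ (N : ℕ) (C : ℝ≥0), ∀ F : Pt n → ℝ≥0∞, AEMeasurable F (mu Ω) → ∀ x ∈ Ω,
      (pot Ω κ)^[N] F x ≤ C * wt γ Ω x * ∫⁻ y in Ω, F y * wt γ Ω y := by
  obtain ⟨N, C₁, h₁⟩ := exists_pot_iterate_le_lintegral hn hΩ hΩb hκ hγ hβ hβn
  obtain ⟨M, C₂, h₂⟩ := exists_pot_iterate_one_le hn hΩ hΩb hκ hγ hβn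
  -- The constant is allowed to be infinite here: it will be a multiple of the L¹ norm of F', about
  -- which nothing is assumed.
  have hlin : ∀ (c : ℝ≥0∞) (i : ℕ) x, (pot Ω κ)^[i] (fun _ => c) x
      ≤ c * (pot Ω κ)^[i] (fun _ => 1) x := by
    intro c i
    induction i with
    | zero => simp
    | succ i ih =>
      intro x
      rw [Function.iterate_succ_apply', Function.iterate_succ_apply']
      calc pot Ω κ ((pot Ω κ)^[i] (fun _ => c)) x
          ≤ pot Ω κ (fun y => c * (pot Ω κ)^[i] (fun _ => 1) y) x :=
            pot_mono κ (Eventually.of_forall ih) x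
        _ = _ := by
            have := aemeasurable_kernel_mul hκ.measurable
              (measurable_pot_iterate (Ω := Ω) hκ.measurable (F := fun _ => 1)
                aemeasurable_const i) x
            rw [pot, pot, ← lintegral_const_mul'' c this]
            simp_rw [mul_left_comm]
  -- The first M potentials map L¹(δ^γ) to L¹, by duality with `h₂`; the next N map L¹ to L^∞; the
  -- last M map L^∞ to δ^γ L^∞.
  refine ⟨M + (N + M), C₂ * C₁ * C₂, fun F hF x hx => ?_⟩
  rw [Function.iterate_add_apply, Function.iterate_add_apply]
  set F' := (pot Ω κ)^[M] F
  have hF' : AEMeasurable F' (mu Ω) := measurable_pot_iterate hκ.measurable hF M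
  have hint : ∫⁻ y in Ω, F' y ≤ C₂ * ∫⁻ y in Ω, F y * wt γ Ω y := by
    have := lintegral_pot_iterate_mul hn hΩ hκ hF (g := fun _ => 1) aemeasurable_const M
    simp only [mul_one] at this
    rw [this, ← lintegral_const_mul' _ _ ENNReal.coe_ne_top]
    refine lintegral_mono_ae ?_
    filter_upwards [ae_restrict_mem hΩ] with y hy
    rw [mul_left_comm]
    gcongr
    exact h₂ y hy
  have hae : (pot Ω κ)^[N] F' ≤ᵐ[mu Ω] fun _ => C₁ * ∫⁻ y in Ω, F' y := by
    filter_upwards [ae_restrict_mem hΩ] with y hy using h₁ F' hF' y hy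
  have hpt : (pot Ω κ)^[M] ((pot Ω κ)^[N] F') x
      ≤ (pot Ω κ)^[M] (fun _ => C₁ * ∫⁻ y in Ω, F' y) x := by
    -- The bound `hae` holds almost everywhere, and one more potential makes it pointwise; without
    -- outer potentials `h₁` is pointwise already.
    cases M with
    | zero => exact h₁ F' hF' x hx
    | succ M =>
      rw [Function.iterate_succ_apply', Function.iterate_succ_apply']
      exact pot_mono κ (pot_iterate_mono κ hae M) x
  calc _ ≤ _ := hpt
    _ ≤ (C₁ * ∫⁻ y in Ω, F' y) * (pot Ω κ)^[M] (fun _ => 1) x := hlin _ _ _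
    _ ≤ (C₁ * (C₂ * ∫⁻ y in Ω, F y * wt γ Ω y)) * (C₂ * wt γ Ω x) := by
        gcongr
        exact h₂ x hx
    _ = _ := by push_cast; ring

/-- Iteration of `V ≤ 𝒦 F + A 𝒦 V`. -/
lemma ae_le_sum_pot_iterate (hκ : Measurable (Function.uncurry κ)) {F V : Pt n → ℝ≥0∞}
    (hF : AEMeasurable F (mu Ω)) {A : ℝ≥0}
    (h : ∀ᵐ x ∂(mu Ω), V x ≤ pot Ω κ F x + A * pot Ω κ V x) (N : ℕ) :
    ∀ᵐ x ∂(mu Ω), V x ≤ (∑ i ∈ Finset.range N, (A : ℝ≥0∞) ^ i * (pot Ω κ)^[i + 1] F x)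
      + (A : ℝ≥0∞) ^ N * (pot Ω κ)^[N] V x := by
  have hstep : ∀ i, ∀ᵐ x ∂(mu Ω), (pot Ω κ)^[i] V x
      ≤ (pot Ω κ)^[i + 1] F x + A * (pot Ω κ)^[i + 1] V x := by
    intro i
    have h1 := pot_iterate_mono κ h i
    have h2 : (pot Ω κ)^[i] (fun x => pot Ω κ F x + A * pot Ω κ V x)
        = fun x => (pot Ω κ)^[i + 1] F x + A * (pot Ω κ)^[i + 1] V x := by
      clear h1
      induction i with
      | zero => rfl
      | succ i ih =>
        rw [Function.iterate_succ_apply', ih]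
        ext x
        rw [pot_add hκ (measurable_pot_iterate hκ hF _), pot_const_mul,
          Function.iterate_succ_apply' _ (i + 1), Function.iterate_succ_apply' _ (i + 1)]
    rw [h2] at h1
    exact h1
  induction N with
  | zero => simp
  | succ N ih =>
    filter_upwards [ih, hstep N] with x h1 h2
    refine h1.trans ?_
    rw [Finset.sum_range_succ, add_assoc]
    gcongr
    calc (A : ℝ≥0∞) ^ N * (pot Ω κ)^[N] V x
        ≤ (A : ℝ≥0∞) ^ N * ((pot Ω κ)^[N + 1] F x + A * (pot Ω κ)^[N + 1] V x) := by gcongr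
      _ = _ := by ring

end Bounds

end GreenEig

namespace GreenEig

variable {n : ℕ}

/-! ### The Hardy-Littlewood-Sobolev inequality -/

lemma lintegral_comp_dist_div (φ : ℝ → ℝ≥0∞) {r : ℝ} (hr : 0 < r) (x : Pt n) :
    ∫⁻ y : Pt n, φ (dist x y / r) = ENNReal.ofReal (r ^ n) * ∫⁻ z : Pt n, φ ‖z‖ := by
  have h1 : ∫⁻ y : Pt n, φ (dist x y / r) = ∫⁻ z : Pt n, φ (‖z‖ / r) := by
    have h := (Measure.measurePreserving_sub_left (volume : Measure (Pt n)) x).lintegral_comp_emb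
      (MeasurableEquiv.subLeft x).measurableEmbedding (fun z => φ (‖z‖ / r))
    simpa [dist_eq_norm] using h
  have hr' : r⁻¹ ≠ 0 := (inv_pos.2 hr).ne'
  have hemb : MeasurableEmbedding (fun z : Pt n => r⁻¹ • z) :=
    (Homeomorph.smulOfNeZero r⁻¹ hr').measurableEmbedding
  have h2 := hemb.lintegral_map (μ := volume) (fun z => φ ‖z‖)
  rw [Measure.map_addHaar_smul volume hr', lintegral_smul_measure] at h2
  rw [h1]
  simp only [norm_smul, norm_inv, Real.norm_eq_abs, abs_of_pos hr] at h2
  simp_rw [div_eq_inv_mul]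
  rw [← h2]
  simp [abs_of_pos hr]

/-- If `‖g‖_q ≤ 1` then the Riesz potential of `min(g, T)` is at most `C T^{1 - qσ}`. -/
lemma exists_pot_rieszKernel_min_le (hn : 1 ≤ n) {β q : ℝ} (hβ : β < n) (hq : 1 < q)
    (hqβ : q * (1 - β / n) < 1) :
    ∃ C : ℝ≥0, ∀ (Ω : Set (Pt n)) (g : Pt n → ℝ≥0∞), AEMeasurable g (mu Ω) →
      ∫⁻ y in Ω, g y ^ q ≤ 1 → ∀ x, ∀ T : ℝ, 0 < T →
      pot Ω (rieszKernel β) (fun y => min (g y) (ENNReal.ofReal T)) x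
        ≤ C * ENNReal.ofReal (T ^ (1 - q * (1 - β / n))) := by
  have hn0 : (0 : ℝ) < n := by exact_mod_cast hn
  obtain ⟨q', hqq⟩ : ∃ q', q.HolderConjugate q' := ⟨_, Real.HolderConjugate.conjExponent hq⟩
  have hq'0 : 0 < q' := hqq.symm.pos
  have hqinv : q⁻¹ + q'⁻¹ = 1 := hqq.inv_add_inv_eq_one
  have hq0 : 0 < q := by linarith
  -- For β ≤ 0 the left side of `hqβ` would be at least q > 1.
  have hβ0 : 0 < β := by
    by_contra h
    have h1 : 1 ≤ 1 - β / n := by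
      have : β / n ≤ 0 := div_nonpos_of_nonpos_of_nonneg (not_lt.1 h) hn0.le
      linarith
    nlinarith
  -- This makes the q'-th power of the kernel integrable at infinity; near the pole β < n suffices.
  have hβq' : (n : ℝ) < β * q' := by
    have h1 : 1 - β / n < q⁻¹ := by
      rw [← one_div, lt_div_iff₀ hq0]; linarith
    have h2 : q'⁻¹ < β / n := by linarith
    rw [lt_div_iff₀ hn0, inv_mul_lt_iff₀ hq'0] at h2
    linarith
  set φ₁ : ℝ → ℝ≥0∞ := fun u => if u < 1 then ENNReal.ofReal (u ^ (-β)) else 0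
  set φ₂ : ℝ → ℝ≥0∞ := fun u => if u < 1 then 0 else ENNReal.ofReal (u ^ (-β))
  have hI₁ : ∫⁻ z : Pt n, φ₁ ‖z‖ ≠ ⊤ := by
    have := (lintegral_ball_norm_rpow_lt_top hn hβ 1).ne
    rw [← lintegral_indicator measurableSet_ball] at this
    convert this using 3 with z
    simp [φ₁, indicator]
  have hI₂ : ∫⁻ z : Pt n, φ₂ ‖z‖ ^ q' ≠ ⊤ := by
    have hfin := finite_integral_one_add_norm (E := Pt n) (μ := volume) (r := β * q')
      (by simpa using hβq')
    refine (lt_of_le_of_lt (lintegral_mono (g := fun z => ENNReal.ofReal (2 ^ (β * q'))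
      * ENNReal.ofReal ((1 + ‖z‖) ^ (-(β * q')))) fun z => ?_) ?_).ne
    · by_cases hz : ‖z‖ < 1
      · simp [φ₂, hz, hq'0]
      · have hz1 : 1 ≤ ‖z‖ := not_lt.1 hz
        have hz0 : 0 < ‖z‖ := by linarith
        simp only [φ₂, hz, if_false]
        rw [ENNReal.ofReal_rpow_of_nonneg (by positivity) hq'0.le,
          ← ENNReal.ofReal_mul (by positivity)]
        apply ENNReal.ofReal_le_ofReal
        rw [← Real.rpow_mul hz0.le, neg_mul]
        calc ‖z‖ ^ (-(β * q')) ≤ ((1 + ‖z‖) / 2) ^ (-(β * q')) :=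
              Real.rpow_le_rpow_of_nonpos (by positivity) (by linarith)
                (by have := mul_pos hβ0 hq'0; linarith)
          _ = _ := by
              rw [Real.div_rpow (by positivity) (by norm_num),
                Real.rpow_neg (by norm_num : (0:ℝ) ≤ 2)]
              field_simp
    · rw [lintegral_const_mul' _ _ ENNReal.ofReal_ne_top]
      exact ENNReal.mul_lt_top ENNReal.ofReal_lt_top hfin
  set I₁ := ∫⁻ z : Pt n, φ₁ ‖z‖
  set I₂ := ∫⁻ z : Pt n, φ₂ ‖z‖ ^ q'
  have hI₂' : I₂ ^ (1 / q') ≠ ⊤ := ENNReal.rpow_ne_top_of_nonneg (by positivity) hI₂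
  refine ⟨I₁.toNNReal + (I₂ ^ (1 / q')).toNNReal, fun Ω g hg hg1 x T hT => ?_⟩
  rw [ENNReal.coe_add, ENNReal.coe_toNNReal hI₁, ENNReal.coe_toNNReal hI₂', add_mul]
  -- The radius balances the two parts: bounding the function by T inside the ball gives T r^{n-β},
  -- Hölder outside gives r^{-β+n/q'}, and both equal T^{1-q(1-β/n)}.
  set r := T ^ (-(q / n))
  have hr : 0 < r := by positivity
  have hφ₁m : Measurable fun y : Pt n => φ₁ (dist x y / r) := by
    refine Measurable.comp (g := φ₁) ?_ (by fun_prop)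
    exact Measurable.ite measurableSet_Iio (by fun_prop) measurable_const
  have hφ₂m : Measurable fun y : Pt n => φ₂ (dist x y / r) := by
    refine Measurable.comp (g := φ₂) ?_ (by fun_prop)
    exact Measurable.ite measurableSet_Iio measurable_const (by fun_prop)
  have hker : ∀ y, rieszKernel β x y
      = ENNReal.ofReal (r ^ (-β)) * (φ₁ (dist x y / r) + φ₂ (dist x y / r)) := by
    intro y
    have : φ₁ (dist x y / r) + φ₂ (dist x y / r) = ENNReal.ofReal ((dist x y / r) ^ (-β)) := by
      simp only [φ₁, φ₂]; split_ifs <;> simp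
    rw [this, ← ENNReal.ofReal_mul (by positivity), ← Real.mul_rpow hr.le (by positivity),
      mul_div_cancel₀ _ hr.ne', rieszKernel]
  have hnear : ∫⁻ y in Ω, φ₁ (dist x y / r) ≤ ENNReal.ofReal (r ^ n) * I₁ := by
    rw [← lintegral_comp_dist_div φ₁ hr x]
    exact setLIntegral_le_lintegral _ _
  have hfar : ∫⁻ y in Ω, φ₂ (dist x y / r) * g y
      ≤ ENNReal.ofReal ((r ^ n) ^ (1 / q')) * I₂ ^ (1 / q') := by
    calc ∫⁻ y in Ω, φ₂ (dist x y / r) * g y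
        ≤ (∫⁻ y in Ω, φ₂ (dist x y / r) ^ q') ^ (1 / q') * (∫⁻ y in Ω, g y ^ q) ^ (1 / q) :=
          ENNReal.lintegral_mul_le_Lp_mul_Lq _ hqq.symm hφ₂m.aemeasurable hg
      _ ≤ (ENNReal.ofReal (r ^ n) * I₂) ^ (1 / q') * 1 := by
          gcongr
          · rw [← lintegral_comp_dist_div (fun u => φ₂ u ^ q') hr x]
            exact setLIntegral_le_lintegral _ _
          · exact ENNReal.rpow_le_one hg1 (by positivity)
      _ = _ := by
          rw [mul_one, ENNReal.mul_rpow_of_nonneg _ _ (by positivity),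
            ENNReal.ofReal_rpow_of_nonneg (by positivity) (by positivity)]
  have e1 : T * (r ^ (-β) * r ^ n) = T ^ (1 - q * (1 - β / n)) := by
    simp only [r]
    rw [← Real.rpow_natCast, ← Real.rpow_mul hT.le, ← Real.rpow_mul hT.le, ← Real.rpow_add hT]
    nth_rewrite 1 [← Real.rpow_one T]
    rw [← Real.rpow_add hT]
    congr 1
    field_simp
    ring
  have e2 : r ^ (-β) * (r ^ n) ^ (1 / q') = T ^ (1 - q * (1 - β / n)) := by
    simp only [r]
    rw [← Real.rpow_natCast, ← Real.rpow_mul hT.le, ← Real.rpow_mul hT.le, ← Real.rpow_mul hT.le,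
      ← Real.rpow_add hT]
    congr 1
    rw [one_div, show q'⁻¹ = 1 - q⁻¹ by linarith]
    field_simp
    ring
  calc pot Ω (rieszKernel β) (fun y => min (g y) (ENNReal.ofReal T)) x
      ≤ ∫⁻ y in Ω, ENNReal.ofReal (r ^ (-β)) *
          (ENNReal.ofReal T * φ₁ (dist x y / r) + φ₂ (dist x y / r) * g y) := by
        refine lintegral_mono fun y => ?_
        rw [hker, mul_assoc, add_mul, mul_comm (φ₁ _)]
        gcongr
        · exact min_le_right _ _
        · exact min_le_left _ _
    _ = ENNReal.ofReal (r ^ (-β)) * (ENNReal.ofReal T * (∫⁻ y in Ω, φ₁ (dist x y / r))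
          + ∫⁻ y in Ω, φ₂ (dist x y / r) * g y) := by
        rw [lintegral_const_mul' _ _ ENNReal.ofReal_ne_top, lintegral_add_left
          (hφ₁m.const_mul _), lintegral_const_mul' _ _ ENNReal.ofReal_ne_top]
    _ ≤ ENNReal.ofReal (r ^ (-β)) * (ENNReal.ofReal T * (ENNReal.ofReal (r ^ n) * I₁)
          + ENNReal.ofReal ((r ^ n) ^ (1 / q')) * I₂ ^ (1 / q')) := by gcongr
    _ = ENNReal.ofReal (T * (r ^ (-β) * r ^ n)) * I₁
          + ENNReal.ofReal (r ^ (-β) * (r ^ n) ^ (1 / q')) * I₂ ^ (1 / q') := by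
        rw [ENNReal.ofReal_mul hT.le, ENNReal.ofReal_mul (by positivity),
          ENNReal.ofReal_mul (by positivity)]
        ring
    _ = _ := by rw [e1, e2]; ring

/-- Either g ≤ F^{p/q}, or F ≤ g^{q/p}; in each case one of the truncations is inactive. The smaller
of |F|^p and |g|^q is thus always the truncated one. -/
lemma mul_le_add_mul_min {F g : ℝ≥0∞} {p q : ℝ} (hp : 0 < p) (hq : 0 < q) :
    F * g ≤ F * min g (F ^ (p / q)) + g * min F (g ^ (q / p)) := by
  rcases le_total g (F ^ (p / q)) with h | h
  · rw [min_eq_left h]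
    exact le_self_add
  · have h' : F ≤ g ^ (q / p) := by
      have := ENNReal.rpow_le_rpow h (by positivity : 0 ≤ q / p)
      rwa [← ENNReal.rpow_mul, show p / q * (q / p) = 1 by field_simp, ENNReal.rpow_one] at this
    rw [min_eq_left h', mul_comm g F]
    exact le_add_self

/-- The bilinear form of the Hardy-Littlewood-Sobolev inequality. -/
lemma exists_lintegral_mul_pot_rieszKernel_le (hn : 1 ≤ n) {β p q : ℝ} (hβ : β < n)
    (hp : 1 < p) (hq : 1 < q) (hpq : 1 / p + 1 / q = 2 - β / n) :
    ∃ C : ℝ≥0, ∀ (Ω : Set (Pt n)) (F g : Pt n → ℝ≥0∞), AEMeasurable F (mu Ω) →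
      AEMeasurable g (mu Ω) → ∫⁻ y in Ω, F y ^ p ≤ 1 → ∫⁻ y in Ω, g y ^ q ≤ 1 →
      ∫⁻ x in Ω, pot Ω (rieszKernel β) F x * g x ≤ C := by
  have hp0 : 0 < p := by linarith
  have hq0 : 0 < q := by linarith
  have hp1 : 1 / p < 1 := by rw [div_lt_one hp0]; exact hp
  have hq1 : 1 / q < 1 := by rw [div_lt_one hq0]; exact hq
  have hqβ : q * (1 - β / n) < 1 := by
    have : 1 - β / n < 1 / q := by linarith
    rwa [lt_div_iff₀ hq0, mul_comm] at this
  have hpβ : p * (1 - β / n) < 1 := by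
    have : 1 - β / n < 1 / p := by linarith
    rwa [lt_div_iff₀ hp0, mul_comm] at this
  obtain ⟨C₁, h₁⟩ := exists_pot_rieszKernel_min_le hn hβ hq hqβ
  obtain ⟨C₂, h₂⟩ := exists_pot_rieszKernel_min_le hn hβ hp hpβ
  -- The truncated bound at level T = F(x)^{p/q}. The resulting exponent 1 + (p/q)(1 - q(1 - β/n))
  -- is p by the relation between p, q and β. The statement is symmetric in p and q, so it serves
  -- both terms.
  have main : ∀ {p q : ℝ}, 1 < p → 1 < q → 1 / p + 1 / q = 2 - β / n → ∀ C : ℝ≥0,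
      ∀ {Ω : Set (Pt n)} {F g : Pt n → ℝ≥0∞} (x : Pt n),
      (∀ T : ℝ, 0 < T → pot Ω (rieszKernel β) (fun y => min (g y) (ENNReal.ofReal T)) x
        ≤ C * ENNReal.ofReal (T ^ (1 - q * (1 - β / n)))) → F x ≠ ⊤ →
      F x * pot Ω (rieszKernel β) (fun y => min (g y) (F x ^ (p / q))) x ≤ C * F x ^ p := by
    intro p q hp hq hpq C Ω F g x hT hF
    have hp0 : 0 < p := by linarith
    have hq0 : 0 < q := by linarith
    rcases eq_or_ne (F x) 0 with h0 | h0
    · simp [h0]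
    · have hFpos : 0 < (F x).toReal := ENNReal.toReal_pos h0 hF
      have hFe : F x = ENNReal.ofReal (F x).toReal := (ENNReal.ofReal_toReal hF).symm
      rw [hFe, ENNReal.ofReal_rpow_of_pos hFpos, ENNReal.ofReal_rpow_of_pos hFpos]
      set T := (F x).toReal
      calc _ ≤ ENNReal.ofReal T *
            (C * ENNReal.ofReal ((T ^ (p / q)) ^ (1 - q * (1 - β / n)))) := by
            gcongr
            exact hT _ (by positivity)
        _ = C * ENNReal.ofReal (T * (T ^ (p / q)) ^ (1 - q * (1 - β / n))) := by
            rw [ENNReal.ofReal_mul hFpos.le]; ring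
        _ = _ := by
            congr 2
            rw [← Real.rpow_mul hFpos.le]
            nth_rewrite 1 [← Real.rpow_one T]
            rw [← Real.rpow_add hFpos]
            congr 1
            rw [show 1 - β / n = 1 / p + 1 / q - 1 by linarith]
            field_simp
            ring
  refine ⟨C₁ + C₂, fun Ω F g hF hg hF1 hg1 => ?_⟩
  have hFtop : ∀ᵐ x ∂(mu Ω), F x ≠ ⊤ := by
    filter_upwards [ae_lt_top' (hF.pow_const p) (hF1.trans_lt ENNReal.one_lt_top).ne] with x hx h
    simp [h, hp0] at hx
  have hgtop : ∀ᵐ x ∂(mu Ω), g x ≠ ⊤ := by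
    filter_upwards [ae_lt_top' (hg.pow_const q) (hg1.trans_lt ENNReal.one_lt_top).ne] with x hx h
    simp [h, hq0] at hx
  have hm := measurable_rieszKernel (n := n) β
  have hm1 : AEMeasurable (Function.uncurry fun x y =>
      rieszKernel β x y * (F x * min (g y) (F x ^ (p / q)))) ((mu Ω).prod (mu Ω)) :=
    hm.aemeasurable.mul (hF.comp_fst.mul (hg.comp_snd.min (hF.comp_fst.pow_const _)))
  have hm2 : AEMeasurable (Function.uncurry fun x y =>
      rieszKernel β x y * (F y * g x)) ((mu Ω).prod (mu Ω)) :=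
    hm.aemeasurable.mul (hF.comp_snd.mul hg.comp_fst)
  have hm3 : AEMeasurable (Function.uncurry fun x y =>
      rieszKernel β x y * (g x * min (F y) (g x ^ (q / p)))) ((mu Ω).prod (mu Ω)) :=
    hm.aemeasurable.mul (hg.comp_fst.mul (hF.comp_snd.min (hg.comp_fst.pow_const _)))
  calc ∫⁻ x in Ω, pot Ω (rieszKernel β) F x * g x
      = ∫⁻ x in Ω, ∫⁻ y in Ω, rieszKernel β x y * (F y * g x) := by
        refine lintegral_congr fun x => ?_
        rw [pot, ← lintegral_mul_const'' _ (aemeasurable_kernel_mul hm hF x)]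
        simp_rw [mul_assoc]
    _ ≤ ∫⁻ x in Ω, ∫⁻ y in Ω, (rieszKernel β x y * (F y * min (g x) (F y ^ (p / q)))
          + rieszKernel β x y * (g x * min (F y) (g x ^ (q / p)))) := by
        refine lintegral_mono fun x => lintegral_mono fun y => ?_
        rw [← mul_add]
        gcongr
        exact mul_le_add_mul_min hp0 hq0
    _ = (∫⁻ x in Ω, ∫⁻ y in Ω, rieszKernel β x y * (F y * min (g x) (F y ^ (p / q))))
          + ∫⁻ x in Ω, ∫⁻ y in Ω, rieszKernel β x y * (g x * min (F y) (g x ^ (q / p))) := by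
        rw [← lintegral_add_right']
        · refine lintegral_congr fun x => lintegral_add_right' _ ?_
          exact aemeasurable_kernel_mul hm ((hF.min aemeasurable_const).const_mul _) x
        · exact hm3.lintegral_prod_right'
    _ = (∫⁻ x in Ω, ∫⁻ y in Ω, rieszKernel β x y * (F x * min (g y) (F x ^ (p / q))))
          + ∫⁻ x in Ω, ∫⁻ y in Ω, rieszKernel β x y * (g x * min (F y) (g x ^ (q / p))) := by
        congr 1
        -- The variables are exchanged so that the truncation level depends on the outer one.
        rw [lintegral_lintegral_swap hm1]
        refine lintegral_congr fun x => lintegral_congr fun y => ?_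
        rw [rieszKernel_comm]
    _ = (∫⁻ x in Ω, F x * pot Ω (rieszKernel β) (fun y => min (g y) (F x ^ (p / q))) x)
          + ∫⁻ x in Ω, g x * pot Ω (rieszKernel β) (fun y => min (F y) (g x ^ (q / p))) x := by
        congr 1
        · refine lintegral_congr fun x => ?_
          rw [pot, ← lintegral_const_mul'' _
            (aemeasurable_kernel_mul hm (hg.min aemeasurable_const) x)]
          simp_rw [mul_left_comm]
        · refine lintegral_congr fun x => ?_
          rw [pot, ← lintegral_const_mul'' _
            (aemeasurable_kernel_mul hm (hF.min aemeasurable_const) x)]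
          simp_rw [mul_left_comm]
    _ ≤ (∫⁻ x in Ω, C₁ * F x ^ p) + ∫⁻ x in Ω, C₂ * g x ^ q := by
        refine add_le_add (lintegral_mono_ae ?_) (lintegral_mono_ae ?_)
        · filter_upwards [hFtop] with x hx
          exact main hp hq hpq C₁ x (h₁ Ω g hg hg1 x) hx
        · filter_upwards [hgtop] with x hx
          exact main hq hp (by linarith) C₂ x (h₂ Ω F hF hF1 x) hx
    _ ≤ C₁ * 1 + C₂ * 1 := by
        rw [lintegral_const_mul' _ _ ENNReal.coe_ne_top, lintegral_const_mul' _ _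
          ENNReal.coe_ne_top]
        gcongr
    _ = _ := by simp

/-- A function whose pairings with the unit ball of `L^{q'}` are at most `C` has `L^q` norm at
most `C`. -/
lemma lintegral_rpow_le_of_forall_lintegral_mul_le {α : Type*} [MeasurableSpace α]
    {ν : Measure α} [IsFiniteMeasure ν] {U : α → ℝ≥0∞} (hU : AEMeasurable U ν) {p q : ℝ}
    (hpq : p.HolderConjugate q) {C : ℝ≥0∞}
    (h : ∀ g : α → ℝ≥0∞, AEMeasurable g ν → ∫⁻ x, g x ^ q ∂ν ≤ 1 → ∫⁻ x, U x * g x ∂ν ≤ C) :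
    ∫⁻ x, U x ^ p ∂ν ≤ C ^ p := by
  have hp0 := hpq.pos
  have hq0 := hpq.symm.pos
  have hp1 : 0 < p - 1 := hpq.sub_one_pos
  -- Truncation at k makes the integral X finite, so that it can be divided out; monotone
  -- convergence removes the truncation at the end.
  have key : ∀ k : ℕ, ∫⁻ x, min (U x) k ^ p ∂ν ≤ C ^ p := by
    intro k
    set X := ∫⁻ x, min (U x) k ^ p ∂ν
    have hXtop : X ≠ ⊤ := by
      refine (lt_of_le_of_lt (lintegral_mono (g := fun _ => (k : ℝ≥0∞) ^ p) fun x => ?_) ?_).ne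
      · exact ENNReal.rpow_le_rpow (min_le_right _ _) hp0.le
      · rw [lintegral_const]
        exact ENNReal.mul_lt_top (ENNReal.rpow_lt_top_of_nonneg hp0.le (by simp))
          (measure_lt_top _ _)
    rcases eq_or_ne X 0 with hX0 | hX0
    · rw [hX0]; exact zero_le
    have hm : AEMeasurable (fun x => min (U x) k) ν := hU.min aemeasurable_const
    have hpqm : (p - 1) * q = p := hpq.sub_one_mul_conj
    -- The extremal function of Hölder's inequality, normalised in L^q.
    have h1 := h (fun x => min (U x) k ^ (p - 1) * X ^ (-(1 / q)))
      ((hm.pow_const _).mul_const _) (by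
        simp_rw [ENNReal.mul_rpow_of_nonneg _ _ hq0.le, ← ENNReal.rpow_mul]
        rw [hpqm, lintegral_mul_const'' _ (hm.pow_const _),
          show -(1 / q) * q = -1 by field_simp, ENNReal.rpow_neg_one,
          ENNReal.mul_inv_cancel hX0 hXtop])
    have h2 : X ^ (1 / p) ≤ C := by
      refine le_trans (le_of_eq ?_) ((lintegral_mono
        (f := fun x => min (U x) k ^ p * X ^ (-(1 / q))) fun x => ?_).trans h1)
      · rw [lintegral_mul_const'' _ (hm.pow_const _)]
        change _ = X * _
        nth_rewrite 2 [← ENNReal.rpow_one X]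
        rw [← ENNReal.rpow_add _ _ hX0 hXtop]
        congr 1
        have := hpq.inv_add_inv_eq_one
        simp only [one_div]
        linarith
      · change min (U x) k ^ p * X ^ (-(1 / q)) ≤ U x * (min (U x) k ^ (p - 1) * X ^ (-(1 / q)))
        rw [← mul_assoc]
        gcongr
        rcases eq_or_ne (min (U x) (k : ℝ≥0∞)) 0 with h0 | h0
        · simp [h0, hp0]
        · have htop : min (U x) (k : ℝ≥0∞) ≠ ⊤ :=
            ((min_le_right _ _).trans_lt (ENNReal.natCast_lt_top k)).ne
          calc min (U x) (k : ℝ≥0∞) ^ p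
              = min (U x) (k : ℝ≥0∞) ^ (1 : ℝ) * min (U x) (k : ℝ≥0∞) ^ (p - 1) := by
                rw [← ENNReal.rpow_add _ _ h0 htop]; congr 1; ring
            _ ≤ U x * min (U x) (k : ℝ≥0∞) ^ (p - 1) := by
                rw [ENNReal.rpow_one]
                gcongr
                exact min_le_left _ _
    calc X = (X ^ (1 / p)) ^ p := by
          rw [← ENNReal.rpow_mul, one_div_mul_cancel hp0.ne', ENNReal.rpow_one]
      _ ≤ C ^ p := by gcongr
  have hlim := lintegral_tendsto_of_tendsto_of_monotone (μ := ν)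
    (f := fun (k : ℕ) x => min (U x) k ^ p) (F := fun x => U x ^ p)
    (fun k => (hU.min aemeasurable_const).pow_const _)
    (Eventually.of_forall fun x k l hkl => by
      change min (U x) k ^ p ≤ min (U x) l ^ p
      gcongr)
    (Eventually.of_forall fun x => by
      have h1 : Tendsto (fun k : ℕ => min (U x) (k : ℝ≥0∞)) atTop (nhds (min (U x) ⊤)) :=
        tendsto_const_nhds.min ENNReal.tendsto_nat_nhds_top
      rw [min_top_right] at h1
      exact (ENNReal.continuous_rpow_const.tendsto _).comp h1)
  exact le_of_tendsto' hlim key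

lemma pot_const_mul_of_ne_top {Ω : Set (Pt n)} {κ : Pt n → Pt n → ℝ≥0∞} {c : ℝ≥0∞} (hc : c ≠ ⊤)
    (F : Pt n → ℝ≥0∞) (x : Pt n) : pot Ω κ (fun y => c * F y) x = c * pot Ω κ F x := by
  lift c to ℝ≥0 using hc
  exact pot_const_mul c F x

/-- The Hardy-Littlewood-Sobolev inequality on a bounded set. -/
theorem exists_lintegral_pot_rieszKernel_rpow_le (hn : 1 ≤ n) {Ω : Set (Pt n)}
    (hΩb : Bornology.IsBounded Ω) {β p₀ p₁ : ℝ} (hβn : β < n) (hp₀ : 1 < p₀)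
    (hp₀β : p₀ * (1 - β / n) < 1) (hp₁ : 1 / p₁ = 1 / p₀ - (1 - β / n)) :
    ∃ C : ℝ≥0, ∀ F : Pt n → ℝ≥0∞, AEMeasurable F (mu Ω) →
      ∫⁻ x in Ω, pot Ω (rieszKernel β) F x ^ p₁ ≤ (C * (∫⁻ x in Ω, F x ^ p₀) ^ (1 / p₀)) ^ p₁ := by
  have hn0 : (0 : ℝ) < n := by exact_mod_cast hn
  have hp₀0 : 0 < p₀ := by linarith
  have : IsFiniteMeasure (mu Ω) := ⟨by simpa using hΩb.measure_lt_top⟩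
  have h1 : 0 < 1 / p₁ := by
    have : 1 - β / n < 1 / p₀ := by rwa [lt_div_iff₀ hp₀0, mul_comm]
    linarith
  have hp₁0 : 0 < p₁ := one_div_pos.1 h1
  have hp₁1 : 1 < p₁ := by
    have h2 : 1 / p₀ < 1 := by rwa [div_lt_one hp₀0]
    have h3 : β / n < 1 := by rwa [div_lt_one hn0]
    have : 1 / p₁ < 1 := by linarith
    rwa [div_lt_one hp₁0] at this
  obtain ⟨q, hq⟩ : ∃ q, p₁.HolderConjugate q := ⟨_, Real.HolderConjugate.conjExponent hp₁1⟩
  have hinv := hq.inv_add_inv_eq_one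
  obtain ⟨C, hC⟩ := exists_lintegral_mul_pot_rieszKernel_le hn hβn hp₀ hq.symm.lt
    (by simp only [one_div] at *; linarith)
  -- Adding 1 keeps the constant positive, so the right side is infinite when the norm of F is.
  refine ⟨C + 1, fun F hF => ?_⟩
  set I := ∫⁻ x in Ω, F x ^ p₀
  rcases eq_or_ne I 0 with hI0 | hI0
  · have hF0 : F =ᵐ[mu Ω] fun _ => 0 := by
      have := (lintegral_eq_zero_iff' (hF.pow_const p₀)).1 hI0
      filter_upwards [this] with x hx
      simpa [hp₀0, hp₀0.not_gt] using hx
    have : ∀ x, pot Ω (rieszKernel β) F x = 0 := by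
      intro x
      rw [pot_congr _ hF0]; simp [pot]
    simp [this, hp₁0]
  rcases eq_or_ne I ⊤ with hIt | hIt
  · rw [hIt, ENNReal.top_rpow_of_pos (by positivity), ENNReal.mul_top (by simp),
      ENNReal.top_rpow_of_pos hp₁0]
    exact le_top
  have hJ0 : I ^ (1 / p₀) ≠ 0 := by simp [hI0, hIt]
  have hJt : I ^ (1 / p₀) ≠ ⊤ := ENNReal.rpow_ne_top_of_nonneg (by positivity) hIt
  set J := I ^ (1 / p₀)
  have hm := measurable_rieszKernel (n := n) β
  refine (lintegral_rpow_le_of_forall_lintegral_mul_le (C := C * J)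
    (measurable_pot hm hF).aemeasurable hq fun g hg hg1 => ?_).trans ?_
  · have := hC Ω (fun y => J⁻¹ * F y) g (hF.const_mul _) hg (by
      simp_rw [ENNReal.mul_rpow_of_nonneg _ _ hp₀0.le]
      rw [lintegral_const_mul'' _ (hF.pow_const _), ENNReal.inv_rpow]
      simp only [J]
      rw [← ENNReal.rpow_mul, one_div_mul_cancel hp₀0.ne', ENNReal.rpow_one,
        ENNReal.inv_mul_cancel hI0 hIt]) hg1
    simp_rw [pot_const_mul_of_ne_top (ENNReal.inv_ne_top.2 hJ0), mul_assoc] at this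
    rw [lintegral_const_mul' _ _ (ENNReal.inv_ne_top.2 hJ0)] at this
    calc ∫⁻ x in Ω, pot Ω (rieszKernel β) F x * g x
        = J * (J⁻¹ * ∫⁻ x in Ω, pot Ω (rieszKernel β) F x * g x) := by
          rw [← mul_assoc, ENNReal.mul_inv_cancel hJ0 hJt, one_mul]
      _ ≤ J * C := by gcongr
      _ = _ := mul_comm _ _
  · refine ENNReal.rpow_le_rpow ?_ hp₁0.le
    push_cast
    exact mul_le_mul' le_self_add le_rfl

end GreenEig

namespace GreenEig

variable {n : ℕ}

/-! ### Estimates of potentials in Lebesgue spaces -/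

lemma eLpNorm_ofReal_eq {α : Type*} [MeasurableSpace α] {ν : Measure α} (F : α → ℝ≥0∞) {p : ℝ}
    (hp : 0 < p) : eLpNorm F (ENNReal.ofReal p) ν = (∫⁻ x, F x ^ p ∂ν) ^ (1 / p) := by
  rw [eLpNorm_eq_lintegral_rpow_enorm_toReal (by simpa using hp) ENNReal.ofReal_ne_top,
    ENNReal.toReal_ofReal hp.le]
  simp

/-- Jensen's inequality for the measure w dν, obtained from Hölder with exponents 1/p and 1 - 1/p
applied to a^p w and w. -/
lemma rpow_lintegral_mul_le {α : Type*} [MeasurableSpace α] {ν : Measure α} {a w : α → ℝ≥0∞}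
    (ha : AEMeasurable a ν) (hw : AEMeasurable w ν) {p : ℝ} (hp : 1 ≤ p) :
    (∫⁻ x, a x * w x ∂ν) ^ p ≤ (∫⁻ x, a x ^ p * w x ∂ν) * (∫⁻ x, w x ∂ν) ^ (p - 1) := by
  have hp0 : 0 < p := by linarith
  have hp1 : 1 / p ≤ 1 := by rw [div_le_one hp0]; exact hp
  have h := ENNReal.lintegral_mul_norm_pow_le (μ := ν) (f := fun x => a x ^ p * w x) (g := w)
    ((ha.pow_const _).mul hw) hw (p := 1 / p) (q := 1 - 1 / p) (by positivity) (by linarith)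
    (by ring)
  have e : ∀ x, (a x ^ p * w x) ^ (1 / p) * w x ^ (1 - 1 / p) = a x * w x := by
    intro x
    rw [ENNReal.mul_rpow_of_nonneg _ _ (by positivity), ← ENNReal.rpow_mul, mul_assoc,
      ← ENNReal.rpow_add_of_nonneg _ _ (by positivity) (by linarith), mul_one_div_cancel hp0.ne']
    simp
  simp_rw [e] at h
  calc (∫⁻ x, a x * w x ∂ν) ^ p
      ≤ ((∫⁻ x, a x ^ p * w x ∂ν) ^ (1 / p) * (∫⁻ x, w x ∂ν) ^ (1 - 1 / p)) ^ p := by gcongr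
    _ = _ := by
        rw [ENNReal.mul_rpow_of_nonneg _ _ hp0.le, ← ENNReal.rpow_mul, ← ENNReal.rpow_mul,
          one_div_mul_cancel hp0.ne', ENNReal.rpow_one]
        congr 2
        field_simp

section Bounds

variable {β γ : ℝ} {Ω : Set (Pt n)} {κ : Pt n → Pt n → ℝ≥0∞}

/-- Potentials are bounded on `L^p(Ω)`. -/
lemma exists_eLpNorm_pot_iterate_le (hn : 1 ≤ n) (hΩ : MeasurableSet Ω)
    (hΩb : Bornology.IsBounded Ω) (hκ : KernelBounds β γ Ω κ) (hγ : 0 ≤ γ) (hβn : β < n)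
    {p : ℝ} (hp : 1 ≤ p) (i : ℕ) :
    ∃ C : ℝ≥0, ∀ F : Pt n → ℝ≥0∞, AEMeasurable F (mu Ω) →
      eLpNorm ((pot Ω κ)^[i] F) (ENNReal.ofReal p) (mu Ω)
        ≤ C * eLpNorm F (ENNReal.ofReal p) (mu Ω) := by
  have hp0 : 0 < p := by linarith
  have hm := hκ.measurable
  obtain ⟨A, hA⟩ : ∃ A : ℝ≥0, ∀ x ∈ Ω, pot Ω κ (fun _ => 1) x ≤ A := by
    obtain ⟨c, hc⟩ := hκ.exists_pot_le hn hΩ hγ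
    obtain ⟨A, hA⟩ := exists_lintegral_rieszKernel_le hn hΩb hβn
    refine ⟨c * A, fun x hx => (hc _ x hx).trans ?_⟩
    push_cast
    gcongr
    simpa [pot] using hA x hx
  have step : ∀ F : Pt n → ℝ≥0∞, AEMeasurable F (mu Ω) →
      eLpNorm (pot Ω κ F) (ENNReal.ofReal p) (mu Ω)
        ≤ A * eLpNorm F (ENNReal.ofReal p) (mu Ω) := by
    intro F hF
    rw [eLpNorm_ofReal_eq _ hp0, eLpNorm_ofReal_eq _ hp0]
    -- Schur's test: Jensen in the measure κ(x, y) dy gives (𝒦F)^p ≤ A^{p-1} 𝒦(F^p), and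
    -- self-adjointness moves 𝒦 onto the constant 1.
    have h1 : ∫⁻ x in Ω, pot Ω κ F x ^ p ≤ (A : ℝ≥0∞) ^ p * ∫⁻ x in Ω, F x ^ p := by
      calc ∫⁻ x in Ω, pot Ω κ F x ^ p
          ≤ ∫⁻ x in Ω, (A : ℝ≥0∞) ^ (p - 1) * (pot Ω κ (fun y => F y ^ p) x * 1) := by
            refine lintegral_mono_ae ?_
            filter_upwards [ae_restrict_mem hΩ] with x hx
            have := rpow_lintegral_mul_le (ν := mu Ω) (a := F) (w := κ x) hF
              hm.of_uncurry_left.aemeasurable hp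
            simp_rw [mul_comm _ (κ x _)] at this
            refine this.trans ?_
            rw [mul_one, mul_comm]
            gcongr
            · simpa [pot] using hA x hx
            · simp [pot]
        _ = (A : ℝ≥0∞) ^ (p - 1) * ∫⁻ x in Ω, F x ^ p * pot Ω κ (fun _ => 1) x := by
            rw [lintegral_const_mul' _ _ (ENNReal.rpow_ne_top_of_nonneg (by linarith)
              ENNReal.coe_ne_top), lintegral_pot_mul hn hΩ hκ (hF.pow_const _) aemeasurable_const]
        _ ≤ (A : ℝ≥0∞) ^ (p - 1) * ∫⁻ x in Ω, F x ^ p * A := by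
            refine mul_le_mul' le_rfl (lintegral_mono_ae ?_)
            filter_upwards [ae_restrict_mem hΩ] with x hx
            gcongr
            exact hA x hx
        _ = (A : ℝ≥0∞) ^ (p - 1) * (A : ℝ≥0∞) ^ (1 : ℝ) * ∫⁻ x in Ω, F x ^ p := by
            rw [lintegral_mul_const' _ _ ENNReal.coe_ne_top, ENNReal.rpow_one]; ring
        _ = _ := by
            rw [← ENNReal.rpow_add_of_nonneg _ _ (by linarith) (by norm_num)]
            simp
    calc (∫⁻ x in Ω, pot Ω κ F x ^ p) ^ (1 / p)
        ≤ ((A : ℝ≥0∞) ^ p * ∫⁻ x in Ω, F x ^ p) ^ (1 / p) := by gcongr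
      _ = _ := by
          rw [ENNReal.mul_rpow_of_nonneg _ _ (by positivity), ← ENNReal.rpow_mul,
            mul_one_div_cancel hp0.ne', ENNReal.rpow_one]
  refine ⟨A ^ i, fun F hF => ?_⟩
  induction i with
  | zero => simp
  | succ i ih =>
    rw [Function.iterate_succ_apply']
    calc _ ≤ A * eLpNorm ((pot Ω κ)^[i] F) (ENNReal.ofReal p) (mu Ω) :=
          step _ (measurable_pot_iterate hm hF i)
      _ ≤ A * ((A ^ i : ℝ≥0) * eLpNorm F (ENNReal.ofReal p) (mu Ω)) := by gcongr
      _ = _ := by push_cast; ring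

/-- Potentials map `L¹(Ω)` to `L^p(Ω)`. -/
lemma exists_eLpNorm_pot_iterate_le_eLpNorm_one (hn : 1 ≤ n) (hΩ : MeasurableSet Ω)
    (hΩb : Bornology.IsBounded Ω) (hκ : KernelBounds β γ Ω κ) (hγ : 0 ≤ γ) (hβn : β < n)
    {p : ℝ} (hp : 1 ≤ p) (hpβ : p * β < n) (i : ℕ) :
    ∃ C : ℝ≥0, ∀ F : Pt n → ℝ≥0∞, AEMeasurable F (mu Ω) →
      eLpNorm ((pot Ω κ)^[i + 1] F) (ENNReal.ofReal p) (mu Ω) ≤ C * eLpNorm F 1 (mu Ω) := by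
  have hp0 : 0 < p := by linarith
  have hm := measurable_rieszKernel (n := n) β
  obtain ⟨c, hc⟩ := hκ.exists_pot_le hn hΩ hγ
  obtain ⟨A, hA⟩ := exists_lintegral_rieszKernel_le hn hΩb hpβ
  obtain ⟨C₁, hC₁⟩ := exists_eLpNorm_pot_iterate_le hn hΩ hΩb hκ hγ hβn le_rfl i
  rw [ENNReal.ofReal_one] at hC₁
  have hpow : ∀ x y : Pt n, rieszKernel β x y ^ p = rieszKernel (p * β) x y := by
    intro x y
    rw [rieszKernel, rieszKernel, ENNReal.ofReal_rpow_of_nonneg (by positivity) hp0.le,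
      ← Real.rpow_mul dist_nonneg]
    congr 2; ring
  refine ⟨c * (A ^ (1 / p)) * C₁, fun F hF => ?_⟩
  rw [Function.iterate_succ_apply']
  have hF' := measurable_pot_iterate hκ.measurable hF i
  have hF'1 := hC₁ F hF
  set F' := (pot Ω κ)^[i] F
  set X := eLpNorm F' 1 (mu Ω)
  have hX : ∫⁻ y in Ω, F' y = X := by simp [X, eLpNorm_one_eq_lintegral_enorm]
  -- Now Jensen is used in the measure F' dy, so that the power falls on the kernel; its exponent pβ
  -- is still below n.
  have h1 : ∫⁻ x in Ω, pot Ω (rieszKernel β) F' x ^ p ≤ A * X ^ p := by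
    calc ∫⁻ x in Ω, pot Ω (rieszKernel β) F' x ^ p
        ≤ ∫⁻ x in Ω, (∫⁻ y in Ω, rieszKernel (p * β) x y * F' y) * X ^ (p - 1) := by
          refine lintegral_mono fun x => ?_
          have := rpow_lintegral_mul_le (ν := mu Ω) (a := rieszKernel β x) (w := F')
            hm.of_uncurry_left.aemeasurable hF' hp
          simp only [hpow, hX] at this
          exact this
      _ = (∫⁻ x in Ω, ∫⁻ y in Ω, rieszKernel (p * β) x y * F' y) * X ^ (p - 1) := by
          rw [lintegral_mul_const'']
          exact (measurable_pot (measurable_rieszKernel _) hF').aemeasurable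
      _ = (∫⁻ y in Ω, ∫⁻ x in Ω, rieszKernel (p * β) x y * F' y) * X ^ (p - 1) := by
          rw [lintegral_lintegral_swap]
          exact (measurable_rieszKernel _).aemeasurable.mul hF'.comp_snd
      _ ≤ (∫⁻ y in Ω, A * F' y) * X ^ (p - 1) := by
          gcongr ?_ * _
          refine lintegral_mono_ae ?_
          filter_upwards [ae_restrict_mem hΩ] with y hy
          rw [lintegral_mul_const _ (measurable_rieszKernel _).of_uncurry_right]
          gcongr
          simp_rw [rieszKernel_comm _ _ y]
          exact hA y hy
      _ = A * (X ^ (1 : ℝ) * X ^ (p - 1)) := by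
          rw [lintegral_const_mul' _ _ ENNReal.coe_ne_top, hX, ENNReal.rpow_one, mul_assoc]
      _ = _ := by
          rw [← ENNReal.rpow_add_of_nonneg _ _ (by norm_num) (by linarith)]
          simp
  have h2 : eLpNorm (pot Ω κ F') (ENNReal.ofReal p) (mu Ω)
      ≤ c * eLpNorm (pot Ω (rieszKernel β) F') (ENNReal.ofReal p) (mu Ω) := by
    have := eLpNorm_le_nnreal_smul_eLpNorm_of_ae_le_mul' (μ := mu Ω) (f := pot Ω κ F')
      (g := pot Ω (rieszKernel β) F') (c := c) (by
        filter_upwards [ae_restrict_mem hΩ] with x hx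
        simpa using hc F' x hx) (ENNReal.ofReal p)
    simpa [ENNReal.smul_def] using this
  calc _ ≤ _ := h2
    _ ≤ c * (A * X ^ p) ^ (1 / p) := by
        rw [eLpNorm_ofReal_eq _ hp0]
        gcongr
    _ = c * ((A : ℝ≥0∞) ^ (1 / p) * X) := by
        rw [ENNReal.mul_rpow_of_nonneg _ _ (by positivity), ← ENNReal.rpow_mul,
          mul_one_div_cancel hp0.ne', ENNReal.rpow_one]
    _ ≤ c * ((A : ℝ≥0∞) ^ (1 / p) * (C₁ * eLpNorm F 1 (mu Ω))) := by gcongr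
    _ = _ := by
        push_cast
        rw [ENNReal.coe_rpow_of_nonneg _ (by positivity)]
        ring

/-- Potentials map `L^{p₀}(Ω)` to `L^{p₁}(Ω)`. -/
lemma exists_eLpNorm_pot_iterate_le_of_one_div_eq (hn : 1 ≤ n) (hΩ : MeasurableSet Ω)
    (hΩb : Bornology.IsBounded Ω) (hκ : KernelBounds β γ Ω κ) (hγ : 0 ≤ γ) (hβn : β < n)
    {p₀ p₁ : ℝ} (hp₀ : 1 < p₀) (hp₀β : p₀ * (1 - β / n) < 1) (hp₁0 : 0 < p₁)
    (hp₁ : 1 / p₁ = 1 / p₀ - (1 - β / n)) (i : ℕ) :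
    ∃ C : ℝ≥0, ∀ F : Pt n → ℝ≥0∞, AEMeasurable F (mu Ω) →
      eLpNorm ((pot Ω κ)^[i + 1] F) (ENNReal.ofReal p₁) (mu Ω)
        ≤ C * eLpNorm F (ENNReal.ofReal p₀) (mu Ω) := by
  have hp₀0 : 0 < p₀ := by linarith
  obtain ⟨c, hc⟩ := hκ.exists_pot_le hn hΩ hγ
  obtain ⟨A, hA⟩ := exists_lintegral_pot_rieszKernel_rpow_le hn hΩb hβn hp₀ hp₀β hp₁
  obtain ⟨C₁, hC₁⟩ := exists_eLpNorm_pot_iterate_le hn hΩ hΩb hκ hγ hβn hp₀.le i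
  refine ⟨c * A * C₁, fun F hF => ?_⟩
  rw [Function.iterate_succ_apply']
  have hF' := measurable_pot_iterate hκ.measurable hF i
  have hF'1 := hC₁ F hF
  set F' := (pot Ω κ)^[i] F
  have h2 : eLpNorm (pot Ω κ F') (ENNReal.ofReal p₁) (mu Ω)
      ≤ c * eLpNorm (pot Ω (rieszKernel β) F') (ENNReal.ofReal p₁) (mu Ω) := by
    have := eLpNorm_le_nnreal_smul_eLpNorm_of_ae_le_mul' (μ := mu Ω) (f := pot Ω κ F')
      (g := pot Ω (rieszKernel β) F') (c := c) (by
        filter_upwards [ae_restrict_mem hΩ] with x hx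
        simpa using hc F' x hx) (ENNReal.ofReal p₁)
    simpa [ENNReal.smul_def] using this
  calc _ ≤ _ := h2
    _ ≤ c * ((A * eLpNorm F' (ENNReal.ofReal p₀) (mu Ω)) ^ p₁) ^ (1 / p₁) := by
        rw [eLpNorm_ofReal_eq _ hp₁0, eLpNorm_ofReal_eq _ hp₀0]
        gcongr
        exact hA F' hF'
    _ = c * (A * eLpNorm F' (ENNReal.ofReal p₀) (mu Ω)) := by
        rw [← ENNReal.rpow_mul, mul_one_div_cancel hp₁0.ne', ENNReal.rpow_one]
    _ ≤ c * (A * (C₁ * eLpNorm F (ENNReal.ofReal p₀) (mu Ω))) := by gcongr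
    _ = _ := by push_cast; ring

/-- Interior sup bounds of potentials. -/
lemma exists_pot_iterate_le_on_thickening (hn : 1 ≤ n) (hΩ : MeasurableSet Ω)
    (hΩb : Bornology.IsBounded Ω) (hκ : KernelBounds β γ Ω κ) (hγ : 0 ≤ γ) (hβ : 0 ≤ β)
    (hβn : β < n) (K : Set (Pt n)) (i : ℕ) (t : ℝ) {ε : ℝ} (hε : 0 < ε) :
    ∃ C : ℝ≥0, ∀ F : Pt n → ℝ≥0∞, AEMeasurable F (mu Ω) → ∀ B : ℝ≥0∞,
      (∀ᵐ y ∂(mu Ω), y ∈ Metric.thickening (t + ε) K → F y ≤ B) →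
      ∀ x ∈ Ω, x ∈ Metric.thickening t K →
        (pot Ω κ)^[i + 1] F x ≤ C * (B + ∫⁻ y in Ω, F y * wt γ Ω y) := by
  have hm := hκ.measurable
  have step : ∀ (t : ℝ) {ε : ℝ}, 0 < ε → ∃ C : ℝ≥0, ∀ F : Pt n → ℝ≥0∞, AEMeasurable F (mu Ω) →
      ∀ B : ℝ≥0∞, (∀ᵐ y ∂(mu Ω), y ∈ Metric.thickening (t + ε) K → F y ≤ B) →
      ∀ x ∈ Ω, x ∈ Metric.thickening t K →
        pot Ω κ F x ≤ C * (B + ∫⁻ y in Ω, F y * wt γ Ω y) := by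
    intro t ε hε
    obtain ⟨c, hc⟩ := hκ.gain
    obtain ⟨A, hA⟩ := exists_lintegral_rieszKernel_le hn hΩb hβn
    set E : ℝ≥0 := (ε ^ (-(β + γ))).toNNReal
    refine ⟨c * A + c * E, fun F hF B hFB x hx hxt => ?_⟩
    -- Near K the datum is bounded by B. Farther away |x-y| ≥ ε, and the gain with a = 0 and full
    -- power γ, with x and y exchanged, bounds the kernel by a multiple of δ(y)^γ.
    have hpt : ∀ᵐ y ∂(mu Ω), κ x y * F y
        ≤ c * rieszKernel β x y * B + (c * E : ℝ≥0) * (F y * wt γ Ω y) := by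
      filter_upwards [hFB, ae_ne hn Ω x, ae_restrict_mem hΩ] with y hy hyx hyΩ
      by_cases hyt : y ∈ Metric.thickening (t + ε) K
      · have h1 := hc 0 0 le_rfl le_rfl (by simpa using hγ) x hx y hyΩ hyx.symm
        simp only [wt, Real.rpow_zero, ENNReal.ofReal_one, mul_one, add_zero] at h1
        refine le_add_right ?_
        gcongr
        exact hy hyt
      · have hd : ε ≤ dist y x := by
          by_contra! hlt
          obtain ⟨z, hz, hxz⟩ := Metric.mem_thickening_iff.1 hxt
          exact hyt (Metric.mem_thickening_iff.2
            ⟨z, hz, (dist_triangle y x z).trans_lt (by linarith)⟩)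
        have h1 := hc 0 γ le_rfl hγ (by simp) y hyΩ x hx hyx
        simp only [wt, Real.rpow_zero, ENNReal.ofReal_one, mul_one, zero_add] at h1
        have h2 : rieszKernel (β + γ) y x ≤ E :=
          ENNReal.ofReal_le_ofReal (Real.rpow_le_rpow_of_nonpos hε hd (by linarith))
        refine le_add_left ?_
        rw [hκ.symm x hx y hyΩ hyx.symm]
        calc κ y x * F y ≤ (c * wt γ Ω y * E) * F y := by
              gcongr
              exact h1.trans (by gcongr; exact le_rfl)
          _ = _ := by push_cast; ring
    calc pot Ω κ F x
        ≤ ∫⁻ y in Ω, (c * rieszKernel β x y * B + (c * E : ℝ≥0) * (F y * wt γ Ω y)) :=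
          lintegral_mono_ae hpt
      _ = c * (∫⁻ y in Ω, rieszKernel β x y) * B
            + (c * E : ℝ≥0) * ∫⁻ y in Ω, F y * wt γ Ω y := by
          have hr : Measurable fun y : Pt n => rieszKernel β x y :=
            (measurable_rieszKernel β).of_uncurry_left
          rw [lintegral_add_left ((hr.const_mul _).mul_const _),
            lintegral_mul_const _ (hr.const_mul _), lintegral_const_mul _ hr,
            lintegral_const_mul' _ _ ENNReal.coe_ne_top]
      _ ≤ c * A * B + (c * E : ℝ≥0) * ∫⁻ y in Ω, F y * wt γ Ω y := by
          gcongr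
          exact hA x hx
      _ ≤ _ := by
          rw [mul_add]
          push_cast
          gcongr
          · exact le_self_add
          · exact le_add_self
  induction i generalizing t ε with
  | zero => exact step t hε
  | succ i ih =>
    -- Half of the margin goes to the inner potentials and half to the last one.
    obtain ⟨C₁, h₁⟩ := ih (t + ε / 2) (half_pos hε)
    obtain ⟨C₂, h₂⟩ := step t (half_pos hε)
    obtain ⟨C₃, h₃⟩ := exists_lintegral_pot_iterate_mul_wt_le hn hΩ hΩb hκ hγ hβn (i + 1)
    refine ⟨C₂ * (C₁ + C₃), fun F hF B hFB x hx hxt => ?_⟩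
    rw [Function.iterate_succ_apply']
    set Y := ∫⁻ y in Ω, F y * wt γ Ω y
    have h4 := h₂ _ (measurable_pot_iterate hm hF (i + 1)) (C₁ * (B + Y)) (by
      filter_upwards [ae_restrict_mem hΩ] with y hy hyt
      refine h₁ F hF B ?_ y hy hyt
      rwa [add_assoc, add_halves]) x hx hxt
    calc _ ≤ _ := h4
      _ ≤ C₂ * (C₁ * (B + Y) + C₃ * (B + Y)) := by
          gcongr
          exact (h₃ F hF).trans (by gcongr; exact le_add_self)
      _ = _ := by push_cast; ring

end Bounds

end GreenEig

namespace GreenEig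

variable {n : ℕ}

/-! ### Integral operators on `L²(Ω)` -/

/-- The function `x ↦ ∫_Ω G(x, y) f(y) dy`. -/
noncomputable def intPot (Ω : Set (Pt n)) (G : Pt n → Pt n → ℝ) (f : Pt n → ℝ) (x : Pt n) : ℝ :=
  ∫ y in Ω, G x y * f y

lemma intPot_congr {Ω : Set (Pt n)} (G : Pt n → Pt n → ℝ) {f g : Pt n → ℝ}
    (h : f =ᵐ[mu Ω] g) : intPot Ω G f = intPot Ω G g := by
  ext x
  refine integral_congr_ae ?_
  filter_upwards [h] with y hy
  rw [hy]

lemma enorm_intPot_le (Ω : Set (Pt n)) (G : Pt n → Pt n → ℝ) (f : Pt n → ℝ) (x : Pt n) :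
    ‖intPot Ω G f x‖ₑ ≤ pot Ω (fun x y => ‖G x y‖ₑ) (fun y => ‖f y‖ₑ) x := by
  refine (enorm_integral_le_lintegral_enorm _).trans_eq ?_
  simp_rw [enorm_mul]
  rfl

lemma aestronglyMeasurable_intPot {Ω : Set (Pt n)} {G : Pt n → Pt n → ℝ}
    (hG : Measurable (Function.uncurry G)) {f : Pt n → ℝ} (hf : AEStronglyMeasurable f (mu Ω)) :
    AEStronglyMeasurable (intPot Ω G f) (mu Ω) :=
  AEStronglyMeasurable.integral_prod_right' (f := fun z : Pt n × Pt n => G z.1 z.2 * f z.2)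
    (hG.aestronglyMeasurable.mul hf.comp_snd)

lemma integrable_kernel_mul {Ω : Set (Pt n)} {G : Pt n → Pt n → ℝ}
    (hG : Measurable (Function.uncurry G)) {f : Pt n → ℝ} (hf : AEStronglyMeasurable f (mu Ω))
    {x : Pt n} (hx : pot Ω (fun x y => ‖G x y‖ₑ) (fun y => ‖f y‖ₑ) x ≠ ⊤) :
    Integrable (fun y => G x y * f y) (mu Ω) := by
  refine ⟨hG.of_uncurry_left.aestronglyMeasurable.mul hf, ?_⟩
  simp_rw [HasFiniteIntegral, enorm_mul]
  exact hx.lt_top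

lemma intPot_add {Ω : Set (Pt n)} {G : Pt n → Pt n → ℝ}
    (hG : Measurable (Function.uncurry G)) {f g : Pt n → ℝ} (hf : AEStronglyMeasurable f (mu Ω))
    (hg : AEStronglyMeasurable g (mu Ω)) {x : Pt n}
    (hfx : pot Ω (fun x y => ‖G x y‖ₑ) (fun y => ‖f y‖ₑ) x ≠ ⊤)
    (hgx : pot Ω (fun x y => ‖G x y‖ₑ) (fun y => ‖g y‖ₑ) x ≠ ⊤) :
    intPot Ω G (fun y => f y + g y) x = intPot Ω G f x + intPot Ω G g x := by
  simp_rw [intPot, mul_add]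
  exact integral_add (integrable_kernel_mul hG hf hfx) (integrable_kernel_mul hG hg hgx)

lemma intPot_const_mul (Ω : Set (Pt n)) (G : Pt n → Pt n → ℝ) (c : ℝ) (f : Pt n → ℝ) (x : Pt n) :
    intPot Ω G (fun y => c * f y) x = c * intPot Ω G f x := by
  rw [intPot, intPot, ← integral_const_mul]
  simp_rw [mul_left_comm]

/-- Fubini's theorem for a symmetric kernel. -/
lemma integral_intPot_mul {Ω : Set (Pt n)} {G : Pt n → Pt n → ℝ}
    (hG : Measurable (Function.uncurry G))
    (hsymm : ∀ᵐ x ∂(mu Ω), ∀ᵐ y ∂(mu Ω), G x y = G y x) {f g : Pt n → ℝ}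
    (hf : AEStronglyMeasurable f (mu Ω)) (hg : AEStronglyMeasurable g (mu Ω))
    (hfin : ∫⁻ x in Ω, pot Ω (fun x y => ‖G x y‖ₑ) (fun y => ‖f y‖ₑ) x * ‖g x‖ₑ ≠ ⊤) :
    ∫ x in Ω, intPot Ω G f x * g x = ∫ x in Ω, f x * intPot Ω G g x := by
  have hm : AEStronglyMeasurable (Function.uncurry fun x y => G x y * f y * g x)
      ((mu Ω).prod (mu Ω)) :=
    (hG.aestronglyMeasurable.mul hf.comp_snd).mul hg.comp_fst
  have hint : Integrable (Function.uncurry fun x y => G x y * f y * g x)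
      ((mu Ω).prod (mu Ω)) := by
    refine ⟨hm, ?_⟩
    rw [HasFiniteIntegral, lintegral_prod _ hm.enorm]
    refine lt_of_le_of_lt (le_of_eq ?_) hfin.lt_top
    refine lintegral_congr fun x => ?_
    rw [pot, ← lintegral_mul_const'' _ (aemeasurable_kernel_mul (κ := fun x y => ‖G x y‖ₑ) hG.enorm
      hf.enorm x)]
    simp [enorm_mul]
  calc ∫ x in Ω, intPot Ω G f x * g x = ∫ x in Ω, ∫ y in Ω, G x y * f y * g x := by
        simp_rw [intPot, ← integral_mul_const]
    _ = ∫ y in Ω, ∫ x in Ω, G x y * f y * g x := integral_integral_swap hint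
    _ = _ := by
        refine integral_congr_ae ?_
        filter_upwards [hsymm] with y hy
        rw [intPot, ← integral_const_mul]
        refine integral_congr_ae ?_
        filter_upwards [hy] with x hx
        rw [hx]; ring

/-- For γ = 0 the gain condition only concerns a = ε = 0, so every estimate above applies to Riesz
kernels themselves. -/
lemma kernelBounds_rieszKernel {Ω : Set (Pt n)} (a : ℝ) :
    KernelBounds a 0 Ω (rieszKernel a) := by
  refine ⟨measurable_rieszKernel a, fun x _ y _ _ => rieszKernel_comm a x y,
    ⟨1, fun b ε hb hε hbε x _ y _ _ => ?_⟩⟩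
  obtain rfl : b = 0 := by linarith
  obtain rfl : ε = 0 := by linarith
  simp [wt]

lemma pot_le_of_kernel_le (hn : 1 ≤ n) {Ω : Set (Pt n)} (hΩ : MeasurableSet Ω)
    {κ κ' : Pt n → Pt n → ℝ≥0∞} {c : ℝ≥0}
    (h : ∀ x ∈ Ω, ∀ y ∈ Ω, x ≠ y → κ x y ≤ c * κ' x y) (F : Pt n → ℝ≥0∞) {x : Pt n}
    (hx : x ∈ Ω) : pot Ω κ F x ≤ c * pot Ω κ' F x := by
  rw [pot, pot, ← lintegral_const_mul' _ _ ENNReal.coe_ne_top]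
  refine lintegral_mono_ae ?_
  filter_upwards [ae_ne hn Ω x, ae_restrict_mem hΩ] with y hyx hy
  rw [← mul_assoc]
  gcongr
  exact h x hx y hy hyx.symm

/-- Kernels dominated by a Riesz kernel define bounded operators on `L²(Ω)`. -/
lemma exists_clm_intPot (hn : 1 ≤ n) {Ω : Set (Pt n)} (hΩ : MeasurableSet Ω)
    (hΩb : Bornology.IsBounded Ω) {a : ℝ} (ha : a < n) :
    ∃ A : ℝ≥0, ∀ G : Pt n → Pt n → ℝ, Measurable (Function.uncurry G) → ∀ c : ℝ≥0,
      (∀ x ∈ Ω, ∀ y ∈ Ω, x ≠ y → ‖G x y‖ₑ ≤ c * rieszKernel a x y) →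
      ∃ T : L2 Ω →L[ℝ] L2 Ω, (∀ f : L2 Ω, T f =ᵐ[mu Ω] intPot Ω G f) ∧ ‖T‖ ≤ c * A := by
  obtain ⟨A, hA⟩ := exists_eLpNorm_pot_iterate_le hn hΩ hΩb (kernelBounds_rieszKernel a) le_rfl ha
    (p := 2) one_le_two 1
  simp only [Function.iterate_one, ENNReal.ofReal_ofNat] at hA
  -- A depends only on the exponent and on Ω: the operator norm is linear in c, and this smallness
  -- is what the compactness proof uses.
  refine ⟨A, fun G hG c hc => ?_⟩
  have hpot : ∀ f : L2 Ω, eLpNorm (pot Ω (fun x y => ‖G x y‖ₑ) (fun y => ‖f y‖ₑ)) 2 (mu Ω)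
      ≤ (c * A : ℝ≥0) * eLpNorm f 2 (mu Ω) := by
    intro f
    have h1 := eLpNorm_le_nnreal_smul_eLpNorm_of_ae_le_mul' (μ := mu Ω)
      (f := pot Ω (fun x y => ‖G x y‖ₑ) (fun y => ‖f y‖ₑ))
      (g := pot Ω (rieszKernel a) (fun y => ‖f y‖ₑ)) (c := c) (by
        filter_upwards [ae_restrict_mem hΩ] with x hx
        simpa using pot_le_of_kernel_le hn hΩ hc (fun y => ‖f y‖ₑ) hx) 2
    have h2 := hA (fun y => ‖f y‖ₑ) (Lp.aestronglyMeasurable f).enorm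
    rw [eLpNorm_enorm] at h2
    calc _ ≤ _ := h1
      _ = c * eLpNorm (pot Ω (rieszKernel a) (fun y => ‖f y‖ₑ)) 2 (mu Ω) := by
          simp [ENNReal.smul_def]
      _ ≤ c * (A * eLpNorm f 2 (mu Ω)) := by gcongr
      _ = _ := by push_cast; ring
  have hnorm : ∀ f : L2 Ω, eLpNorm (intPot Ω G f) 2 (mu Ω)
      ≤ (c * A : ℝ≥0) * eLpNorm f 2 (mu Ω) := fun f =>
    (eLpNorm_mono_enorm fun x => by simpa using enorm_intPot_le Ω G f x).trans (hpot f)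
  have hmem : ∀ f : L2 Ω, MemLp (intPot Ω G f) 2 (mu Ω) := fun f =>
    ⟨aestronglyMeasurable_intPot hG (Lp.aestronglyMeasurable f),
      (hnorm f).trans_lt (ENNReal.mul_lt_top ENNReal.coe_lt_top (Lp.eLpNorm_lt_top f))⟩
  have hfin : ∀ f : L2 Ω, ∀ᵐ x ∂(mu Ω),
      pot Ω (fun x y => ‖G x y‖ₑ) (fun y => ‖f y‖ₑ) x ≠ ⊤ := by
    intro f
    have hm := measurable_pot (Ω := Ω) (κ := fun x y => ‖G x y‖ₑ) hG.enorm (Lp.aestronglyMeasurable f).enorm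
    have h1 := (hpot f).trans_lt (ENNReal.mul_lt_top ENNReal.coe_lt_top (Lp.eLpNorm_lt_top f))
    have h0 := eLpNorm_ofReal_eq (ν := mu Ω)
      (pot Ω (fun x y => ‖G x y‖ₑ) (fun y => ‖f y‖ₑ)) two_pos
    simp only [ENNReal.ofReal_ofNat] at h0
    rw [h0] at h1
    have h2 : ∫⁻ x in Ω, pot Ω (fun x y => ‖G x y‖ₑ) (fun y => ‖f y‖ₑ) x ^ (2 : ℝ) ≠ ⊤ := by
      intro h
      rw [h] at h1
      simp at h1
    filter_upwards [ae_lt_top (hm.pow_const _) h2] with x hx h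
    change pot Ω _ _ x ^ (2 : ℝ) < ⊤ at hx
    rw [h] at hx
    simp at hx
  let T₀ : L2 Ω →ₗ[ℝ] L2 Ω :=
    { toFun := fun f => (hmem f).toLp
      map_add' := by
        intro f g
        apply Lp.ext
        filter_upwards [(hmem (f + g)).coeFn_toLp, (hmem f).coeFn_toLp, (hmem g).coeFn_toLp,
          Lp.coeFn_add (hmem f).toLp (hmem g).toLp, hfin f, hfin g] with x h1 h2 h3 h4 h5 h6
        rw [h1, h4, Pi.add_apply, h2, h3, intPot_congr G (Lp.coeFn_add f g)]
        exact intPot_add hG (Lp.aestronglyMeasurable f) (Lp.aestronglyMeasurable g) h5 h6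
      map_smul' := by
        intro r f
        apply Lp.ext
        filter_upwards [(hmem (r • f)).coeFn_toLp, (hmem f).coeFn_toLp,
          Lp.coeFn_smul r (hmem f).toLp] with x h1 h2 h3
        rw [h1, RingHom.id_apply, h3, Pi.smul_apply, h2, intPot_congr G (Lp.coeFn_smul r f)]
        exact intPot_const_mul Ω G r f x }
  refine ⟨T₀.mkContinuous (c * A) fun f => ?_, fun f => (hmem f).coeFn_toLp,
    T₀.mkContinuous_norm_le (by positivity) _⟩
  change ‖(hmem f).toLp‖ ≤ _
  rw [Lp.norm_toLp, Lp.norm_def, ← NNReal.coe_mul, ← ENNReal.coe_toReal, ← ENNReal.toReal_mul]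
  exact ENNReal.toReal_mono (ENNReal.mul_ne_top ENNReal.coe_ne_top (Lp.eLpNorm_ne_top f)) (hnorm f)

/-! ### Compactness -/

/-- Hilbert-Schmidt operators are compact. -/
lemma isCompactOperator_of_summable_norm_sq {ι E : Type*} [NormedAddCommGroup E]
    [InnerProductSpace ℝ E] [CompleteSpace E] (b : HilbertBasis ι ℝ E) (T : E →L[ℝ] E)
    (h : Summable fun i => ‖T (b i)‖ ^ 2) : IsCompactOperator T := by
  let P : Finset ι → E →L[ℝ] E := fun s => ∑ i ∈ s, (innerSL ℝ (b i)).smulRight (T (b i))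
  have hP : ∀ s, IsCompactOperator (P s) := by
    intro s
    have : P s ∈ compactOperator (RingHom.id ℝ) E E := by
      refine Submodule.sum_mem _ fun i _ => ?_
      change IsCompactOperator _
      have h1 : IsCompactOperator (innerSL ℝ (b i)) :=
        isCompactOperator_of_locallyCompactSpace_dom (innerSL ℝ (b i))
      exact h1.clm_comp (ContinuousLinearMap.toSpanSingleton ℝ (T (b i)))
    exact this
  have hPapp : ∀ s f, P s f = ∑ i ∈ s, inner ℝ (b i) f • T (b i) := by
    intro s f
    simp [P]
  classical
  refine isCompactOperator_of_tendsto (F := P) (l := atTop) ?_ (Eventually.of_forall hP)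
  rw [Metric.tendsto_nhds]
  intro ε hε
  -- The finite-rank truncations `P s` converge in operator norm: Cauchy-Schwarz and Bessel bound
  -- the error on f by ‖f‖ times the square root of a tail of the series.
  obtain ⟨s₀, hs₀⟩ := summable_iff_vanishing_norm.1 h ((ε / 2) ^ 2) (by positivity)
  filter_upwards [eventually_ge_atTop s₀] with s hs
  rw [dist_comm, dist_eq_norm]
  refine lt_of_le_of_lt (ContinuousLinearMap.opNorm_le_bound _ (half_pos hε).le fun f => ?_)
    (half_lt_self hε)
  have hsum : HasSum (fun i => inner ℝ (b i) f • T (b i)) (T f) := by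
    have := (b.hasSum_repr f).mapL T
    simpa [b.repr_apply_apply] using this
  have hlim : Tendsto (fun t : Finset ι => ‖P t f - P s f‖) atTop (nhds ‖T f - P s f‖) := by
    refine ((Tendsto.sub_const ?_ _).norm)
    simpa only [hPapp, HasSum, SummationFilter.unconditional_filter] using hsum
  refine le_of_tendsto hlim ((eventually_ge_atTop s).mono fun t hst => ?_)
  have hdiff : P t f - P s f = ∑ i ∈ t \ s, inner ℝ (b i) f • T (b i) := by
    rw [hPapp, hPapp, ← Finset.sum_sdiff hst]; simp
  have h1 := hs₀ (t \ s) (Finset.sdiff_disjoint.mono_right hs)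
  have h1' : ∑ i ∈ t \ s, ‖T (b i)‖ ^ 2 ≤ (ε / 2) ^ 2 :=
    (le_abs_self _).trans h1.le
  have h2 : ∑ i ∈ t \ s, ‖inner ℝ (b i) f‖ ^ 2 ≤ ‖f‖ ^ 2 :=
    b.orthonormal.sum_inner_products_le f
  rw [hdiff]
  calc ‖∑ i ∈ t \ s, inner ℝ (b i) f • T (b i)‖
      ≤ ∑ i ∈ t \ s, ‖inner ℝ (b i) f‖ * ‖T (b i)‖ := by
        refine (norm_sum_le _ _).trans_eq (Finset.sum_congr rfl fun i _ => norm_smul _ _)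
    _ ≤ √(∑ i ∈ t \ s, ‖inner ℝ (b i) f‖ ^ 2) * √(∑ i ∈ t \ s, ‖T (b i)‖ ^ 2) :=
        Real.sum_mul_le_sqrt_mul_sqrt _ _ _
    _ ≤ √(‖f‖ ^ 2) * √((ε / 2) ^ 2) := by gcongr
    _ = _ := by
        rw [Real.sqrt_sq (norm_nonneg _), Real.sqrt_sq (half_pos hε).le, mul_comm]

lemma norm_sq_eq_integral {Ω : Set (Pt n)} (f : L2 Ω) : ‖f‖ ^ 2 = ∫ x in Ω, f x ^ 2 := by
  rw [← real_inner_self_eq_norm_sq, L2.inner_def]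
  simp [sq]

lemma inner_eq_integral {Ω : Set (Pt n)} (f g : L2 Ω) : inner ℝ f g = ∫ x in Ω, f x * g x := by
  rw [L2.inner_def]
  simp [mul_comm]

/-- An integral operator with a bounded kernel is compact. -/
lemma isCompactOperator_of_kernel_bounded {Ω : Set (Pt n)}
    (hΩ : MeasurableSet Ω) (hΩb : Bornology.IsBounded Ω) {G : Pt n → Pt n → ℝ}
    (hG : Measurable (Function.uncurry G)) {M : ℝ} (hM : ∀ x ∈ Ω, ∀ y ∈ Ω, ‖G x y‖ ≤ M)
    {T : L2 Ω →L[ℝ] L2 Ω} (hT : ∀ f : L2 Ω, T f =ᵐ[mu Ω] intPot Ω G f) : IsCompactOperator T := by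
  have : IsFiniteMeasure (mu Ω) := ⟨by simpa using hΩb.measure_lt_top⟩
  obtain ⟨w, b, -⟩ := exists_hilbertBasis ℝ (L2 Ω)
  refine isCompactOperator_of_summable_norm_sq b T ?_
  have hk : ∀ x ∈ Ω, MemLp (G x) 2 (mu Ω) := fun x hx =>
    MemLp.of_bound hG.of_uncurry_left.aestronglyMeasurable M
      ((ae_restrict_iff' hΩ).2 (Eventually.of_forall fun y hy => hM x hx y hy))
  -- For fixed x the values (T b_i)(x) are the coefficients of G(x, ·) in the basis, so Bessel
  -- bounds the sum of their squares by ∫ M²; then x is integrated.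
  refine summable_of_sum_le (c := ∫ x in Ω, (∫ y in Ω, M ^ 2)) (fun i => by positivity)
    fun s => ?_
  have hint : ∀ i, Integrable (fun x => (T (b i)) x ^ 2) (mu Ω) := fun i =>
    (Lp.memLp (T (b i))).integrable_sq
  simp_rw [norm_sq_eq_integral]
  rw [← integral_finsetSum _ fun i _ => hint i]
  refine integral_mono_ae (integrable_finsetSum _ fun i _ => hint i) (integrable_const _) ?_
  have hall : ∀ᵐ x ∂(mu Ω), ∀ i ∈ s, (T (b i)) x = intPot Ω G (b i) x :=
    (Finset.eventually_all s).2 fun i _ => hT (b i)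
  filter_upwards [hall, ae_restrict_mem hΩ] with x hx hxΩ
  have h1 : ∀ i ∈ s, (T (b i)) x ^ 2 = ‖inner ℝ (b i) (hk x hxΩ).toLp‖ ^ 2 := by
    intro i hi
    rw [hx i hi, Real.norm_eq_abs, sq_abs, inner_eq_integral, intPot]
    congr 1
    refine integral_congr_ae ?_
    filter_upwards [(hk x hxΩ).coeFn_toLp] with y hy
    rw [hy, mul_comm]
  rw [Finset.sum_congr rfl h1]
  refine (b.orthonormal.sum_inner_products_le _).trans ?_
  rw [norm_sq_eq_integral]
  refine integral_mono_ae (Lp.memLp _).integrable_sq (integrable_const _) ?_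
  filter_upwards [(hk x hxΩ).coeFn_toLp, ae_restrict_mem hΩ] with y hy hyΩ
  rw [hy]
  have := hM x hxΩ y hyΩ
  rw [← sq_abs]
  exact pow_le_pow_left₀ (abs_nonneg _) this 2

/-- An integral operator with a kernel dominated by a Riesz kernel is compact. -/
lemma isCompactOperator_of_kernel_le (hn : 1 ≤ n) {Ω : Set (Pt n)}
    (hΩ : MeasurableSet Ω) (hΩb : Bornology.IsBounded Ω) {G : Pt n → Pt n → ℝ}
    (hG : Measurable (Function.uncurry G)) {β : ℝ} (hβ0 : 0 ≤ β) (hβ : β < n) {c : ℝ≥0}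
    (hc : ∀ x ∈ Ω, ∀ y ∈ Ω, x ≠ y → ‖G x y‖ₑ ≤ c * rieszKernel β x y)
    {T : L2 Ω →L[ℝ] L2 Ω} (hT : ∀ f : L2 Ω, T f =ᵐ[mu Ω] intPot Ω G f) : IsCompactOperator T := by
  have : IsFiniteMeasure (mu Ω) := ⟨by simpa using hΩb.measure_lt_top⟩
  set ε := ((n : ℝ) - β) / 2
  have hε : 0 < ε := by simp only [ε]; linarith
  obtain ⟨A, hA⟩ := exists_clm_intPot hn hΩ hΩb (a := β + ε) (by simp only [ε]; linarith)
  obtain ⟨A', hA'⟩ := exists_clm_intPot hn hΩ hΩb hβ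
  set r : ℕ → ℝ := fun k => 1 / ((k : ℝ) + 1)
  have hr : ∀ k, 0 < r k := fun k => by positivity
  -- The kernel is cut at distance r k from the diagonal. The outer part is bounded; the inner part
  -- satisfies |x-y|^{-β} ≤ (r k)^ε |x-y|^{-(β+ε)} with β + ε < n, so its operator norm tends to 0.
  set K : ℕ → Pt n → Pt n → ℝ := fun k x y => if dist x y < r k then 0 else G x y
  set D : ℕ → Pt n → Pt n → ℝ := fun k x y => if dist x y < r k then G x y else 0
  have hset : ∀ k, MeasurableSet {z : Pt n × Pt n | dist z.1 z.2 < r k} := fun k =>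
    measurableSet_lt measurable_dist measurable_const
  have hKm : ∀ k, Measurable (Function.uncurry (K k)) := fun k =>
    Measurable.ite (hset k) measurable_const hG
  have hDm : ∀ k, Measurable (Function.uncurry (D k)) := fun k =>
    Measurable.ite (hset k) hG measurable_const
  have hKc : ∀ k, ∀ x ∈ Ω, ∀ y ∈ Ω, x ≠ y → ‖K k x y‖ₑ ≤ c * rieszKernel β x y := by
    intro k x hx y hy hxy
    simp only [K]
    split_ifs
    · simp
    · exact hc x hx y hy hxy
  have hKb : ∀ k, ∀ x ∈ Ω, ∀ y ∈ Ω, ‖K k x y‖ ≤ c * r k ^ (-β) := by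
    intro k x hx y hy
    simp only [K]
    split_ifs with h
    · simp only [norm_zero]
      have := hr k
      positivity
    · have hd : r k ≤ dist x y := not_lt.1 h
      have hxy : x ≠ y := dist_pos.1 ((hr k).trans_le hd)
      have h1 := hc x hx y hy hxy
      rw [rieszKernel, ← ENNReal.ofReal_coe_nnreal, ← ENNReal.ofReal_mul c.coe_nonneg,
        ← ofReal_norm] at h1
      have h2 := (ENNReal.ofReal_le_ofReal_iff (by positivity)).1 h1
      refine h2.trans ?_
      have : dist x y ^ (-β) ≤ r k ^ (-β) :=
        Real.rpow_le_rpow_of_nonpos (hr k) hd (by linarith)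
      gcongr
  have hDc : ∀ k, ∀ x ∈ Ω, ∀ y ∈ Ω, x ≠ y →
      ‖D k x y‖ₑ ≤ (c * (r k ^ ε).toNNReal : ℝ≥0) * rieszKernel (β + ε) x y := by
    intro k x hx y hy hxy
    simp only [D]
    split_ifs with h
    · refine (hc x hx y hy hxy).trans ?_
      have hd := dist_pos.2 hxy
      rw [ENNReal.coe_mul, mul_assoc]
      gcongr
      change ENNReal.ofReal _ ≤ ENNReal.ofReal _ * ENNReal.ofReal _
      rw [← ENNReal.ofReal_mul (Real.rpow_nonneg (hr k).le _)]
      apply ENNReal.ofReal_le_ofReal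
      calc dist x y ^ (-β) = dist x y ^ ε * dist x y ^ (-(β + ε)) := by
            rw [← Real.rpow_add hd]; congr 1; ring
        _ ≤ r k ^ ε * dist x y ^ (-(β + ε)) := by gcongr
    · simp
  choose TK hTK _ using fun k => hA' (K k) (hKm k) c (hKc k)
  choose TD hTD hTDn using fun k => hA (D k) (hDm k) _ (hDc k)
  have hsub : ∀ k, T - TK k = TD k := by
    intro k
    refine ContinuousLinearMap.ext fun f => Lp.ext ?_
    have hTf := hT f
    have hKfin := hTK k f
    have hfm := Lp.aestronglyMeasurable f
    have h1 : ∀ᵐ x ∂(mu Ω), intPot Ω G f x = intPot Ω (K k) f x + intPot Ω (D k) f x := by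
      have hGi : ∀ᵐ x ∂(mu Ω), pot Ω (fun x y => ‖G x y‖ₑ) (fun y => ‖f y‖ₑ) x ≠ ⊤ := by
        obtain ⟨B, hB⟩ := exists_eLpNorm_pot_iterate_le hn hΩ hΩb (kernelBounds_rieszKernel β)
          le_rfl hβ (p := 1) le_rfl 1
        have h2 := hB (fun y => ‖f y‖ₑ) hfm.enorm
        simp only [Function.iterate_one, ENNReal.ofReal_one, eLpNorm_enorm] at h2
        have h3 : eLpNorm f 1 (mu Ω) < ⊤ := ((Lp.memLp f).mono_exponent one_le_two).2
        have h4 := h2.trans_lt (ENNReal.mul_lt_top ENNReal.coe_lt_top h3)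
        rw [eLpNorm_one_eq_lintegral_enorm] at h4
        simp only [enorm_eq_self] at h4
        filter_upwards [ae_lt_top (measurable_pot (measurable_rieszKernel β) hfm.enorm) h4.ne,
          ae_restrict_mem hΩ] with x hx hxΩ
        exact ((pot_le_of_kernel_le hn hΩ hc _ hxΩ).trans_lt
          (ENNReal.mul_lt_top ENNReal.coe_lt_top hx)).ne
      filter_upwards [hGi] with x hx
      have hi := integrable_kernel_mul hG hfm hx
      have hiK : Integrable (fun y => K k x y * f y) (mu Ω) := by
        refine hi.mono ((hKm k).of_uncurry_left.aestronglyMeasurable.mul hfm)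
          (Eventually.of_forall fun y => ?_)
        simp only [K]
        split_ifs <;> simp
        positivity
      have hiD : Integrable (fun y => D k x y * f y) (mu Ω) := by
        refine hi.mono ((hDm k).of_uncurry_left.aestronglyMeasurable.mul hfm)
          (Eventually.of_forall fun y => ?_)
        simp only [D]
        split_ifs <;> simp
        positivity
      rw [intPot, intPot, intPot, ← integral_add hiK hiD]
      refine integral_congr_ae (Eventually.of_forall fun y => ?_)
      simp only [K, D]
      split_ifs <;> simp
    filter_upwards [Lp.coeFn_sub (T f) (TK k f), hT f, hTK k f, hTD k f, h1]
      with x e1 e2 e3 e4 e5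
    rw [sub_apply, e1, Pi.sub_apply, e2, e3, e4, e5]
    ring
  have hlim : Tendsto TK atTop (nhds T) := by
    rw [tendsto_iff_norm_sub_tendsto_zero]
    have hr0 : Tendsto r atTop (nhds 0) := tendsto_one_div_add_atTop_nhds_zero_nat
    have h1 : Tendsto (fun k => (c : ℝ) * r k ^ ε * A) atTop (nhds 0) := by
      have := ((hr0.rpow_const (p := ε) (Or.inr hε.le)).const_mul (c : ℝ)).mul_const (A : ℝ)
      simpa [Real.zero_rpow hε.ne'] using this
    refine squeeze_zero (fun _ => norm_nonneg _) (fun k => ?_) h1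
    rw [norm_sub_rev, hsub]
    refine (hTDn k).trans_eq ?_
    rw [NNReal.coe_mul, Real.coe_toNNReal _ (Real.rpow_nonneg (hr k).le _)]
  exact isCompactOperator_of_tendsto hlim (Eventually.of_forall fun k =>
    isCompactOperator_of_kernel_bounded hΩ hΩb (hKm k) (hKb k) (hTK k))

end GreenEig

namespace GreenEig

/-! ### Enumeration of the spectrum of a compact operator -/

/-- A family of reals with finite sublevel sets can be sorted. -/
lemma exists_equiv_monotone {ι : Type*} [Infinite ι] (v : ι → ℝ)
    (hfin : ∀ c : ℝ, {i | v i ≤ c}.Finite) : ∃ e : ℕ ≃ ι, Monotone (v ∘ e) := by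
  have hcount : Countable ι := by
    have : (univ : Set ι) = ⋃ k : ℕ, {i | v i ≤ k} := by
      ext i
      simpa using exists_nat_ge (v i)
    rw [← countable_univ_iff, this]
    exact countable_iUnion fun k => (hfin k).countable
  obtain ⟨enc, henc⟩ := hcount.exists_injective_nat
  -- Ties between equal values are broken by an injection into ℕ. In this linear order initial
  -- segments are finite, which makes an infinite index type order isomorphic to ℕ.
  let _ : LinearOrder ι := LinearOrder.lift' (fun i => toLex (v i, enc i)) fun i j h => by
    have := (Prod.ext_iff.1 (toLex.injective h)).2
    exact henc this
  have hle : ∀ i j : ι, i ≤ j → v i ≤ v j := by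
    intro i j h
    rcases (Prod.Lex.le_iff.1 (show toLex (v i, enc i) ≤ toLex (v j, enc j) from h)) with h | h
    · exact h.le
    · exact h.1.le
  have hIic : ∀ i : ι, (Iic i).Finite := fun i => (hfin (v i)).subset fun j hj => hle j i hj
  let _ : LocallyFiniteOrder ι :=
    LocallyFiniteOrder.ofFiniteIcc fun a b => (hIic b).subset fun x hx => hx.2
  let _ : SuccOrder ι := LinearLocallyFiniteOrder.succOrder ι
  let _ : PredOrder ι := LinearLocallyFiniteOrder.predOrder ι
  have hbot : ∃ b : ι, ∀ i, b ≤ i := by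
    obtain ⟨i₀⟩ := (inferInstance : Nonempty ι)
    obtain ⟨b, hb, hmin⟩ := exists_min_image (Iic i₀) id (hIic i₀) ⟨i₀, le_refl i₀⟩
    refine ⟨b, fun i => ?_⟩
    rcases le_total i i₀ with h | h
    · exact hmin i h
    · exact le_trans hb h
  let _ : OrderBot ι := { bot := hbot.choose, bot_le := hbot.choose_spec }
  have : NoMaxOrder ι := ⟨fun a => by
    by_contra! h
    exact infinite_univ (α := ι) ((hIic a).subset fun i _ => h i)⟩
  exact ⟨(orderIsoNatOfLinearSuccPredArch (ι := ι)).symm.toEquiv, fun a b hab =>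
    hle _ _ ((orderIsoNatOfLinearSuccPredArch (ι := ι)).symm.monotone hab)⟩

/-- A compact, symmetric, positive and injective operator on an infinite-dimensional Hilbert space
has an orthonormal basis of eigenvectors, with eigenvalues decreasing to zero. -/
theorem exists_hilbertBasis_eigenvectors {E : Type*} [NormedAddCommGroup E]
    [InnerProductSpace ℝ E] [CompleteSpace E] (hE : ¬ FiniteDimensional ℝ E) {T : E →L[ℝ] E}
    (hc : IsCompactOperator T) (hs : ∀ f g, inner ℝ (T f) g = inner ℝ f (T g))
    (hpos : ∀ f, 0 ≤ inner ℝ (T f) f) (hinj : ∀ f, T f = 0 → f = 0) :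
    ∃ (lam : ℕ → ℝ) (φ : HilbertBasis ℕ ℝ E), Monotone lam ∧ Tendsto lam atTop atTop ∧
      ∀ j, lam j ≠ 0 ∧ T (φ j) = (lam j)⁻¹ • φ j := by
  have hsymm : (T : E →ₗ[ℝ] E).IsSymmetric := hs
  let V : ℝ → Submodule ℝ E := fun μ => Module.End.eigenspace (T : Module.End ℝ E) μ
  have hVc : ∀ μ, CompleteSpace (V μ) := fun μ => by
    have : IsClosed (V μ : Set E) := by
      have : (V μ : Set E) = {x | T x = μ • x} := by
        ext x; simp [V]
      rw [this]
      exact isClosed_eq T.continuous (continuous_const_smul μ)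
    exact this.completeSpace_coe
  choose w b hb using fun μ => exists_hilbertBasis ℝ (V μ)
  -- The index runs over orthonormal bases of all eigenspaces; a real number that is not an
  -- eigenvalue contributes nothing.
  let ι := Σ μ : ℝ, w μ
  let v : ι → E := fun i => (b i.1 i.2 : E)
  have hv : Orthonormal ℝ v :=
    (hsymm.orthogonalFamily_eigenspaces).orthonormal_sigma_orthonormal fun μ => (b μ).orthonormal
  have hTv : ∀ i : ι, T (v i) = i.1 • v i := fun i =>
    Module.End.mem_eigenspace_iff.1 (b i.1 i.2).2
  have hspan : (Submodule.span ℝ (range v))ᗮ = ⊥ := by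
    rw [eq_bot_iff, ← ContinuousLinearMap.orthogonalComplement_iSup_eigenspaces_eq_bot hc hsymm]
    intro x hx
    rw [Submodule.mem_orthogonal] at hx ⊢
    have h1 : ∀ μ, ∀ u ∈ V μ, inner ℝ u x = 0 := by
      intro μ u hu
      have h2 := (b μ).hasSum_repr ⟨u, hu⟩
      have h3 : HasSum (fun i => inner ℝ x (((b μ).repr ⟨u, hu⟩ i • b μ i : V μ) : E))
          (inner ℝ x u) := (h2.mapL (V μ).subtypeL).mapL (innerSL ℝ x)
      have h4 : ∀ i, inner ℝ x (((b μ).repr ⟨u, hu⟩ i • b μ i : V μ) : E) = (0 : ℝ) := by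
        intro i
        have := hx (v ⟨μ, i⟩) (Submodule.subset_span ⟨⟨μ, i⟩, rfl⟩)
        rw [Submodule.coe_smul, inner_smul_right, real_inner_comm, this, mul_zero]
      simp_rw [h4] at h3
      rw [real_inner_comm]
      exact h3.unique hasSum_zero
    intro u hu
    have hle : (⨆ μ, V μ) ≤ (Submodule.span ℝ {x})ᗮ := by
      refine iSup_le fun μ u hu => ?_
      rw [Submodule.mem_orthogonal_singleton_iff_inner_left]
      exact h1 μ u hu
    exact Submodule.mem_orthogonal_singleton_iff_inner_left.1 (hle hu)
  have hμpos : ∀ i : ι, 0 < i.1 := by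
    intro i
    have h1 := hpos (v i)
    rw [hTv, inner_smul_left, real_inner_self_eq_norm_sq, hv.1 i] at h1
    simp only [conj_trivial, one_pow, mul_one] at h1
    refine lt_of_le_of_ne h1 fun h0 => ?_
    have := hinj (v i) (by rw [hTv, ← h0, zero_smul])
    have h2 := hv.1 i
    rw [this, norm_zero] at h2
    exact zero_ne_one h2
  -- Infinitely many eigenvalues of size at least 1/c would give orthonormal vectors whose images
  -- are at mutual distance at least 1/c, against compactness.
  have hfin : ∀ c : ℝ, {i : ι | i.1⁻¹ ≤ c}.Finite := by
    intro c
    by_contra hinf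
    have hinf' : {i : ι | i.1⁻¹ ≤ c}.Infinite := hinf
    obtain ⟨i₀, hi₀⟩ := hinf'.nonempty
    have hc0 : 0 < c := (inv_pos.2 (hμpos i₀)).trans_le hi₀
    let s : ℕ ↪ {i : ι | i.1⁻¹ ≤ c} := hinf'.natEmbedding _
    obtain ⟨K, hK, hTK⟩ := hc.image_closedBall_subset_compact (𝕜₁ := ℝ) (f := (T : E →ₗ[ℝ] E)) 1
    obtain ⟨a, -, ψ, hψ, ha⟩ := hK.tendsto_subseq (x := fun k => T (v (s k))) fun k =>
      hTK ⟨v (s k), by simp [hv.1], rfl⟩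
    have hcau := ha.cauchySeq
    rw [Metric.cauchySeq_iff] at hcau
    obtain ⟨N, hN⟩ := hcau c⁻¹ (inv_pos.2 hc0)
    have h1 := hN N le_rfl (N + 1) (by omega)
    have hne : (s (ψ N) : ι) ≠ s (ψ (N + 1)) := by
      intro h
      have := hψ.injective (s.injective (Subtype.ext h))
      omega
    set i := (s (ψ N) : ι)
    set j := (s (ψ (N + 1)) : ι)
    have hi : c⁻¹ ≤ i.1 := inv_le_of_inv_le₀ (hμpos i) (s (ψ N)).2
    rw [dist_eq_norm] at h1
    change ‖T (v i) - T (v j)‖ < c⁻¹ at h1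
    have h2 : ‖T (v i) - T (v j)‖ ^ 2 = i.1 ^ 2 + j.1 ^ 2 := by
      rw [hTv, hTv, norm_sub_sq_real, norm_smul, norm_smul, hv.1, hv.1, inner_smul_left,
        inner_smul_right, hv.2 hne]
      simp
    have h3 : (c⁻¹) ^ 2 ≤ ‖T (v i) - T (v j)‖ ^ 2 := by
      rw [h2]
      have : (c⁻¹) ^ 2 ≤ i.1 ^ 2 := pow_le_pow_left₀ (inv_pos.2 hc0).le hi 2
      nlinarith [sq_nonneg j.1]
    exact absurd h1 (not_lt.2 (le_of_sq_le_sq h3 (norm_nonneg _)))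
  have hinf : Infinite ι := by
    by_contra hfi
    rw [not_infinite_iff_finite] at hfi
    have := Fintype.ofFinite ι
    let B := HilbertBasis.mkOfOrthogonalEqBot hv hspan
    exact hE B.toOrthonormalBasis.toBasis.finiteDimensional_of_finite
  obtain ⟨e, he⟩ := exists_equiv_monotone (fun i : ι => i.1⁻¹) hfin
  have hv' : Orthonormal ℝ (v ∘ e) := hv.comp e e.injective
  have hspan' : (Submodule.span ℝ (range (v ∘ e)))ᗮ = ⊥ := by
    rw [e.surjective.range_comp, hspan]
  refine ⟨fun j => (e j).1⁻¹, HilbertBasis.mkOfOrthogonalEqBot hv' hspan', he, ?_, fun j => ?_⟩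
  · refine tendsto_atTop_atTop.2 fun c => ?_
    have h1 : {j : ℕ | (e j).1⁻¹ ≤ c}.Finite := (hfin c).preimage e.injective.injOn
    obtain ⟨N, hN⟩ := h1.bddAbove
    refine ⟨N + 1, fun a ha => ?_⟩
    by_contra! h
    have := hN (show a ∈ {j : ℕ | (e j).1⁻¹ ≤ c} from h.le)
    omega
  · rw [HilbertBasis.coe_mkOfOrthogonalEqBot, inv_inv]
    exact ⟨(inv_pos.2 (hμpos _)).ne', hTv (e j)⟩

variable {n : ℕ}

/-- `L²(Ω)` is infinite-dimensional. -/
lemma not_finiteDimensional_L2 (hn : 1 ≤ n) {Ω : Set (Pt n)} (hΩo : IsOpen Ω)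
    (hΩne : Ω.Nonempty) : ¬ FiniteDimensional ℝ (L2 Ω) := by
  have : Nonempty (Fin n) := ⟨⟨0, hn⟩⟩
  obtain ⟨x₀, hx₀⟩ := hΩne
  obtain ⟨r, hr, hball⟩ := Metric.isOpen_iff.1 hΩo x₀ hx₀
  set ρ : ℕ → ℝ := fun k => r / ((k : ℝ) + 1)
  have hρ : ∀ k, 0 < ρ k := fun k => by positivity
  have hanti : StrictAnti ρ := strictAnti_nat_of_succ_lt fun k => by
    simp only [ρ]
    gcongr
    simp
  -- Disjoint open annuli inside Ω: their indicators are non-zero and mutually orthogonal.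
  let A : ℕ → Set (Pt n) := fun k => Metric.ball x₀ (ρ k) \ Metric.closedBall x₀ (ρ (k + 1))
  have hAo : ∀ k, IsOpen (A k) := fun k => Metric.isOpen_ball.sdiff Metric.isClosed_closedBall
  have hAm : ∀ k, MeasurableSet (A k) := fun k => (hAo k).measurableSet
  have hAΩ : ∀ k, A k ⊆ Ω := fun k x hx => hball (Metric.ball_subset_ball (by
    simp only [ρ]
    exact div_le_self hr.le (by simp)) hx.1)
  have hAne : ∀ k, (A k).Nonempty := by
    intro k
    obtain ⟨t, ht1, ht2⟩ := exists_between (hanti (Nat.lt_succ_self k))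
    obtain ⟨z, hz⟩ := exists_norm_eq (Pt n) ((hρ (k + 1)).le.trans ht1.le)
    refine ⟨x₀ + z, ?_, ?_⟩
    · simpa [hz] using ht2
    · simpa [hz] using ht1
  have hvol : ∀ k, (mu Ω) (A k) = volume (A k) := fun k => by
    rw [Measure.restrict_apply (hAm k), inter_eq_left.2 (hAΩ k)]
  have hpos : ∀ k, (mu Ω) (A k) ≠ 0 := fun k => by
    rw [hvol]
    exact ((hAo k).measure_pos _ (hAne k)).ne'
  have hfin : ∀ k, (mu Ω) (A k) ≠ ⊤ := fun k => by
    rw [hvol]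
    exact ((measure_mono sdiff_subset).trans_lt measure_ball_lt_top).ne
  have hdisj : ∀ i j, i ≠ j → A i ∩ A j = ∅ := by
    have key : ∀ i j, i < j → A i ∩ A j = ∅ := by
      intro i j hij
      ext x
      simp only [mem_inter_iff, mem_empty_iff_false, iff_false, not_and]
      intro hi hj
      have h1 : x ∈ Metric.ball x₀ (ρ (i + 1)) :=
        Metric.ball_subset_ball (hanti.antitone (Nat.succ_le_of_lt hij)) hj.1
      exact hi.2 (Metric.ball_subset_closedBall h1)
    intro i j hij
    rcases lt_or_gt_of_ne hij with h | h
    · exact key i j h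
    · rw [inter_comm]; exact key j i h
  let u : ℕ → L2 Ω := fun k => indicatorConstLp 2 (hAm k) (hfin k) (1 : ℝ)
  have hinner : ∀ i j, inner ℝ (u i) (u j) = ((mu Ω) (A i ∩ A j)).toReal := by
    intro i j
    exact L2.real_inner_indicatorConstLp_one_indicatorConstLp_one (hAm i) (hAm j)
      (hfin i) (hfin j)
  have hli : LinearIndependent ℝ u := by
    refine linearIndependent_of_ne_zero_of_inner_eq_zero (𝕜 := ℝ) (fun k h0 => ?_)
      fun i j hij => ?_
    · have h1 := hinner k k
      rw [h0, inner_zero_left, inter_self] at h1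
      exact (ENNReal.toReal_pos (hpos k) (hfin k)).ne h1
    · change inner ℝ (u i) (u j) = 0
      rw [hinner, hdisj i j hij]; simp
  intro hfd
  exact not_finite_iff_infinite.2 inferInstance hli.finite

end GreenEig

namespace GreenEig

/-! ### The resolvent in an eigenbasis -/

section Abstract

variable {E : Type*} [NormedAddCommGroup E] [InnerProductSpace ℝ E]

lemma ext_inner_basis {ι : Type*} (φ : HilbertBasis ι ℝ E) {x y : E}
    (h : ∀ j, inner ℝ (φ j) x = inner ℝ (φ j) y) : x = y := by
  refine φ.repr.injective (lp.ext (funext fun j => ?_))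
  rw [φ.repr_apply_apply, φ.repr_apply_apply, h]

lemma hasSum_inner_sq {ι : Type*} (φ : HilbertBasis ι ℝ E) (x : E) :
    HasSum (fun j => (inner ℝ (φ j) x) ^ 2) (‖x‖ ^ 2) := by
  have h := φ.hasSum_inner_mul_inner x x
  rw [real_inner_self_eq_norm_sq] at h
  refine h.congr_fun fun j => ?_
  rw [real_inner_comm (φ j) x, sq]

lemma norm_le_of_abs_inner_le {ι : Type*} (φ : HilbertBasis ι ℝ E) {x y : E} {B : ℝ} (hB : 0 ≤ B)
    (h : ∀ j, |inner ℝ (φ j) x| ≤ B * |inner ℝ (φ j) y|) : ‖x‖ ≤ B * ‖y‖ := by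
  have h1 : ‖x‖ ^ 2 ≤ B ^ 2 * ‖y‖ ^ 2 := by
    refine hasSum_le (fun j => ?_) (hasSum_inner_sq φ x) ((hasSum_inner_sq φ y).mul_left (B ^ 2))
    rw [← sq_abs, ← sq_abs (inner ℝ (φ j) y), ← mul_pow]
    exact pow_le_pow_left₀ (abs_nonneg _) (h j) 2
  rw [← mul_pow] at h1
  exact le_of_sq_le_sq h1 (by positivity)

/-- Finitely many terms, and a tail where λ_j - l ≥ 1. Since `0⁻¹ = 0`, the value l may belong to
the spectrum. -/
lemma exists_abs_inv_sub_le {lam : ℕ → ℝ} (hlim : Tendsto lam atTop atTop) (l : ℝ) :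
    ∃ B : ℝ, 0 ≤ B ∧ ∀ j, |(lam j - l)⁻¹| ≤ B := by
  obtain ⟨N, hN⟩ := (tendsto_atTop_atTop.1 hlim) (l + 1)
  refine ⟨1 + ∑ j ∈ Finset.range N, |(lam j - l)⁻¹|, by positivity, fun j => ?_⟩
  rcases lt_or_ge j N with h | h
  · have := Finset.single_le_sum (f := fun j => |(lam j - l)⁻¹|) (fun i _ => abs_nonneg _)
      (Finset.mem_range.2 h)
    linarith
  · have h1 := hN j h
    have h2 : |(lam j - l)⁻¹| ≤ 1 := by
      rw [abs_of_nonneg (inv_nonneg.2 (by linarith))]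
      exact inv_le_one_of_one_le₀ (by linarith)
    have : 0 ≤ ∑ j ∈ Finset.range N, |(lam j - l)⁻¹| := by positivity
    linarith

/-- The bounded multipliers keep the coefficients in ℓ², so the series is the vector with these
coefficients. This reduces identities for the resolvent to identities between coefficients. -/
lemma inner_tsum_resolvent (φ : HilbertBasis ℕ ℝ E) {lam : ℕ → ℝ}
    (hlim : Tendsto lam atTop atTop) (l : ℝ) (g : E) (i : ℕ) :
    inner ℝ (φ i) (∑' j, (inner ℝ (φ j) g / (lam j - l)) • φ j)
      = inner ℝ (φ i) g / (lam i - l) := by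
  obtain ⟨B, hB, hle⟩ := exists_abs_inv_sub_le hlim l
  have hmem : Memℓp (fun j => inner ℝ (φ j) g / (lam j - l)) 2 := by
    refine memℓp_gen ?_
    have hs := (hasSum_inner_sq φ g).summable.mul_left (B ^ 2)
    refine Summable.of_nonneg_of_le (fun j => by positivity) (fun j => ?_) hs
    simp only [ENNReal.toReal_ofNat, Real.rpow_ofNat, Real.norm_eq_abs, sq_abs]
    rw [div_eq_mul_inv, mul_pow, mul_comm, ← sq_abs (lam j - l)⁻¹]
    have := pow_le_pow_left₀ (abs_nonneg _) (hle j) 2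
    gcongr
  have h := (φ.hasSum_repr_symm ⟨_, hmem⟩).tsum_eq
  change (∑' j, (inner ℝ (φ j) g / (lam j - l)) • φ j) = _ at h
  rw [h, ← φ.repr_apply_apply, LinearIsometryEquiv.apply_symm_apply]

lemma inner_sub_sum (φ : HilbertBasis ℕ ℝ E) (I : ℕ) (g : E) (i : ℕ) :
    inner ℝ (φ i) (g - ∑ j ∈ Finset.range I, inner ℝ (φ j) g • φ j)
      = if i < I then 0 else inner ℝ (φ i) g := by
  rw [inner_sub_right, inner_sum]
  have : ∀ j ∈ Finset.range I, inner ℝ (φ i) (inner ℝ (φ j) g • φ j)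
      = if i = j then inner ℝ (φ i) g else 0 := by
    intro j _
    rw [inner_smul_right, orthonormal_iff_ite.1 φ.orthonormal i j]
    split_ifs with h
    · rw [h]; simp
    · simp
  rw [Finset.sum_congr rfl this, Finset.sum_ite_eq]
  simp only [Finset.mem_range]
  split_ifs <;> simp

end Abstract

/-! ### Admissible kernels and their operator on `L²(Ω)`. -/

variable {n : ℕ}

/-- The standing assumptions on the Green function in the form in which they are used. -/
structure AdmissibleKernel (β γ : ℝ) (Ω : Set (Pt n)) (G : Pt n → Pt n → ℝ) : Prop where
  one_le : 1 ≤ n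
  isOpen : IsOpen Ω
  isBounded : Bornology.IsBounded Ω
  γ_nonneg : 0 ≤ γ
  β_nonneg : 0 ≤ β
  β_lt : β < n
  measurable : Measurable (Function.uncurry G)
  symm : ∀ x ∈ Ω, ∀ y ∈ Ω, x ≠ y → G x y = G y x
  bounds : KernelBounds β γ Ω (fun x y => ‖G x y‖ₑ)

section

variable {β γ : ℝ} {Ω : Set (Pt n)} {G : Pt n → Pt n → ℝ}

lemma AdmissibleKernel.isFiniteMeasure (H : AdmissibleKernel β γ Ω G) :
    IsFiniteMeasure (mu Ω) := ⟨by simpa using H.isBounded.measure_lt_top⟩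

lemma AdmissibleKernel.measurableSet (H : AdmissibleKernel β γ Ω G) : MeasurableSet Ω :=
  H.isOpen.measurableSet

lemma AdmissibleKernel.ae_symm (H : AdmissibleKernel β γ Ω G) :
    ∀ᵐ x ∂(mu Ω), ∀ᵐ y ∂(mu Ω), G x y = G y x := by
  filter_upwards [ae_restrict_mem H.measurableSet] with x hx
  filter_upwards [ae_ne H.one_le Ω x, ae_restrict_mem H.measurableSet] with y hyx hy
  exact H.symm x hx y hy hyx.symm

lemma AdmissibleKernel.exists_kernel_le (H : AdmissibleKernel β γ Ω G) :
    ∃ c : ℝ≥0, ∀ x ∈ Ω, ∀ y ∈ Ω, x ≠ y → ‖G x y‖ₑ ≤ c * rieszKernel β x y := by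
  obtain ⟨c, hc⟩ := H.bounds.gain
  refine ⟨c, fun x hx y hy hxy => ?_⟩
  have := hc 0 0 le_rfl le_rfl (by simpa using H.γ_nonneg) x hx y hy hxy
  simpa [wt] using this

/-- The Green operator on `L²(Ω)`. -/
theorem AdmissibleKernel.exists_greenOp (H : AdmissibleKernel β γ Ω G) :
    ∃ T : L2 Ω →L[ℝ] L2 Ω, (∀ f : L2 Ω, T f =ᵐ[mu Ω] intPot Ω G f) ∧ IsCompactOperator T := by
  obtain ⟨c, hc⟩ := H.exists_kernel_le
  obtain ⟨A, hA⟩ := exists_clm_intPot H.one_le H.measurableSet H.isBounded H.β_lt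
  obtain ⟨T, hT, -⟩ := hA G H.measurable c hc
  exact ⟨T, hT, isCompactOperator_of_kernel_le H.one_le H.measurableSet H.isBounded H.measurable
    H.β_nonneg H.β_lt hc hT⟩

lemma ofReal_norm_eq_eLpNorm (f : L2 Ω) : ENNReal.ofReal ‖f‖ = eLpNorm f 2 (mu Ω) := by
  rw [Lp.norm_def, ENNReal.ofReal_toReal (Lp.eLpNorm_ne_top f)]

lemma AdmissibleKernel.inner_greenOp (H : AdmissibleKernel β γ Ω G) {T : L2 Ω →L[ℝ] L2 Ω}
    (hT : ∀ f : L2 Ω, T f =ᵐ[mu Ω] intPot Ω G f) (f g : L2 Ω) :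
    inner ℝ (T f) g = inner ℝ f (T g) := by
  have hfm := (Lp.aestronglyMeasurable f)
  have hgm := (Lp.aestronglyMeasurable g)
  have hfin : ∫⁻ x in Ω, pot Ω (fun x y => ‖G x y‖ₑ) (fun y => ‖f y‖ₑ) x * ‖g x‖ₑ ≠ ⊤ := by
    obtain ⟨C, hC⟩ := exists_eLpNorm_pot_iterate_le H.one_le H.measurableSet H.isBounded H.bounds
      H.γ_nonneg H.β_lt (p := 2) one_le_two 1
    have h1 := hC (fun y => ‖f y‖ₑ) hfm.enorm
    have h2 := ENNReal.lintegral_mul_le_Lp_mul_Lq (mu Ω) Real.HolderConjugate.two_two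
      (measurable_pot (Ω := Ω) H.bounds.measurable hfm.enorm).aemeasurable hgm.enorm
    rw [← eLpNorm_ofReal_eq _ two_pos, ← eLpNorm_ofReal_eq _ two_pos] at h2
    simp only [ENNReal.ofReal_ofNat, eLpNorm_enorm, Function.iterate_one] at h1 h2
    refine (h2.trans_lt (ENNReal.mul_lt_top (h1.trans_lt (ENNReal.mul_lt_top ENNReal.coe_lt_top
      (Lp.eLpNorm_lt_top f))) (Lp.eLpNorm_lt_top g))).ne
  rw [inner_eq_integral, inner_eq_integral]
  calc ∫ x in Ω, (T f) x * g x = ∫ x in Ω, intPot Ω G f x * g x := by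
        refine integral_congr_ae ?_
        filter_upwards [hT f] with x hx
        rw [hx]
    _ = ∫ x in Ω, f x * intPot Ω G g x :=
        integral_intPot_mul H.measurable H.ae_symm hfm hgm hfin
    _ = _ := by
        refine integral_congr_ae ?_
        filter_upwards [hT g] with x hx
        rw [hx]

lemma enorm_greenOp_le {T : L2 Ω →L[ℝ] L2 Ω} (hT : ∀ f : L2 Ω, T f =ᵐ[mu Ω] intPot Ω G f)
    (g : L2 Ω) : ∀ᵐ x ∂(mu Ω), ‖T g x‖ₑ
      ≤ pot Ω (fun x y => ‖G x y‖ₑ) (fun y => ‖g y‖ₑ) x := by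
  filter_upwards [hT g] with x hx
  rw [hx]
  exact enorm_intPot_le Ω G g x

/-! ### Existence of an eigensystem -/

/-- The compact self-adjoint operator T is a right inverse of L. Hence ⟨Tf, f⟩ = ⟨Tf, L(Tf)⟩ ≥ 0, T
is injective, and eigenvalues of L are reciprocals of those of T. -/
theorem AdmissibleKernel.exists_isEigenSystem (H : AdmissibleKernel β γ Ω G) (hΩne : Ω.Nonempty)
    {L : L2 Ω →ₗ.[ℝ] L2 Ω} (hL : IsNonneg L) (hLG : IsGreenFunction L G) :
    ∃ (lam : ℕ → ℝ) (φ : HilbertBasis ℕ ℝ (L2 Ω)), IsEigenSystem L lam φ := by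
  obtain ⟨T, hT, hTc⟩ := H.exists_greenOp
  have hLT : ∀ f : L2 Ω, ∃ h : T f ∈ L.domain, L ⟨T f, h⟩ = f := fun f =>
    (hLG (T f) f).2 (hT f)
  obtain ⟨lam, φ, hmono, hlim, heig⟩ := exists_hilbertBasis_eigenvectors
    (not_finiteDimensional_L2 H.one_le H.isOpen hΩne) hTc (H.inner_greenOp hT)
    (fun f => by
      obtain ⟨h, hf⟩ := hLT f
      have := hL ⟨T f, h⟩
      rw [hf] at this
      rwa [real_inner_comm])
    (fun f hf => by
      obtain ⟨h, h1⟩ := hLT f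
      have h2 : (⟨T f, h⟩ : L.domain) = 0 := Subtype.ext hf
      rw [h2, L.map_zero] at h1
      exact h1.symm)
  refine ⟨lam, φ, hmono, hlim, fun j => ?_⟩
  obtain ⟨h0, h1⟩ := heig j
  have h2 : φ j = T (lam j • φ j) := by
    rw [map_smul, h1, smul_smul, mul_inv_cancel₀ h0, one_smul]
  obtain ⟨h, h3⟩ := hLT (lam j • φ j)
  rw [← h2] at h
  refine ⟨h, ?_⟩
  rw [← h3]
  congr 1
  exact Subtype.ext h2

/-- The Green function property gives φ_j = T(λ_j φ_j) for any prescribed eigensystem, which also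
excludes λ_j = 0. -/
lemma IsEigenSystem.greenOp_apply {L : L2 Ω →ₗ.[ℝ] L2 Ω} (hLG : IsGreenFunction L G)
    {T : L2 Ω →L[ℝ] L2 Ω} (hT : ∀ f : L2 Ω, T f =ᵐ[mu Ω] intPot Ω G f)
    {lam : ℕ → ℝ} {φ : HilbertBasis ℕ ℝ (L2 Ω)} (hφ : IsEigenSystem L lam φ) (j : ℕ) :
    lam j ≠ 0 ∧ T (φ j) = (lam j)⁻¹ • φ j := by
  have h1 : φ j = T (lam j • φ j) := by
    refine Lp.ext ?_
    have := (hLG (φ j) (lam j • φ j)).1 (hφ.eigen j)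
    filter_upwards [this, hT (lam j • φ j)] with x h1 h2
    rw [h1, h2]; rfl
  rw [map_smul] at h1
  have h0 : lam j ≠ 0 := by
    intro h0
    rw [h0, zero_smul] at h1
    exact φ.orthonormal.ne_zero j h1
  refine ⟨h0, ?_⟩
  nth_rewrite 2 [h1]
  rw [smul_smul, inv_mul_cancel₀ h0, one_smul]

end

end GreenEig

namespace GreenEig

variable {n : ℕ}

section

variable {β γ : ℝ} {Ω : Set (Pt n)} {G : Pt n → Pt n → ℝ}

/-! ### The spaces `L¹(Ω; δ^γ)` and `δ^γ L^∞(Ω)` -/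

lemma enorm_mul_bdist_rpow (γ : ℝ) (Ω : Set (Pt n)) (a : ℝ) (x : Pt n) :
    ‖a * bdist Ω x ^ γ‖ₑ = ‖a‖ₑ * wt γ Ω x := by
  rw [enorm_mul, Real.enorm_of_nonneg (Real.rpow_nonneg (bdist_nonneg _ _) _), wt]

/-- As δ > 0 in the open set Ω, the weight can be divided out to recover measurability of f. -/
lemma AdmissibleKernel.memL1w_iff (H : AdmissibleKernel β γ Ω G) {f : Pt n → ℝ} :
    MemL1w γ Ω f ↔ AEStronglyMeasurable f (mu Ω) ∧ ∫⁻ x in Ω, ‖f x‖ₑ * wt γ Ω x ≠ ⊤ := by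
  have hw : Measurable fun x => bdist Ω x ^ γ := (measurable_bdist Ω).pow_const γ
  constructor
  · intro h
    constructor
    · have h1 : AEStronglyMeasurable (fun x => f x * bdist Ω x ^ γ * (bdist Ω x ^ γ)⁻¹) (mu Ω) :=
        h.1.mul hw.inv.aestronglyMeasurable
      refine h1.congr ?_
      filter_upwards [ae_restrict_mem H.measurableSet] with x hx
      have := Real.rpow_pos_of_pos (bdist_pos H.one_le H.isOpen H.isBounded hx) γ
      rw [mul_inv_cancel_right₀ this.ne']
    · have := h.2.ne
      simpa only [enorm_mul_bdist_rpow] using this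
  · rintro ⟨h1, h2⟩
    refine ⟨h1.mul hw.aestronglyMeasurable, ?_⟩
    simp_rw [HasFiniteIntegral, enorm_mul_bdist_rpow]
    exact h2.lt_top

lemma memWLinf_iff {ψ : L2 Ω} :
    MemWLinf γ ψ ↔ ∃ M : ℝ≥0, ∀ᵐ x ∂(mu Ω), ‖ψ x‖ₑ ≤ M * wt γ Ω x := by
  constructor
  · rintro ⟨M, hM⟩
    refine ⟨M.toNNReal, ?_⟩
    filter_upwards [hM] with x hx
    have hw := Real.rpow_nonneg (bdist_nonneg Ω x) γ
    rw [Real.enorm_eq_ofReal_abs, wt]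
    change _ ≤ ENNReal.ofReal M * _
    rw [← ENNReal.ofReal_mul' hw]
    exact ENNReal.ofReal_le_ofReal hx
  · rintro ⟨M, hM⟩
    refine ⟨M, ?_⟩
    filter_upwards [hM] with x hx
    have hw := Real.rpow_nonneg (bdist_nonneg Ω x) γ
    rw [Real.enorm_eq_ofReal_abs, wt, ← ENNReal.ofReal_coe_nnreal,
      ← ENNReal.ofReal_mul' hw] at hx
    exact (ENNReal.ofReal_le_ofReal_iff (by positivity)).1 hx

lemma lintegral_mul_le_of_enorm_le (f : Pt n → ℝ) {ψ : Pt n → ℝ} {M : ℝ≥0} (hM : ∀ᵐ x ∂(mu Ω), ‖ψ x‖ₑ ≤ M * wt γ Ω x) :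
    ∫⁻ x in Ω, ‖f x‖ₑ * ‖ψ x‖ₑ ≤ M * ∫⁻ x in Ω, ‖f x‖ₑ * wt γ Ω x := by
  rw [← lintegral_const_mul' _ _ ENNReal.coe_ne_top]
  refine lintegral_mono_ae ?_
  filter_upwards [hM] with x hx
  rw [mul_left_comm]
  gcongr

lemma AdmissibleKernel.integrable_mul (H : AdmissibleKernel β γ Ω G) {f : Pt n → ℝ}
    (hf : MemL1w γ Ω f) {ψ : L2 Ω} (hψ : MemWLinf γ ψ) :
    Integrable (fun x => f x * ψ x) (mu Ω) := by
  obtain ⟨M, hM⟩ := memWLinf_iff.1 hψ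
  obtain ⟨hfm, hf1⟩ := H.memL1w_iff.1 hf
  refine ⟨hfm.mul (Lp.aestronglyMeasurable ψ), ?_⟩
  simp_rw [HasFiniteIntegral, enorm_mul]
  exact (lintegral_mul_le_of_enorm_le f hM).trans_lt
    (ENNReal.mul_lt_top ENNReal.coe_lt_top hf1.lt_top)

lemma memL1w_add {f g : Pt n → ℝ} (hf : MemL1w γ Ω f) (hg : MemL1w γ Ω g) :
    MemL1w γ Ω (fun x => f x + g x) := by
  simp_rw [MemL1w, add_mul]
  exact Integrable.add hf hg

lemma memL1w_sub {f g : Pt n → ℝ} (hf : MemL1w γ Ω f) (hg : MemL1w γ Ω g) :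
    MemL1w γ Ω (fun x => f x - g x) := by
  simp_rw [MemL1w, sub_mul]
  exact Integrable.sub hf hg

lemma memL1w_const_mul {f : Pt n → ℝ} (hf : MemL1w γ Ω f) (c : ℝ) :
    MemL1w γ Ω (fun x => c * f x) := by
  simp_rw [MemL1w, mul_assoc]
  exact Integrable.const_mul hf c

lemma memL1w_finsetSum {ι : Type*} (s : Finset ι) {f : ι → Pt n → ℝ}
    (hf : ∀ i ∈ s, MemL1w γ Ω (f i)) : MemL1w γ Ω (fun x => ∑ i ∈ s, f i x) := by
  simp_rw [MemL1w, Finset.sum_mul]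
  exact integrable_finsetSum _ hf

lemma AdmissibleKernel.exists_lintegral_wt_le (H : AdmissibleKernel β γ Ω G) :
    ∃ C : ℝ≥0, ∀ (p : ℝ), 1 ≤ p → ∃ B : ℝ≥0, ∀ f : Pt n → ℝ, AEStronglyMeasurable f (mu Ω) →
      ∫⁻ x in Ω, ‖f x‖ₑ * wt γ Ω x ≤ C * B * eLpNorm f (ENNReal.ofReal p) (mu Ω) := by
  have := H.isFiniteMeasure
  obtain ⟨D, hD⟩ := exists_wt_le H.one_le H.isBounded H.γ_nonneg
  refine ⟨D, fun p hp => ?_⟩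
  have hp' : (1 : ℝ≥0∞) ≤ ENNReal.ofReal p := by
    rw [← ENNReal.ofReal_one]; exact ENNReal.ofReal_le_ofReal hp
  set e := 1 / (1 : ℝ≥0∞).toReal - 1 / (ENNReal.ofReal p).toReal
  have he : 0 ≤ e := by
    simp only [e, ENNReal.toReal_one, ENNReal.toReal_ofReal (by linarith : 0 ≤ p)]
    rw [sub_nonneg, div_le_div_iff₀ (by linarith) one_pos]
    linarith
  refine ⟨((mu Ω) univ ^ e).toNNReal, fun f hf => ?_⟩
  rw [ENNReal.coe_toNNReal (ENNReal.rpow_ne_top_of_nonneg he (measure_ne_top _ _))]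
  have h1 := eLpNorm_le_eLpNorm_mul_rpow_measure_univ hp' hf
  rw [eLpNorm_one_eq_lintegral_enorm] at h1
  calc ∫⁻ x in Ω, ‖f x‖ₑ * wt γ Ω x ≤ ∫⁻ x in Ω, ‖f x‖ₑ * D := by
        refine lintegral_mono_ae ?_
        filter_upwards [ae_restrict_mem H.measurableSet] with x hx
        gcongr
        exact hD x hx
    _ = (∫⁻ x in Ω, ‖f x‖ₑ) * D := lintegral_mul_const' _ _ ENNReal.coe_ne_top
    _ ≤ (eLpNorm f (ENNReal.ofReal p) (mu Ω) * (mu Ω) univ ^ e) * D := by gcongr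
    _ = _ := by ring

lemma AdmissibleKernel.exists_lintegral_wt_le_norm (H : AdmissibleKernel β γ Ω G) :
    ∃ C : ℝ≥0, ∀ g : L2 Ω, ∫⁻ x in Ω, ‖g x‖ₑ * wt γ Ω x ≤ C * ENNReal.ofReal ‖g‖ := by
  obtain ⟨C, hC⟩ := H.exists_lintegral_wt_le
  obtain ⟨B, hB⟩ := hC 2 one_le_two
  refine ⟨C * B, fun g => ?_⟩
  have := hB g (Lp.aestronglyMeasurable g)
  simp only [ENNReal.ofReal_ofNat] at this
  rwa [← ofReal_norm_eq_eLpNorm, ← ENNReal.coe_mul] at this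

lemma AdmissibleKernel.memL1w_coe (H : AdmissibleKernel β γ Ω G) (g : L2 Ω) :
    MemL1w γ Ω g := by
  obtain ⟨C, hC⟩ := H.exists_lintegral_wt_le_norm
  exact H.memL1w_iff.2 ⟨Lp.aestronglyMeasurable g,
    ((hC g).trans_lt (ENNReal.mul_lt_top ENNReal.coe_lt_top ENNReal.ofReal_lt_top)).ne⟩

lemma AdmissibleKernel.exists_norm_le (H : AdmissibleKernel β γ Ω G) :
    ∃ C : ℝ≥0, ∀ (g : L2 Ω) (M : ℝ≥0), (∀ᵐ x ∂(mu Ω), ‖g x‖ₑ ≤ M * wt γ Ω x) →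
      ‖g‖ ≤ C * M := by
  have := H.isFiniteMeasure
  obtain ⟨D, hD⟩ := exists_wt_le H.one_le H.isBounded H.γ_nonneg
  set m := (mu Ω) univ ^ (1 / (2 : ℝ))
  have hm : m ≠ ⊤ := ENNReal.rpow_ne_top_of_nonneg (by norm_num) (measure_ne_top _ _)
  refine ⟨m.toNNReal * D, fun g M hM => ?_⟩
  have h1 : eLpNorm g 2 (mu Ω) ≤ (M * D : ℝ≥0) * m := by
    calc eLpNorm g 2 (mu Ω) ≤ eLpNorm (fun _ => ((M * D : ℝ≥0) : ℝ)) 2 (mu Ω) := by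
          refine eLpNorm_mono_enorm_ae ?_
          filter_upwards [hM, ae_restrict_mem H.measurableSet] with x hx hxΩ
          refine hx.trans ?_
          rw [Real.enorm_of_nonneg (by positivity), ENNReal.ofReal_coe_nnreal]
          push_cast
          gcongr
          exact hD x hxΩ
      _ ≤ _ := by
          by_cases h0 : mu Ω = 0
          · rw [h0]; simp
          · rw [eLpNorm_const _ two_ne_zero h0, Real.enorm_of_nonneg (by positivity),
              ENNReal.ofReal_coe_nnreal]
            simp [m]
  rw [Lp.norm_def]
  refine (ENNReal.toReal_mono (ENNReal.mul_ne_top ENNReal.coe_ne_top hm) h1).trans_eq ?_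
  rw [ENNReal.toReal_mul]
  change ((M * D : ℝ≥0) : ℝ) * (m.toNNReal : ℝ) = _
  push_cast
  ring

/-- The function is sign(d) δ^γ, built from a measurable representative of d. It realises the
duality of L¹(Ω; δ^γ) and δ^γ L^∞(Ω), both for uniqueness and for the first estimate. -/
lemma AdmissibleKernel.exists_test (H : AdmissibleKernel β γ Ω G) {d : Pt n → ℝ}
    (hd : AEStronglyMeasurable d (mu Ω)) :
    ∃ ψ : L2 Ω, (∀ᵐ x ∂(mu Ω), ‖ψ x‖ₑ ≤ wt γ Ω x) ∧
      ∀ᵐ x ∂(mu Ω), d x * ψ x = ‖d x * bdist Ω x ^ γ‖ := by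
  have := H.isFiniteMeasure
  obtain ⟨D, hD⟩ := exists_wt_le H.one_le H.isBounded H.γ_nonneg
  have hw : Measurable fun x => bdist Ω x ^ γ := (measurable_bdist Ω).pow_const γ
  set d' := hd.mk d
  set q : Pt n → ℝ := fun x => if d' x < 0 then -(bdist Ω x ^ γ) else bdist Ω x ^ γ
  have hqm : Measurable q :=
    Measurable.ite (measurableSet_lt hd.stronglyMeasurable_mk.measurable measurable_const)
      hw.neg hw
  have hqe : ∀ x, ‖q x‖ₑ = wt γ Ω x := by
    intro x
    have : ‖bdist Ω x ^ γ‖ₑ = wt γ Ω x := by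
      simpa using enorm_mul_bdist_rpow γ Ω 1 x
    simp only [q]
    split_ifs <;> simp [this]
  have hq2 : MemLp q 2 (mu Ω) := by
    refine MemLp.of_bound hqm.aestronglyMeasurable D ?_
    filter_upwards [ae_restrict_mem H.measurableSet] with x hx
    have h1 := hD x hx
    rw [← hqe, ← ofReal_norm, ← ENNReal.ofReal_coe_nnreal] at h1
    exact (ENNReal.ofReal_le_ofReal_iff D.coe_nonneg).1 h1
  refine ⟨hq2.toLp, ?_, ?_⟩
  · filter_upwards [hq2.coeFn_toLp] with x hx
    rw [hx, hqe]
  · filter_upwards [hq2.coeFn_toLp, hd.ae_eq_mk] with x hx hdx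
    have hw0 := Real.rpow_nonneg (bdist_nonneg Ω x) γ
    rw [hx, hdx, norm_mul, Real.norm_of_nonneg hw0, Real.norm_eq_abs]
    simp only [q]
    change d' x * _ = |d' x| * _
    split_ifs with h
    · rw [abs_of_neg h]; ring
    · rw [abs_of_nonneg (not_lt.1 h)]

lemma AdmissibleKernel.ae_eq_of_forall_integral_eq (H : AdmissibleKernel β γ Ω G)
    {u v : Pt n → ℝ} (hu : MemL1w γ Ω u) (hv : MemL1w γ Ω v)
    (h : ∀ ψ : L2 Ω, MemWLinf γ ψ → ∫ x in Ω, u x * ψ x = ∫ x in Ω, v x * ψ x) :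
    u =ᵐ[mu Ω] v := by
  have hd := memL1w_sub hu hv
  obtain ⟨ψ, hψ1, hψ2⟩ := H.exists_test (H.memL1w_iff.1 hd).1
  have hψ : MemWLinf γ ψ := memWLinf_iff.2 ⟨1, by simpa using hψ1⟩
  have h1 : ∫ x in Ω, ‖(u x - v x) * bdist Ω x ^ γ‖ = 0 := by
    rw [← integral_congr_ae hψ2]
    simp_rw [sub_mul]
    rw [integral_sub (H.integrable_mul hu hψ) (H.integrable_mul hv hψ), h ψ hψ, sub_self]
  rw [integral_eq_zero_iff_of_nonneg (fun x => norm_nonneg _) (Integrable.norm hd)] at h1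
  filter_upwards [h1, ae_restrict_mem H.measurableSet] with x hx hxΩ
  have hw := Real.rpow_pos_of_pos (bdist_pos H.one_le H.isOpen H.isBounded hxΩ) γ
  simpa [hw.ne', sub_eq_zero] using hx

/-! ### A priori bounds -/

/-- The iteration stops at the power of 𝒦 that sends L¹(Ω; δ^γ) to δ^γ L^∞(Ω), so the remainder sees
V only through its weighted L¹ norm. The constants depend on A alone, not on F and V. -/
lemma AdmissibleKernel.exists_apriori (H : AdmissibleKernel β γ Ω G) (A : ℝ≥0) :
    ∃ (N : ℕ) (C : ℝ≥0), ∀ F V : Pt n → ℝ≥0∞, AEMeasurable F (mu Ω) → AEMeasurable V (mu Ω) →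
      (∀ᵐ x ∂(mu Ω), V x ≤ pot Ω (fun x y => ‖G x y‖ₑ) F x
        + A * pot Ω (fun x y => ‖G x y‖ₑ) V x) →
      ∀ᵐ x ∂(mu Ω), V x ≤ (∑ i ∈ Finset.range N,
          (A : ℝ≥0∞) ^ i * (pot Ω (fun x y => ‖G x y‖ₑ))^[i + 1] F x)
        + C * (∫⁻ y in Ω, V y * wt γ Ω y) * wt γ Ω x := by
  obtain ⟨N, C, hC⟩ := exists_pot_iterate_le H.one_le H.measurableSet H.isBounded H.bounds
    H.γ_nonneg H.β_nonneg H.β_lt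
  refine ⟨N, A ^ N * C, fun F V hF hV h => ?_⟩
  filter_upwards [ae_le_sum_pot_iterate H.bounds.measurable hF h N,
    ae_restrict_mem H.measurableSet] with x hx hxΩ
  refine hx.trans (add_le_add le_rfl ?_)
  calc (A : ℝ≥0∞) ^ N * (pot Ω (fun x y => ‖G x y‖ₑ))^[N] V x
      ≤ (A : ℝ≥0∞) ^ N * (C * wt γ Ω x * ∫⁻ y in Ω, V y * wt γ Ω y) := by
        gcongr
        exact hC V hV x hxΩ
    _ = _ := by push_cast; ring

lemma AdmissibleKernel.exists_apriori_wt (H : AdmissibleKernel β γ Ω G) (A : ℝ≥0) :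
    ∃ C : ℝ≥0, ∀ F V : Pt n → ℝ≥0∞, AEMeasurable F (mu Ω) → AEMeasurable V (mu Ω) →
      (∀ᵐ x ∂(mu Ω), V x ≤ pot Ω (fun x y => ‖G x y‖ₑ) F x
        + A * pot Ω (fun x y => ‖G x y‖ₑ) V x) →
      ∀ M : ℝ≥0, (∀ᵐ x ∂(mu Ω), F x ≤ M * wt γ Ω x) →
      ∀ᵐ x ∂(mu Ω), V x ≤ C * (M + ∫⁻ y in Ω, V y * wt γ Ω y) * wt γ Ω x := by
  obtain ⟨N, C, hC⟩ := H.exists_apriori A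
  choose B hB using exists_pot_iterate_wt_le H.one_le H.measurableSet H.isBounded H.bounds
    H.γ_nonneg H.β_lt
  refine ⟨(∑ i ∈ Finset.range N, A ^ i * B (i + 1)) + C, fun F V hF hV h M hM => ?_⟩
  have hit : ∀ i, ∀ᵐ x ∂(mu Ω), (pot Ω (fun x y => ‖G x y‖ₑ))^[i] F x
      ≤ M * (B i * wt γ Ω x) := by
    intro i
    have h1 := pot_iterate_mono (fun x y => ‖G x y‖ₑ) hM i
    rw [pot_iterate_const_mul] at h1
    filter_upwards [h1, ae_restrict_mem H.measurableSet] with x hx hxΩ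
    refine hx.trans ?_
    gcongr
    exact hB i x hxΩ
  filter_upwards [hC F V hF hV h, ae_all_iff.2 hit] with x h1 h2
  refine h1.trans ?_
  push_cast
  rw [add_mul, add_mul]
  gcongr
  · rw [Finset.sum_mul, Finset.sum_mul]
    refine Finset.sum_le_sum fun i _ => ?_
    calc (A : ℝ≥0∞) ^ i * (pot Ω (fun x y => ‖G x y‖ₑ))^[i + 1] F x
        ≤ (A : ℝ≥0∞) ^ i * (M * (B (i + 1) * wt γ Ω x)) := by gcongr; exact h2 (i + 1)
      _ = (A : ℝ≥0∞) ^ i * B (i + 1) * M * wt γ Ω x := by ring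
      _ ≤ _ := by gcongr; exact le_self_add
  · exact le_add_self

/-- An operator solution of `z = T g + l T z` with `|g| ≤ M δ^γ` is in `δ^γ L^∞(Ω)`. -/
lemma AdmissibleKernel.exists_apriori_L2 (H : AdmissibleKernel β γ Ω G) {T : L2 Ω →L[ℝ] L2 Ω}
    (hT : ∀ f : L2 Ω, T f =ᵐ[mu Ω] intPot Ω G f) (A : ℝ≥0) :
    ∃ C : ℝ≥0, ∀ l : ℝ, |l| ≤ A → ∀ z g : L2 Ω, z = T g + l • T z →
      ∀ M : ℝ≥0, (∀ᵐ x ∂(mu Ω), ‖g x‖ₑ ≤ M * wt γ Ω x) →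
      ∀ᵐ x ∂(mu Ω), ‖z x‖ₑ ≤ C * (M + ENNReal.ofReal ‖z‖) * wt γ Ω x := by
  obtain ⟨C, hC⟩ := H.exists_apriori_wt A
  obtain ⟨D, hD⟩ := H.exists_lintegral_wt_le_norm
  refine ⟨C * (1 + D), fun l hl z g hz M hM => ?_⟩
  have hlA : ‖l‖ₑ ≤ A := by
    rw [Real.enorm_eq_ofReal_abs, ← ENNReal.ofReal_coe_nnreal]
    exact ENNReal.ofReal_le_ofReal hl
  have h1 : ∀ᵐ x ∂(mu Ω), ‖z x‖ₑ ≤ pot Ω (fun x y => ‖G x y‖ₑ) (fun y => ‖g y‖ₑ) x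
      + A * pot Ω (fun x y => ‖G x y‖ₑ) (fun y => ‖z y‖ₑ) x := by
    filter_upwards [Lp.coeFn_add (T g) (l • T z), Lp.coeFn_smul l (T z), enorm_greenOp_le hT g,
      enorm_greenOp_le hT z] with x e1 e2 e3 e4
    rw [hz, e1, Pi.add_apply, e2, Pi.smul_apply, smul_eq_mul, ← hz]
    refine (enorm_add_le _ _).trans ?_
    rw [enorm_mul]
    gcongr
  filter_upwards [hC _ _ (Lp.aestronglyMeasurable g).enorm (Lp.aestronglyMeasurable z).enorm h1
    M hM] with x hx
  refine hx.trans ?_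
  gcongr ?_ * _
  push_cast
  rw [mul_assoc]
  gcongr
  refine (add_le_add le_rfl (hD z)).trans ?_
  rw [add_mul, one_mul, mul_add]
  gcongr ?_ + ?_
  · exact le_self_add
  · exact le_add_self

end

end GreenEig

namespace GreenEig

variable {n : ℕ}

/-- The component of `g` orthogonal to the first `I` elements of the basis. -/
noncomputable def highPart {Ω : Set (Pt n)} (φ : HilbertBasis ℕ ℝ (L2 Ω)) (I : ℕ) (g : L2 Ω) :
    L2 Ω := g - ∑ j ∈ Finset.range I, inner ℝ (φ j) g • φ j

/-- An admissible kernel, its operator on `L²(Ω)`, and a basis of eigenfunctions. -/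
structure GreenSpectrum (β γ : ℝ) (Ω : Set (Pt n)) (G : Pt n → Pt n → ℝ) (T : L2 Ω →L[ℝ] L2 Ω)
    (lam : ℕ → ℝ) (φ : HilbertBasis ℕ ℝ (L2 Ω)) : Prop where
  kernel : AdmissibleKernel β γ Ω G
  greenOp : ∀ f : L2 Ω, T f =ᵐ[mu Ω] intPot Ω G f
  tendsto : Tendsto lam atTop atTop
  ne_zero : ∀ j, lam j ≠ 0
  apply_eigen : ∀ j, T (φ j) = (lam j)⁻¹ • φ j

variable {β γ : ℝ} {Ω : Set (Pt n)} {G : Pt n → Pt n → ℝ} {T : L2 Ω →L[ℝ] L2 Ω}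
  {lam : ℕ → ℝ} {φ : HilbertBasis ℕ ℝ (L2 Ω)} {l : ℝ}

lemma coeFn_highPart (φ : HilbertBasis ℕ ℝ (L2 Ω)) (I : ℕ) (g : L2 Ω) :
    highPart φ I g =ᵐ[mu Ω]
      fun x => g x - ∑ j ∈ Finset.range I, inner ℝ (φ j) g * φ j x := by
  have h1 : ∀ j, ((inner ℝ (φ j) g • φ j : L2 Ω) : Pt n → ℝ) =ᵐ[mu Ω]
      fun x => inner ℝ (φ j) g * φ j x := fun j => Lp.coeFn_smul _ _
  filter_upwards [Lp.coeFn_sub g (∑ j ∈ Finset.range I, inner ℝ (φ j) g • φ j),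
    Lp.coeFn_fun_finsetSum (Finset.range I) (fun j => inner ℝ (φ j) g • φ j),
    ae_all_iff.2 h1] with x h2 h3 h4
  rw [highPart, h2, Pi.sub_apply, h3]
  simp_rw [h4]

/-! ### The resolvent -/

lemma GreenSpectrum.inner_basis_greenOp (S : GreenSpectrum β γ Ω G T lam φ) (j : ℕ) (g : L2 Ω) :
    inner ℝ (φ j) (T g) = (lam j)⁻¹ * inner ℝ (φ j) g := by
  rw [← S.kernel.inner_greenOp S.greenOp, S.apply_eigen, real_inner_smul_left]

lemma GreenSpectrum.inner_basis_solOp (S : GreenSpectrum β γ Ω G T lam φ) (l : ℝ) (j : ℕ)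
    (g : L2 Ω) : inner ℝ (φ j) (solOp lam φ l g) = inner ℝ (φ j) g / (lam j - l) :=
  inner_tsum_resolvent φ S.tendsto l g j

lemma inner_basis_highPart (φ : HilbertBasis ℕ ℝ (L2 Ω)) (I : ℕ) (g : L2 Ω) (j : ℕ) :
    inner ℝ (φ j) (highPart φ I g) = if j < I then 0 else inner ℝ (φ j) g :=
  inner_sub_sum φ I g j

/-- In coefficients: 1/(λ_j - l) = 1/λ_j + l / (λ_j (λ_j - l)). -/
lemma GreenSpectrum.solOp_eq (S : GreenSpectrum β γ Ω G T lam φ) (hl : ∀ j, l ≠ lam j)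
    (g : L2 Ω) : solOp lam φ l g = T g + l • T (solOp lam φ l g) := by
  refine ext_inner_basis φ fun j => ?_
  rw [inner_add_right, inner_smul_right, S.inner_basis_greenOp, S.inner_basis_greenOp,
    S.inner_basis_solOp]
  have h1 := S.ne_zero j
  have h2 : lam j - l ≠ 0 := sub_ne_zero.2 (hl j).symm
  field_simp
  ring

lemma GreenSpectrum.solOp_greenOp (S : GreenSpectrum β γ Ω G T lam φ) (l : ℝ) (g : L2 Ω) :
    solOp lam φ l (T g) = T (solOp lam φ l g) := by
  refine ext_inner_basis φ fun j => ?_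
  rw [S.inner_basis_greenOp, S.inner_basis_solOp, S.inner_basis_solOp, S.inner_basis_greenOp,
    mul_div_assoc]

lemma GreenSpectrum.highPart_solOp (S : GreenSpectrum β γ Ω G T lam φ) (l : ℝ) (I : ℕ) (g : L2 Ω) :
    highPart φ I (solOp lam φ l g) = solOp lam φ l (highPart φ I g) := by
  refine ext_inner_basis φ fun j => ?_
  rw [inner_basis_highPart, S.inner_basis_solOp, S.inner_basis_solOp, inner_basis_highPart]
  split_ifs <;> simp

lemma GreenSpectrum.inner_solOp (S : GreenSpectrum β γ Ω G T lam φ) (l : ℝ) (f g : L2 Ω) :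
    inner ℝ (solOp lam φ l f) g = inner ℝ f (solOp lam φ l g) := by
  rw [← φ.tsum_inner_mul_inner, ← φ.tsum_inner_mul_inner]
  refine tsum_congr fun j => ?_
  rw [real_inner_comm, S.inner_basis_solOp, S.inner_basis_solOp, real_inner_comm]
  ring

/-- The modes that l may approach have been removed, so only the gap d to the remaining ones enters.
-/
lemma GreenSpectrum.norm_highPart_solOp_le (S : GreenSpectrum β γ Ω G T lam φ) {I : ℕ} {d : ℝ}
    (hd : 0 < d) (h : ∀ j, I ≤ j → d ≤ lam j - l) (g : L2 Ω) :
    ‖highPart φ I (solOp lam φ l g)‖ ≤ d⁻¹ * ‖g‖ := by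
  refine norm_le_of_abs_inner_le φ (inv_nonneg.2 hd.le) fun j => ?_
  rw [inner_basis_highPart, S.inner_basis_solOp]
  split_ifs with hj
  · simpa using by positivity
  · have h1 := h j (not_lt.1 hj)
    rw [abs_div, div_eq_inv_mul, abs_of_pos (hd.trans_le h1)]
    exact mul_le_mul_of_nonneg_right (inv_anti₀ hd h1) (abs_nonneg _)

/-! ### Regularity of the eigenfunctions and of the resolvent -/

lemma GreenSpectrum.memWLinf_greenOp (S : GreenSpectrum β γ Ω G T lam φ) {ψ : L2 Ω}
    (hψ : MemWLinf γ ψ) : MemWLinf γ (T ψ) := by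
  have H := S.kernel
  obtain ⟨M, hM⟩ := memWLinf_iff.1 hψ
  obtain ⟨C, hC⟩ := exists_pot_iterate_wt_le H.one_le H.measurableSet H.isBounded H.bounds
    H.γ_nonneg H.β_lt 1
  refine memWLinf_iff.2 ⟨M * C, ?_⟩
  filter_upwards [enorm_greenOp_le S.greenOp ψ, ae_restrict_mem H.measurableSet] with x hx hxΩ
  refine (hx.trans (pot_mono _ hM x)).trans ?_
  have h1 := pot_iterate_const_mul (Ω := Ω) (κ := fun x y => ‖G x y‖ₑ) M (wt γ Ω) 1
  simp only [Function.iterate_one] at h1 hC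
  rw [h1, ENNReal.coe_mul, mul_assoc]
  exact mul_le_mul' le_rfl (hC x hxΩ)

lemma GreenSpectrum.memWLinf_basis (S : GreenSpectrum β γ Ω G T lam φ) (j : ℕ) :
    MemWLinf γ (φ j) := by
  obtain ⟨C, hC⟩ := S.kernel.exists_apriori_L2 S.greenOp (lam j).nnabs
  have h0 : ∀ᵐ x ∂(mu Ω), ‖(0 : L2 Ω) x‖ₑ ≤ (0 : ℝ≥0) * wt γ Ω x := by
    filter_upwards [Lp.coeFn_zero ℝ 2 (mu Ω)] with x hx
    rw [hx]; simp
  -- The eigenvalue equation is z = T g + l T z with g = 0 and l = λ_j.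
  have h1 := hC (lam j) le_rfl (φ j) 0
    (by rw [map_zero, zero_add, S.apply_eigen, smul_smul, mul_inv_cancel₀ (S.ne_zero j), one_smul])
    0 h0
  refine memWLinf_iff.2 ⟨C * ‖φ j‖.toNNReal, ?_⟩
  filter_upwards [h1] with x hx
  simpa [ENNReal.ofReal, ENNReal.coe_mul] using hx

lemma GreenSpectrum.memWLinf_solOp (S : GreenSpectrum β γ Ω G T lam φ) (hl : ∀ j, l ≠ lam j)
    {ψ : L2 Ω} (hψ : MemWLinf γ ψ) : MemWLinf γ (solOp lam φ l ψ) := by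
  obtain ⟨C, hC⟩ := S.kernel.exists_apriori_L2 S.greenOp l.nnabs
  obtain ⟨M, hM⟩ := memWLinf_iff.1 hψ
  refine memWLinf_iff.2 ⟨C * (M + ‖solOp lam φ l ψ‖.toNNReal), ?_⟩
  filter_upwards [hC l le_rfl _ ψ (S.solOp_eq hl ψ) M hM] with x hx
  simpa [ENNReal.ofReal, ENNReal.coe_mul] using hx

/-- The projection subtracts finitely many eigenfunctions, all in δ^γ L^∞(Ω), with coefficients
bounded by the L² norm. -/
lemma GreenSpectrum.exists_highPart_le (S : GreenSpectrum β γ Ω G T lam φ) (I : ℕ) :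
    ∃ C : ℝ≥0, ∀ (ψ : L2 Ω) (M : ℝ≥0), (∀ᵐ x ∂(mu Ω), ‖ψ x‖ₑ ≤ M * wt γ Ω x) →
      ∀ᵐ x ∂(mu Ω), ‖highPart φ I ψ x‖ₑ ≤ (C * M : ℝ≥0) * wt γ Ω x := by
  obtain ⟨D, hD⟩ := S.kernel.exists_norm_le
  choose B hB using fun j => memWLinf_iff.1 (S.memWLinf_basis j)
  refine ⟨1 + ∑ j ∈ Finset.range I, D * B j, fun ψ M hM => ?_⟩
  filter_upwards [coeFn_highPart φ I ψ, hM, ae_all_iff.2 hB] with x h1 h2 h3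
  rw [h1]
  refine (enorm_sub_le).trans ?_
  push_cast
  rw [add_mul, one_mul, add_mul, Finset.sum_mul, Finset.sum_mul]
  refine add_le_add h2 ((enorm_sum_le _ _).trans (Finset.sum_le_sum fun j _ => ?_))
  rw [enorm_mul]
  have h4 : ‖(inner ℝ (φ j) ψ : ℝ)‖ₑ ≤ D * M := by
    rw [← ENNReal.coe_mul, ← ofReal_norm, ← ENNReal.ofReal_coe_nnreal]
    refine ENNReal.ofReal_le_ofReal ?_
    calc ‖(inner ℝ (φ j) ψ : ℝ)‖ ≤ ‖φ j‖ * ‖ψ‖ := norm_inner_le_norm _ _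
      _ = ‖ψ‖ := by rw [φ.orthonormal.1 j, one_mul]
      _ ≤ _ := by push_cast; exact hD ψ M hM
  calc _ ≤ (D * M : ℝ≥0∞) * (B j * wt γ Ω x) := by gcongr; exact h3 j
    _ = _ := by ring

/-- The source of uniformity in l. The projection commutes with the resolvent, so z = P 𝔾_l ψ solves
z = T(Pψ) + l Tz; the a priori bound needs only |l| ≤ A, the bound on Pψ, and the L² norm of z,
which the gap controls. -/
lemma GreenSpectrum.exists_highPart_solOp_le (S : GreenSpectrum β γ Ω G T lam φ) (I : ℕ)
    {d : ℝ} (hd : 0 < d) (A : ℝ≥0) :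
    ∃ C : ℝ≥0, ∀ l : ℝ, |l| ≤ A → (∀ j, l ≠ lam j) → (∀ j, I ≤ j → d ≤ lam j - l) →
      ∀ ψ : L2 Ω, (∀ᵐ x ∂(mu Ω), ‖ψ x‖ₑ ≤ wt γ Ω x) →
      ∀ᵐ x ∂(mu Ω), ‖highPart φ I (solOp lam φ l ψ) x‖ₑ ≤ C * wt γ Ω x := by
  obtain ⟨C, hC⟩ := S.kernel.exists_apriori_L2 S.greenOp A
  obtain ⟨B, hB⟩ := S.exists_highPart_le I
  obtain ⟨D, hD⟩ := S.kernel.exists_norm_le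
  refine ⟨C * (B + (d⁻¹).toNNReal * D), fun l hlA hl hgap ψ hψ => ?_⟩
  have hψ1 : ∀ᵐ x ∂(mu Ω), ‖ψ x‖ₑ ≤ (1 : ℝ≥0) * wt γ Ω x := by simpa using hψ
  have hz : highPart φ I (solOp lam φ l ψ)
      = T (highPart φ I ψ) + l • T (highPart φ I (solOp lam φ l ψ)) := by
    rw [S.highPart_solOp]
    exact S.solOp_eq hl _
  filter_upwards [hC l hlA _ _ hz (B * 1) (hB ψ 1 hψ1)] with x hx
  refine hx.trans ?_
  push_cast
  rw [mul_one]
  gcongr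
  rw [← ENNReal.coe_mul, ← ENNReal.ofReal_coe_nnreal]
  refine ENNReal.ofReal_le_ofReal ?_
  refine (S.norm_highPart_solOp_le hd hgap ψ).trans ?_
  push_cast
  rw [Real.coe_toNNReal _ (inv_nonneg.2 hd.le)]
  gcongr
  simpa using hD ψ 1 hψ1

end GreenEig

namespace GreenEig

variable {n : ℕ} {β γ : ℝ} {Ω : Set (Pt n)} {G : Pt n → Pt n → ℝ} {T : L2 Ω →L[ℝ] L2 Ω}
  {lam : ℕ → ℝ} {φ : HilbertBasis ℕ ℝ (L2 Ω)} {l : ℝ}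

/-! ### The Green potential on `L¹(Ω; δ^γ)` -/

lemma AdmissibleKernel.lintegral_pot_wt_ne_top (H : AdmissibleKernel β γ Ω G) {f : Pt n → ℝ}
    (hf : MemL1w γ Ω f) :
    ∫⁻ x in Ω, pot Ω (fun x y => ‖G x y‖ₑ) (fun y => ‖f y‖ₑ) x * wt γ Ω x ≠ ⊤ := by
  obtain ⟨hfm, hf1⟩ := H.memL1w_iff.1 hf
  obtain ⟨C, hC⟩ := exists_lintegral_pot_iterate_mul_wt_le H.one_le H.measurableSet H.isBounded
    H.bounds H.γ_nonneg H.β_lt 1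
  exact ((hC _ hfm.enorm).trans_lt (ENNReal.mul_lt_top ENNReal.coe_lt_top hf1.lt_top)).ne

lemma AdmissibleKernel.memL1w_intPot (H : AdmissibleKernel β γ Ω G) {f : Pt n → ℝ}
    (hf : MemL1w γ Ω f) : MemL1w γ Ω (intPot Ω G f) := by
  refine H.memL1w_iff.2
    ⟨aestronglyMeasurable_intPot H.measurable (H.memL1w_iff.1 hf).1, ne_top_of_le_ne_top
      (H.lintegral_pot_wt_ne_top hf) (lintegral_mono fun x => ?_)⟩
  gcongr
  exact enorm_intPot_le Ω G f x

lemma GreenSpectrum.integral_intPot_mul (S : GreenSpectrum β γ Ω G T lam φ) {f : Pt n → ℝ}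
    (hf : MemL1w γ Ω f) {ψ : L2 Ω} (hψ : MemWLinf γ ψ) :
    ∫ x in Ω, intPot Ω G f x * ψ x = ∫ x in Ω, f x * T ψ x := by
  have H := S.kernel
  obtain ⟨M, hM⟩ := memWLinf_iff.1 hψ
  have hfin : ∫⁻ x in Ω, pot Ω (fun x y => ‖G x y‖ₑ) (fun y => ‖f y‖ₑ) x * ‖ψ x‖ₑ ≠ ⊤ := by
    have h1 : ∫⁻ x in Ω, pot Ω (fun x y => ‖G x y‖ₑ) (fun y => ‖f y‖ₑ) x * ‖ψ x‖ₑ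
        ≤ M * ∫⁻ x in Ω, pot Ω (fun x y => ‖G x y‖ₑ) (fun y => ‖f y‖ₑ) x * wt γ Ω x := by
      rw [← lintegral_const_mul' _ _ ENNReal.coe_ne_top]
      refine lintegral_mono_ae ?_
      filter_upwards [hM] with x hx
      rw [mul_left_comm]
      gcongr
    exact (h1.trans_lt (ENNReal.mul_lt_top ENNReal.coe_lt_top
      (H.lintegral_pot_wt_ne_top hf).lt_top)).ne
  rw [GreenEig.integral_intPot_mul H.measurable H.ae_symm (H.memL1w_iff.1 hf).1
    (Lp.aestronglyMeasurable ψ) hfin]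
  refine integral_congr_ae ?_
  filter_upwards [S.greenOp ψ] with x hx
  rw [hx]

lemma enorm_intPot_iterate_le (Ω : Set (Pt n)) (G : Pt n → Pt n → ℝ) (f : Pt n → ℝ) (i : ℕ)
    (x : Pt n) : ‖(intPot Ω G)^[i] f x‖ₑ
      ≤ (pot Ω (fun x y => ‖G x y‖ₑ))^[i] (fun y => ‖f y‖ₑ) x := by
  induction i generalizing x with
  | zero => rfl
  | succ i ih =>
    rw [Function.iterate_succ_apply', Function.iterate_succ_apply']
    exact (enorm_intPot_le Ω G _ x).trans (pot_mono _ (Eventually.of_forall ih) x)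

/-! ### Weak solutions -/

lemma integral_mul_add_smul (H : AdmissibleKernel β γ Ω G) {f : Pt n → ℝ} (hf : MemL1w γ Ω f)
    {a b : L2 Ω} (ha : MemWLinf γ a) (hb : MemWLinf γ b) (c : ℝ) :
    ∫ x in Ω, f x * (a + c • b : L2 Ω) x = (∫ x in Ω, f x * a x) + c * ∫ x in Ω, f x * b x := by
  rw [← integral_const_mul, ← integral_add (H.integrable_mul hf ha)
    ((H.integrable_mul hf hb).const_mul c)]
  refine integral_congr_ae ?_
  filter_upwards [Lp.coeFn_add a (c • b), Lp.coeFn_smul c b] with x h1 h2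
  rw [h1, Pi.add_apply, h2, Pi.smul_apply, smul_eq_mul]
  ring

lemma integral_add_const_mul_mul (H : AdmissibleKernel β γ Ω G) {f g : Pt n → ℝ}
    (hf : MemL1w γ Ω f) (hg : MemL1w γ Ω g) {ψ : L2 Ω} (hψ : MemWLinf γ ψ) (c : ℝ) :
    ∫ x in Ω, (f x + c * g x) * ψ x = (∫ x in Ω, f x * ψ x) + c * ∫ x in Ω, g x * ψ x := by
  rw [← integral_const_mul, ← integral_add (H.integrable_mul hf hψ)
    ((H.integrable_mul hg hψ).const_mul c)]
  refine integral_congr_ae (Eventually.of_forall fun x => ?_)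
  change (f x + c * g x) * ψ x = f x * ψ x + c * (g x * ψ x)
  ring

lemma GreenSpectrum.isWeakSol_of_forall (S : GreenSpectrum β γ Ω G T lam φ)
    (hl : ∀ j, l ≠ lam j) {f u : Pt n → ℝ} (hf : MemL1w γ Ω f) (hu : MemL1w γ Ω u)
    (h : ∀ ψ : L2 Ω, MemWLinf γ ψ →
      ∫ x in Ω, u x * ψ x = ∫ x in Ω, f x * solOp lam φ l ψ x) :
    IsWeakSol γ lam φ l f u :=
  ⟨hf, hu, fun _ hψ => S.kernel.integrable_mul hf (S.memWLinf_solOp hl hψ), h⟩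

lemma GreenSpectrum.isWeakSol_unique (S : GreenSpectrum β γ Ω G T lam φ) {f u v : Pt n → ℝ}
    (hu : IsWeakSol γ lam φ l f u) (hv : IsWeakSol γ lam φ l f v) : u =ᵐ[mu Ω] v :=
  S.kernel.ae_eq_of_forall_integral_eq hu.sol_mem hv.sol_mem fun ψ hψ =>
    (hu.weak ψ hψ).trans (hv.weak ψ hψ).symm

/-- The resolvent identity 𝔾_l = T + l T 𝔾_l, transposed: a solution for the more regular datum Tf
yields one for f. -/
lemma GreenSpectrum.isWeakSol_of_intPot (S : GreenSpectrum β γ Ω G T lam φ)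
    (hl : ∀ j, l ≠ lam j) {f u : Pt n → ℝ} (hf : MemL1w γ Ω f)
    (hu : IsWeakSol γ lam φ l (intPot Ω G f) u) :
    IsWeakSol γ lam φ l f (fun x => intPot Ω G f x + l * u x) := by
  have H := S.kernel
  refine S.isWeakSol_of_forall hl hf
    (memL1w_add hu.data_mem (memL1w_const_mul hu.sol_mem l)) fun ψ hψ => ?_
  have hz := S.memWLinf_solOp hl hψ
  rw [integral_add_const_mul_mul H hu.data_mem hu.sol_mem hψ, hu.weak ψ hψ,
    S.integral_intPot_mul hf hψ, S.integral_intPot_mul hf hz,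
    ← integral_mul_add_smul H hf (S.memWLinf_greenOp hψ) (S.memWLinf_greenOp hz),
    ← S.solOp_eq hl]

/-- Such a datum is in L², where the self-adjoint resolvent provides the solution directly. -/
lemma GreenSpectrum.exists_isWeakSol_of_le (S : GreenSpectrum β γ Ω G T lam φ)
    (hl : ∀ j, l ≠ lam j) {f : Pt n → ℝ} (hf : MemL1w γ Ω f) {M : ℝ≥0}
    (hM : ∀ᵐ x ∂(mu Ω), ‖f x‖ₑ ≤ M * wt γ Ω x) : ∃ u, IsWeakSol γ lam φ l f u := by
  have H := S.kernel
  have := H.isFiniteMeasure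
  obtain ⟨D, hD⟩ := exists_wt_le H.one_le H.isBounded H.γ_nonneg
  have hf2 : MemLp f 2 (mu Ω) := by
    refine MemLp.of_bound (H.memL1w_iff.1 hf).1 (M * D : ℝ≥0) ?_
    filter_upwards [hM, ae_restrict_mem H.measurableSet] with x hx hxΩ
    have h1 : ‖f x‖ₑ ≤ (M * D : ℝ≥0) := by
      push_cast
      exact hx.trans (mul_le_mul' le_rfl (hD x hxΩ))
    rwa [← ofReal_norm, ← ENNReal.ofReal_coe_nnreal,
      ENNReal.ofReal_le_ofReal_iff (NNReal.coe_nonneg _)] at h1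
  refine ⟨solOp lam φ l hf2.toLp, S.isWeakSol_of_forall hl hf (H.memL1w_coe _) fun ψ _ => ?_⟩
  rw [← inner_eq_integral, S.inner_solOp, inner_eq_integral]
  refine integral_congr_ae ?_
  filter_upwards [hf2.coeFn_toLp] with x hx
  rw [hx]

/-- Enough potentials bring the datum into δ^γ L^∞(Ω); from the solution found there,
`isWeakSol_of_intPot` goes back one potential at a time. -/
theorem GreenSpectrum.exists_isWeakSol (S : GreenSpectrum β γ Ω G T lam φ)
    (hl : ∀ j, l ≠ lam j) {f : Pt n → ℝ} (hf : MemL1w γ Ω f) :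
    ∃ u, IsWeakSol γ lam φ l f u := by
  have H := S.kernel
  have key : ∀ (N : ℕ) (f : Pt n → ℝ), MemL1w γ Ω f →
      (∃ M : ℝ≥0, ∀ᵐ x ∂(mu Ω), ‖(intPot Ω G)^[N] f x‖ₑ ≤ M * wt γ Ω x) →
      ∃ u, IsWeakSol γ lam φ l f u := by
    intro N
    induction N with
    | zero => exact fun f hf ⟨M, hM⟩ => S.exists_isWeakSol_of_le hl hf hM
    | succ N ih =>
      intro f hf hN
      obtain ⟨u, hu⟩ := ih (intPot Ω G f) (H.memL1w_intPot hf) hN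
      exact ⟨_, S.isWeakSol_of_intPot hl hf hu⟩
  obtain ⟨N, C, hC⟩ := exists_pot_iterate_le H.one_le H.measurableSet H.isBounded H.bounds
    H.γ_nonneg H.β_nonneg H.β_lt
  obtain ⟨hfm, hf1⟩ := H.memL1w_iff.1 hf
  refine key N f hf ⟨C * (∫⁻ x in Ω, ‖f x‖ₑ * wt γ Ω x).toNNReal, ?_⟩
  filter_upwards [ae_restrict_mem H.measurableSet] with x hx
  refine (enorm_intPot_iterate_le Ω G f N x).trans ((hC _ hfm.enorm x hx).trans_eq ?_)
  rw [ENNReal.coe_mul, ENNReal.coe_toNNReal hf1, mul_right_comm]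

/-- A weak solution solves the integral equation. -/
lemma GreenSpectrum.ae_eq_intPot_add (S : GreenSpectrum β γ Ω G T lam φ)
    (hl : ∀ j, l ≠ lam j) {f u : Pt n → ℝ} (hu : IsWeakSol γ lam φ l f u) :
    u =ᵐ[mu Ω] fun x => intPot Ω G f x + l * intPot Ω G u x := by
  have H := S.kernel
  have hf := hu.data_mem
  have hfp := H.memL1w_intPot hf
  have hup := H.memL1w_intPot hu.sol_mem
  refine H.ae_eq_of_forall_integral_eq hu.sol_mem
    (memL1w_add hfp (memL1w_const_mul hup l)) fun ψ hψ => ?_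
  have hT := S.memWLinf_greenOp hψ
  rw [integral_add_const_mul_mul H hfp hup hψ, S.integral_intPot_mul hf hψ,
    S.integral_intPot_mul hu.sol_mem hψ, hu.weak _ hT, S.solOp_greenOp,
    ← integral_mul_add_smul H hf hT (S.memWLinf_greenOp (S.memWLinf_solOp hl hψ)),
    ← S.solOp_eq hl, hu.weak ψ hψ]

lemma GreenSpectrum.ae_enorm_le (S : GreenSpectrum β γ Ω G T lam φ)
    (hl : ∀ j, l ≠ lam j) {A : ℝ≥0} (hlA : |l| ≤ A) {f u : Pt n → ℝ}
    (hu : IsWeakSol γ lam φ l f u) :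
    ∀ᵐ x ∂(mu Ω), ‖u x‖ₑ ≤ pot Ω (fun x y => ‖G x y‖ₑ) (fun y => ‖f y‖ₑ) x
      + A * pot Ω (fun x y => ‖G x y‖ₑ) (fun y => ‖u y‖ₑ) x := by
  have hl' : ‖l‖ₑ ≤ A := by
    rw [Real.enorm_eq_ofReal_abs, ← ENNReal.ofReal_coe_nnreal]
    exact ENNReal.ofReal_le_ofReal hlA
  filter_upwards [S.ae_eq_intPot_add hl hu] with x hx
  rw [hx]
  refine (enorm_add_le _ _).trans ?_
  rw [enorm_mul]
  exact add_le_add (enorm_intPot_le Ω G f x) (mul_le_mul' hl' (enorm_intPot_le Ω G u x))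

/-! ### The projection -/

lemma GreenSpectrum.memL1w_perp (S : GreenSpectrum β γ Ω G T lam φ) (l : ℝ) {f : Pt n → ℝ}
    (hf : MemL1w γ Ω f) : MemL1w γ Ω (perp lam φ l f) :=
  memL1w_sub hf (memL1w_finsetSum _ fun j _ =>
    memL1w_const_mul (S.kernel.memL1w_coe (φ j)) (pairing f (φ j)))

lemma GreenSpectrum.integral_sub_sum_mul (S : GreenSpectrum β γ Ω G T lam φ) (I : ℕ) (c : ℕ → ℝ)
    {f : Pt n → ℝ} (hf : MemL1w γ Ω f) {ψ : L2 Ω} (hψ : MemWLinf γ ψ) :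
    ∫ x in Ω, (f x - ∑ j ∈ Finset.range I, c j * φ j x) * ψ x
      = (∫ x in Ω, f x * ψ x) - ∑ j ∈ Finset.range I, c j * inner ℝ (φ j) ψ := by
  have H := S.kernel
  have hφ : ∀ j, Integrable (fun x => c j * (φ j x * ψ x)) (mu Ω) := fun j =>
    (H.integrable_mul (H.memL1w_coe (φ j)) hψ).const_mul _
  have h1 : ∑ j ∈ Finset.range I, c j * inner ℝ (φ j) ψ
      = ∫ x in Ω, ∑ j ∈ Finset.range I, c j * (φ j x * ψ x) := by
    rw [integral_finsetSum _ fun j _ => hφ j]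
    refine Finset.sum_congr rfl fun j _ => ?_
    rw [integral_const_mul, inner_eq_integral]
  rw [h1, ← integral_sub (H.integrable_mul hf hψ) (integrable_finsetSum _ fun j _ => hφ j)]
  refine integral_congr_ae (Eventually.of_forall fun x => ?_)
  simp only [sub_mul, Finset.sum_mul, mul_assoc]

lemma GreenSpectrum.integral_mul_highPart (S : GreenSpectrum β γ Ω G T lam φ) (I : ℕ)
    {f : Pt n → ℝ} (hf : MemL1w γ Ω f) {ψ : L2 Ω} (hψ : MemWLinf γ ψ) :
    ∫ x in Ω, f x * highPart φ I ψ x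
      = (∫ x in Ω, f x * ψ x) - ∑ j ∈ Finset.range I, pairing f (φ j) * inner ℝ (φ j) ψ := by
  have H := S.kernel
  have hφ : ∀ j, Integrable (fun x => inner ℝ (φ j) ψ * (f x * φ j x)) (mu Ω) := fun j =>
    (H.integrable_mul hf (S.memWLinf_basis j)).const_mul _
  have h1 : ∑ j ∈ Finset.range I, pairing f (φ j) * inner ℝ (φ j) ψ
      = ∫ x in Ω, ∑ j ∈ Finset.range I, inner ℝ (φ j) ψ * (f x * φ j x) := by
    rw [integral_finsetSum _ fun j _ => hφ j]
    refine Finset.sum_congr rfl fun j _ => ?_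
    rw [integral_const_mul, pairing, mul_comm]
  rw [h1, ← integral_sub (H.integrable_mul hf hψ) (integrable_finsetSum _ fun j _ => hφ j)]
  refine integral_congr_ae ?_
  filter_upwards [coeFn_highPart φ I ψ] with x hx
  rw [hx, mul_sub, Finset.mul_sum]
  simp only [mul_left_comm (f x)]

/-- The projection passes from the datum, which need not be in L², to the test function. -/
lemma GreenSpectrum.integral_perp_mul (S : GreenSpectrum β γ Ω G T lam φ) (l : ℝ)
    {f : Pt n → ℝ} (hf : MemL1w γ Ω f) {ψ : L2 Ω} (hψ : MemWLinf γ ψ) :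
    ∫ x in Ω, perp lam φ l f x * ψ x = ∫ x in Ω, f x * highPart φ (lowCount lam l) ψ x := by
  rw [S.integral_mul_highPart _ hf hψ, ← S.integral_sub_sum_mul _ _ hf hψ]
  rfl

/-- Both sides are tested with ψ. Splitting 𝔾_l ψ into its high part and its first modes, whose
coefficients are ⟨ψ, φ_j⟩/(λ_j - l), reproduces the two terms on the right. -/
theorem GreenSpectrum.ae_eq_sum_add (S : GreenSpectrum β γ Ω G T lam φ) (hl : ∀ j, l ≠ lam j)
    {f u w : Pt n → ℝ} (hu : IsWeakSol γ lam φ l f u)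
    (hw : IsWeakSol γ lam φ l (perp lam φ l f) w) :
    u =ᵐ[mu Ω] fun x => (∑ j ∈ Finset.range (lowCount lam l),
      pairing f (φ j) / (lam j - l) * φ j x) + w x := by
  have H := S.kernel
  have hf := hu.data_mem
  have hs : MemL1w γ Ω (fun x => ∑ j ∈ Finset.range (lowCount lam l),
      pairing f (φ j) / (lam j - l) * φ j x) :=
    memL1w_finsetSum _ fun j _ => memL1w_const_mul (H.memL1w_coe (φ j)) _
  refine H.ae_eq_of_forall_integral_eq hu.sol_mem (memL1w_add hs hw.sol_mem) fun ψ hψ => ?_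
  have hz := S.memWLinf_solOp hl hψ
  have h1 := S.integral_sub_sum_mul (lowCount lam l)
    (fun j => -(pairing f (φ j) / (lam j - l))) hw.sol_mem hψ
  have h2 : ∀ x, w x - ∑ j ∈ Finset.range (lowCount lam l),
      -(pairing f (φ j) / (lam j - l)) * φ j x
      = (∑ j ∈ Finset.range (lowCount lam l), pairing f (φ j) / (lam j - l) * φ j x) + w x := by
    intro x
    simp only [neg_mul, Finset.sum_neg_distrib]
    ring
  simp only [h2] at h1
  rw [h1, hw.weak ψ hψ, S.integral_perp_mul l hf hz, S.integral_mul_highPart _ hf hz,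
    hu.weak ψ hψ]
  simp only [neg_mul, Finset.sum_neg_distrib, S.inner_basis_solOp]
  rw [sub_neg_eq_add, sub_add]
  rw [← Finset.sum_sub_distrib, Finset.sum_eq_zero fun j _ => by ring, sub_zero]

end GreenEig

namespace GreenEig

variable {n : ℕ}

/-! ### Uniformity in the spectral parameter -/

/-- `l` is at most `A` in absolute value, it has `I` low eigenfunctions, and it stays at
distance at least `d` below the other eigenvalues. -/
structure HasGap (lam : ℕ → ℝ) (I : ℕ) (d : ℝ) (A : ℝ≥0) (l : ℝ) : Prop where
  ne : ∀ j, l ≠ lam j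
  lowCount_eq : lowCount lam l = I
  abs_le : |l| ≤ A
  le_sub : ∀ j, I ≤ j → d ≤ lam j - l

lemma exists_lt_succ_of_tendsto {lam : ℕ → ℝ} (hlim : Tendsto lam atTop atTop) (l : ℝ) :
    ∃ j, l ≤ lam j ∧ lam j < lam (j + 1) := by
  by_contra! h
  obtain ⟨N, hN⟩ := tendsto_atTop_atTop.1 hlim l
  have h1 : ∀ k, lam (N + k) ≤ lam N := by
    intro k
    induction k with
    | zero => exact le_rfl
    | succ k ih => exact (h (N + k) (hN _ (Nat.le_add_right _ _))).trans ih
  obtain ⟨M, hM⟩ := tendsto_atTop_atTop.1 hlim (lam N + 1)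
  linarith [hM (N + M) (Nat.le_add_left _ _), h1 M]

/-- The value lb alone determines I, as the first zero-based index with λ ≥ lb. Then l < `lam (I -
1)` < lb = `lam I`, so d = lb - `lam (I - 1)` bounds the distance to the high modes from below, and
|l| ≤ |Λ| + |lb|. -/
lemma exists_hasGap {lam : ℕ → ℝ} (hmono : Monotone lam) (hlim : Tendsto lam atTop atTop)
    (lb Λ : ℝ) : ∃ (I : ℕ) (d : ℝ) (A : ℝ≥0), 0 < d ∧
      ∀ l, -Λ ≤ l → (∀ j, l ≠ lam j) → lamBar lam l = lb → HasGap lam I d A l := by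
  set I := sInf {j | lb ≤ lam j}
  have key : ∀ l, (∀ j, l ≠ lam j) → lamBar lam l = lb →
      lowCount lam l = I ∧ l < lam (I - 1) ∧ lam (I - 1) < lb ∧ lam I = lb := by
    intro l hl hlb
    obtain ⟨h1, h2⟩ := Nat.sInf_mem (s := {j | l ≤ lam j ∧ lam j < lam (j + 1)})
      (exists_lt_succ_of_tendsto hlim l)
    have hcount : lowCount lam l = sInf {j | l ≤ lam j ∧ lam j < lam (j + 1)} + 1 := rfl
    rw [lamBar] at hlb
    generalize sInf {j | l ≤ lam j ∧ lam j < lam (j + 1)} = m at *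
    rw [hcount] at hlb
    have hI : I = m + 1 := by
      refine le_antisymm (Nat.sInf_le hlb.ge) (le_csInf ⟨m + 1, hlb.ge⟩ fun j hj => ?_)
      by_contra! hjm
      have := hmono (Nat.lt_succ_iff.1 hjm)
      change lb ≤ lam j at hj
      linarith
    rw [hI]
    exact ⟨hcount, lt_of_le_of_ne h1 (hl m), by simpa [← hlb] using h2, hlb⟩
  by_cases hd : lam (I - 1) < lb
  · refine ⟨I, lb - lam (I - 1), ⟨|Λ| + |lb|, by positivity⟩, sub_pos.2 hd,
      fun l hΛ hl hlb => ?_⟩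
    obtain ⟨h1, h2, h3, h4⟩ := key l hl hlb
    refine ⟨hl, h1, ?_, fun j hj => ?_⟩
    · change |l| ≤ |Λ| + |lb|
      exact abs_le.2 ⟨by linarith [le_abs_self Λ, abs_nonneg lb],
        by linarith [le_abs_self lb, abs_nonneg Λ]⟩
    · linarith [hmono hj]
  -- In this case no admissible l has `lamBar lam l = lb`, and the constants are arbitrary.
  · exact ⟨0, 1, 0, one_pos, fun l _ hl hlb => absurd (key l hl hlb).2.2.1 hd⟩

section

variable {β γ : ℝ} {Ω : Set (Pt n)} {G : Pt n → Pt n → ℝ} {T : L2 Ω →L[ℝ] L2 Ω}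
  {lam : ℕ → ℝ} {φ : HilbertBasis ℕ ℝ (L2 Ω)}

lemma eLpNorm_mul_bdist_rpow (γ : ℝ) (Ω : Set (Pt n)) (f : Pt n → ℝ) :
    eLpNorm (fun x => f x * bdist Ω x ^ γ) 1 (mu Ω) = ∫⁻ x in Ω, ‖f x‖ₑ * wt γ Ω x := by
  simp_rw [eLpNorm_one_eq_lintegral_enorm, enorm_mul_bdist_rpow]

/-- Duality with ψ = sign(w) δ^γ: the weak formulation and the transfer of the projection leave the
pairing of f with P 𝔾_l ψ, which is bounded by C δ^γ uniformly in l. -/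
theorem GreenSpectrum.exists_lintegral_wt_le (S : GreenSpectrum β γ Ω G T lam φ) (I : ℕ)
    {d : ℝ} (hd : 0 < d) (A : ℝ≥0) :
    ∃ C : ℝ≥0, ∀ l, HasGap lam I d A l → ∀ f w : Pt n → ℝ, MemL1w γ Ω f →
      IsWeakSol γ lam φ l (perp lam φ l f) w →
      ∫⁻ x in Ω, ‖w x‖ₑ * wt γ Ω x ≤ C * ∫⁻ x in Ω, ‖f x‖ₑ * wt γ Ω x := by
  have H := S.kernel
  obtain ⟨C, hC⟩ := S.exists_highPart_solOp_le I hd A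
  refine ⟨C, fun l hl f w hf hw => ?_⟩
  obtain ⟨ψ, hψ1, hψ2⟩ := H.exists_test (H.memL1w_iff.1 hw.sol_mem).1
  have hψ : MemWLinf γ ψ := memWLinf_iff.2 ⟨1, by simpa using hψ1⟩
  calc ∫⁻ x in Ω, ‖w x‖ₑ * wt γ Ω x = ∫⁻ x in Ω, ‖w x * bdist Ω x ^ γ‖ₑ := by
        simp_rw [enorm_mul_bdist_rpow]
    _ = ENNReal.ofReal (∫ x in Ω, ‖w x * bdist Ω x ^ γ‖) :=
        (ofReal_integral_norm_eq_lintegral_enorm hw.sol_mem).symm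
    _ = ENNReal.ofReal (∫ x in Ω, f x * highPart φ I (solOp lam φ l ψ) x) := by
        rw [← integral_congr_ae hψ2, hw.weak ψ hψ,
          S.integral_perp_mul l hf (S.memWLinf_solOp hl.ne hψ), hl.lowCount_eq]
    _ ≤ ‖∫ x in Ω, f x * highPart φ I (solOp lam φ l ψ) x‖ₑ := by
        rw [Real.enorm_eq_ofReal_abs]
        exact ENNReal.ofReal_le_ofReal (le_abs_self _)
    _ ≤ ∫⁻ x in Ω, ‖f x‖ₑ * ‖highPart φ I (solOp lam φ l ψ) x‖ₑ := by
        refine (enorm_integral_le_lintegral_enorm _).trans_eq ?_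
        simp_rw [enorm_mul]
    _ ≤ _ := lintegral_mul_le_of_enorm_le f (hC l hl.abs_le hl.ne hl.le_sub ψ hψ1)

lemma GreenSpectrum.exists_enorm_perp_le (S : GreenSpectrum β γ Ω G T lam φ) (I : ℕ) :
    ∃ C : ℝ≥0, ∀ l, lowCount lam l = I → ∀ f : Pt n → ℝ,
      ∀ᵐ x ∂(mu Ω), ‖perp lam φ l f x‖ₑ
        ≤ ‖f x‖ₑ + C * (∫⁻ y in Ω, ‖f y‖ₑ * wt γ Ω y) * wt γ Ω x := by
  choose B hB using fun j => memWLinf_iff.1 (S.memWLinf_basis j)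
  refine ⟨∑ j ∈ Finset.range I, B j * B j, fun l hl f => ?_⟩
  filter_upwards [ae_all_iff.2 hB] with x hx
  rw [perp, hl]
  refine enorm_sub_le.trans (add_le_add le_rfl ((enorm_sum_le _ _).trans ?_))
  push_cast
  rw [Finset.sum_mul, Finset.sum_mul]
  refine Finset.sum_le_sum fun j _ => ?_
  have h1 : ‖pairing f (φ j)‖ₑ ≤ B j * ∫⁻ y in Ω, ‖f y‖ₑ * wt γ Ω y := by
    refine (enorm_integral_le_lintegral_enorm _).trans ?_
    simp_rw [enorm_mul]
    exact lintegral_mul_le_of_enorm_le f (hB j)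
  rw [enorm_mul]
  calc _ ≤ (B j * ∫⁻ y in Ω, ‖f y‖ₑ * wt γ Ω y) * (B j * wt γ Ω x) := mul_le_mul' h1 (hx j)
    _ = _ := by ring

lemma pot_iterate_add {κ : Pt n → Pt n → ℝ≥0∞} (hκ : Measurable (Function.uncurry κ))
    {F F' : Pt n → ℝ≥0∞} (hF : AEMeasurable F (mu Ω)) (i : ℕ) :
    (pot Ω κ)^[i] (fun y => F y + F' y)
      = fun x => (pot Ω κ)^[i] F x + (pot Ω κ)^[i] F' x := by
  induction i with
  | zero => rfl
  | succ i ih =>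
    ext x
    rw [Function.iterate_succ_apply', ih, pot_add hκ (measurable_pot_iterate hκ hF i),
      Function.iterate_succ_apply', Function.iterate_succ_apply']

/-- Pointwise bound of the projected solution by potentials of the datum. -/
theorem GreenSpectrum.exists_enorm_le (S : GreenSpectrum β γ Ω G T lam φ) (I : ℕ)
    {d : ℝ} (hd : 0 < d) (A : ℝ≥0) :
    ∃ (N : ℕ) (C : ℝ≥0), ∀ l, HasGap lam I d A l → ∀ f w : Pt n → ℝ, MemL1w γ Ω f →
      IsWeakSol γ lam φ l (perp lam φ l f) w →
      ∀ᵐ x ∂(mu Ω), ‖w x‖ₑ ≤ C * ((∑ i ∈ Finset.range N,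
          (pot Ω (fun x y => ‖G x y‖ₑ))^[i + 1] (fun y => ‖f y‖ₑ) x)
        + (∫⁻ y in Ω, ‖f y‖ₑ * wt γ Ω y) * wt γ Ω x) := by
  have H := S.kernel
  obtain ⟨N, C₁, hC₁⟩ := H.exists_apriori A
  obtain ⟨C₂, hC₂⟩ := S.exists_lintegral_wt_le I hd A
  obtain ⟨C₃, hC₃⟩ := S.exists_enorm_perp_le I
  choose D hD using exists_pot_iterate_wt_le H.one_le H.measurableSet H.isBounded H.bounds
    H.γ_nonneg H.β_lt
  set E := ∑ i ∈ Finset.range N, A ^ i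
  set E' := ∑ i ∈ Finset.range N, A ^ i * (C₃ * D (i + 1))
  refine ⟨N, E + E' + C₁ * C₂, fun l hl f w hf hw => ?_⟩
  obtain ⟨hfm, hf1⟩ := H.memL1w_iff.1 hf
  obtain ⟨hwm, -⟩ := H.memL1w_iff.1 hw.sol_mem
  obtain ⟨hpm, -⟩ := H.memL1w_iff.1 hw.data_mem
  have hX2 := hC₂ l hl f w hf hw
  have hp := hC₃ l hl.lowCount_eq f
  -- The weighted norm of w left over by the iteration is absorbed through `hX2`; passing from f^⊥
  -- to f costs only multiples of δ^γ, by `hp`.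
  have hmain := hC₁ _ _ hpm.enorm hwm.enorm (S.ae_enorm_le hl.ne hl.abs_le hw)
  generalize hX : ∫⁻ y in Ω, ‖f y‖ₑ * wt γ Ω y = X at *
  lift X to ℝ≥0 using hf1
  have hit : ∀ i, ∀ᵐ x ∂(mu Ω), (pot Ω (fun x y => ‖G x y‖ₑ))^[i] (fun y => ‖perp lam φ l f y‖ₑ) x
      ≤ (pot Ω (fun x y => ‖G x y‖ₑ))^[i] (fun y => ‖f y‖ₑ) x + C₃ * D i * (X * wt γ Ω x) := by
    intro i
    have h1 := pot_iterate_mono (fun x y => ‖G x y‖ₑ) hp i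
    simp_rw [← ENNReal.coe_mul C₃ X] at h1
    rw [pot_iterate_add H.bounds.measurable hfm.enorm, pot_iterate_const_mul] at h1
    filter_upwards [h1, ae_restrict_mem H.measurableSet] with x hx hxΩ
    refine hx.trans (add_le_add le_rfl ?_)
    calc ((C₃ * X : ℝ≥0) : ℝ≥0∞) * (pot Ω (fun x y => ‖G x y‖ₑ))^[i] (wt γ Ω) x
        ≤ ((C₃ * X : ℝ≥0) : ℝ≥0∞) * (D i * wt γ Ω x) := mul_le_mul' le_rfl (hD i x hxΩ)
      _ = _ := by push_cast; ring
  filter_upwards [hmain, ae_all_iff.2 hit] with x h1 h2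
  set P : ℕ → ℝ≥0∞ := fun i => (pot Ω (fun x y => ‖G x y‖ₑ))^[i + 1] (fun y => ‖f y‖ₑ) x
  calc ‖w x‖ₑ ≤ (∑ i ∈ Finset.range N, (A : ℝ≥0∞) ^ i
          * (P i + C₃ * D (i + 1) * (X * wt γ Ω x))) + C₁ * (C₂ * X) * wt γ Ω x := by
        refine h1.trans (add_le_add (Finset.sum_le_sum fun i _ => ?_) ?_)
        · exact mul_le_mul' le_rfl (h2 (i + 1))
        · gcongr
    _ = (∑ i ∈ Finset.range N, (A : ℝ≥0∞) ^ i * P i)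
          + (E' * (X * wt γ Ω x) + C₁ * C₂ * (X * wt γ Ω x)) := by
        simp only [E', mul_add, Finset.sum_add_distrib]
        push_cast
        rw [Finset.sum_mul, add_assoc]
        congr 1
        congr 1
        · exact Finset.sum_congr rfl fun i _ => by ring
        · ring
    _ ≤ E * (∑ i ∈ Finset.range N, P i) + (E' + C₁ * C₂) * (X * wt γ Ω x) := by
        rw [add_mul, Finset.mul_sum]
        refine add_le_add (Finset.sum_le_sum fun i hi => mul_le_mul' ?_ le_rfl) le_rfl
        exact_mod_cast Finset.single_le_sum (f := fun i => A ^ i) (fun _ _ => zero_le) hi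
    _ ≤ (E + E' + C₁ * C₂ : ℝ≥0) * (∑ i ∈ Finset.range N, P i)
          + (E + E' + C₁ * C₂ : ℝ≥0) * (X * wt γ Ω x) := by
        refine add_le_add (mul_le_mul' ?_ le_rfl) (mul_le_mul' ?_ le_rfl)
        · push_cast
          rw [add_assoc]
          exact le_self_add
        · push_cast
          rw [add_assoc]
          exact le_add_self
    _ = _ := (mul_add _ _ _).symm

/-! ### Estimates in Lebesgue spaces -/

/-- Common end of the second and third estimates: `hpot` handles the potentials, and `hr` the last
term, since δ^γ is bounded on Ω. -/
lemma AdmissibleKernel.exists_eLpNorm_le (H : AdmissibleKernel β γ Ω G) {q : ℝ} (hq : 1 ≤ q)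
    {r : ℝ≥0∞}
    (hpot : ∀ i, ∃ C : ℝ≥0, ∀ F : Pt n → ℝ≥0∞, AEMeasurable F (mu Ω) →
      eLpNorm ((pot Ω (fun x y => ‖G x y‖ₑ))^[i + 1] F) (ENNReal.ofReal q) (mu Ω)
        ≤ C * eLpNorm F r (mu Ω))
    (hr : ∃ B : ℝ≥0, ∀ f : Pt n → ℝ, AEStronglyMeasurable f (mu Ω) →
      ∫⁻ x in Ω, ‖f x‖ₑ * wt γ Ω x ≤ B * eLpNorm f r (mu Ω)) (N : ℕ) (C : ℝ≥0) :
    ∃ C' : ℝ≥0, ∀ f w : Pt n → ℝ, AEStronglyMeasurable f (mu Ω) →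
      (∀ᵐ x ∂(mu Ω), ‖w x‖ₑ ≤ C * ((∑ i ∈ Finset.range N,
          (pot Ω (fun x y => ‖G x y‖ₑ))^[i + 1] (fun y => ‖f y‖ₑ) x)
        + (∫⁻ y in Ω, ‖f y‖ₑ * wt γ Ω y) * wt γ Ω x)) →
      eLpNorm w (ENNReal.ofReal q) (mu Ω) ≤ C' * eLpNorm f r (mu Ω) := by
  have := H.isFiniteMeasure
  choose D hD using hpot
  obtain ⟨B, hB⟩ := hr
  obtain ⟨b, hb⟩ := exists_wt_le H.one_le H.isBounded H.γ_nonneg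
  have hq' : (1 : ℝ≥0∞) ≤ ENNReal.ofReal q := by
    rw [← ENNReal.ofReal_one]; exact ENNReal.ofReal_le_ofReal hq
  set m := (mu Ω) univ ^ (ENNReal.ofReal q).toReal⁻¹
  have hm : m ≠ ⊤ := ENNReal.rpow_ne_top_of_nonneg (by positivity) (measure_ne_top _ _)
  refine ⟨C * ((∑ i ∈ Finset.range N, D i) + B * b * m.toNNReal), fun f w hf hw => ?_⟩
  set P : ℕ → Pt n → ℝ≥0∞ := fun i => (pot Ω (fun x y => ‖G x y‖ₑ))^[i + 1] (fun y => ‖f y‖ₑ)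
  set X := ∫⁻ y in Ω, ‖f y‖ₑ * wt γ Ω y
  have hP : ∀ i, AEStronglyMeasurable (P i) (mu Ω) := fun i =>
    (measurable_pot_iterate H.bounds.measurable hf.enorm (i + 1)).aestronglyMeasurable
  have h1 : eLpNorm w (ENNReal.ofReal q) (mu Ω)
      ≤ C * eLpNorm ((∑ i ∈ Finset.range N, P i) + fun x => X * wt γ Ω x)
        (ENNReal.ofReal q) (mu Ω) := by
    have := eLpNorm_le_nnreal_smul_eLpNorm_of_ae_le_mul' (μ := mu Ω) (f := w)
      (g := (∑ i ∈ Finset.range N, P i) + fun x => X * wt γ Ω x) (c := C) (by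
        filter_upwards [hw] with x hx
        simpa [P] using hx) (ENNReal.ofReal q)
    simpa [ENNReal.smul_def] using this
  refine h1.trans ?_
  push_cast
  rw [ENNReal.coe_toNNReal hm, mul_assoc]
  refine mul_le_mul' le_rfl ((eLpNorm_add_le (Finset.aestronglyMeasurable_sum _ fun i _ => hP i)
    ((measurable_wt γ Ω).const_mul X).aestronglyMeasurable hq').trans ?_)
  rw [add_mul]
  refine add_le_add ((eLpNorm_sum_le (fun i _ => hP i) hq').trans ?_) ?_
  · rw [Finset.sum_mul]
    refine Finset.sum_le_sum fun i _ => (hD i _ hf.enorm).trans_eq ?_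
    rw [eLpNorm_enorm]
  · have h2 : eLpNorm (fun x => X * wt γ Ω x) (ENNReal.ofReal q) (mu Ω) ≤ (X * b) • m := by
      refine eLpNorm_le_of_ae_enorm_bound ?_
      filter_upwards [ae_restrict_mem H.measurableSet] with x hx
      simpa using mul_le_mul' le_rfl (hb x hx)
    calc _ ≤ (X * b) * m := h2
      _ ≤ (B * eLpNorm f r (mu Ω)) * b * m := by
        gcongr
        exact hB f hf
      _ = _ := by ring

lemma AdmissibleKernel.exists_eLpNorm_top_le (H : AdmissibleKernel β γ Ω G) {K K₀ : Set (Pt n)}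
    (hK : closure K ⊆ interior K₀) (hK₀ : closure K₀ ⊆ Ω) (N : ℕ) (C : ℝ≥0) :
    ∃ C' : ℝ≥0, ∀ f w : Pt n → ℝ, AEStronglyMeasurable f (mu Ω) →
      (∀ᵐ x ∂(mu Ω), ‖w x‖ₑ ≤ C * ((∑ i ∈ Finset.range N,
          (pot Ω (fun x y => ‖G x y‖ₑ))^[i + 1] (fun y => ‖f y‖ₑ) x)
        + (∫⁻ y in Ω, ‖f y‖ₑ * wt γ Ω y) * wt γ Ω x)) →
      eLpNorm w ∞ (volume.restrict K)
        ≤ C' * (eLpNorm f ∞ (volume.restrict K₀) + ∫⁻ y in Ω, ‖f y‖ₑ * wt γ Ω y) := by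
  obtain ⟨b, hb⟩ := exists_wt_le H.one_le H.isBounded H.γ_nonneg
  have hKΩ : K ⊆ Ω := subset_closure.trans (hK.trans (interior_subset.trans
    (subset_closure.trans hK₀)))
  -- Compactness of the closure of K leaves a margin ρ inside K₀; half of it is spent on the
  -- thickening where w is bounded, half on the potentials.
  obtain ⟨ρ, hρ, hρK⟩ := ((H.isBounded.subset hKΩ).isCompact_closure).exists_thickening_subset_open
    isOpen_interior hK
  choose D hD using fun i => exists_pot_iterate_le_on_thickening H.one_le H.measurableSet
    H.isBounded H.bounds H.γ_nonneg H.β_nonneg H.β_lt K i (ρ / 2) (half_pos hρ)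
  refine ⟨C * ((∑ i ∈ Finset.range N, D i) + b), fun f w hf hw => ?_⟩
  set B := eLpNorm f ∞ (volume.restrict K₀)
  set X := ∫⁻ y in Ω, ‖f y‖ₑ * wt γ Ω y
  have hfB : ∀ᵐ y ∂(mu Ω), y ∈ Metric.thickening (ρ / 2 + ρ / 2) K → ‖f y‖ₑ ≤ B := by
    have h1 : ∀ᵐ y ∂(volume.restrict (interior K₀)), ‖f y‖ₑ ≤ B := by
      filter_upwards [enorm_ae_le_eLpNormEssSup f (volume.restrict (interior K₀))] with y hy
      refine hy.trans ?_
      rw [← eLpNorm_exponent_top]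
      exact eLpNorm_mono_measure f (Measure.restrict_mono_set volume interior_subset)
    rw [ae_restrict_iff' isOpen_interior.measurableSet] at h1
    filter_upwards [ae_restrict_of_ae h1] with y hy hyK
    rw [add_halves] at hyK
    exact hy (hρK (Metric.thickening_subset_of_subset ρ subset_closure hyK))
  -- K need not be measurable, so the bound is proved on this open superset.
  set U := Ω ∩ Metric.thickening (ρ / 2) K
  have hKU : K ⊆ U := subset_inter hKΩ (Metric.self_subset_thickening (half_pos hρ) K)
  have hU : MeasurableSet U := (H.isOpen.inter Metric.isOpen_thickening).measurableSet
  refine (eLpNorm_mono_measure w (Measure.restrict_mono_set volume hKU)).trans ?_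
  rw [eLpNorm_exponent_top]
  refine eLpNormEssSup_le_of_ae_enorm_bound ?_
  filter_upwards [ae_mono (Measure.restrict_mono_set volume inter_subset_left) hw,
    ae_restrict_mem hU] with x hx hxU
  refine hx.trans ?_
  push_cast
  rw [mul_assoc]
  refine mul_le_mul' le_rfl ?_
  rw [add_mul, Finset.sum_mul]
  refine add_le_add (Finset.sum_le_sum fun i _ => hD i _ hf.enorm B hfB x hxU.1 hxU.2) ?_
  rw [mul_comm]
  exact mul_le_mul' (hb x hxU.1) le_add_self

end

end GreenEig

/-! ### Assembly of the main theorem. -/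

namespace GreenEig

variable {n : ℕ}

theorem GreenBounds.admissibleKernel (hn : 1 ≤ n) {s γ : ℝ} (hs0 : 0 < s) (hγ0 : 0 < γ)
    (hγ1 : γ ≤ 1) {Ω : Set (Pt n)} (hΩo : IsOpen Ω) (hΩb : Bornology.IsBounded Ω)
    {G : Pt n → Pt n → ℝ} (hG : GreenBounds s γ Ω G) :
    AdmissibleKernel (max ((n : ℝ) - 2 * s) 0) γ Ω G where
  one_le := hn
  isOpen := hΩo
  isBounded := hΩb
  γ_nonneg := hγ0.le
  β_nonneg := le_max_right _ _
  β_lt := by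
    have : (1 : ℝ) ≤ n := by exact_mod_cast hn
    exact max_lt (by linarith) (by linarith)
  measurable := hG.measurable
  symm := hG.symm
  bounds := hG.kernelBounds hγ1 hΩb

lemma AdmissibleKernel.memL1w_of_memLp {β γ : ℝ} {Ω : Set (Pt n)} {G : Pt n → Pt n → ℝ}
    (H : AdmissibleKernel β γ Ω G) {p : ℝ} (hp : 1 ≤ p) {f : Pt n → ℝ}
    (hf : MemLp f (ENNReal.ofReal p) (mu Ω)) : MemL1w γ Ω f := by
  obtain ⟨C, hC⟩ := H.exists_lintegral_wt_le
  obtain ⟨B, hB⟩ := hC p hp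
  refine H.memL1w_iff.2 ⟨hf.1, ((hB f hf.1).trans_lt ?_).ne⟩
  exact ENNReal.mul_lt_top (ENNReal.mul_lt_top ENNReal.coe_lt_top ENNReal.coe_lt_top) hf.2

end GreenEig

open GreenEig in
theorem mainTheorem2 (n : ℕ) (hn : 1 ≤ n) (s γ : ℝ) (hs0 : 0 < s) (hs1 : s < 1)
    (hγ0 : 0 < γ) (hγ1 : γ ≤ 1) (hns : (n : ℝ) ≠ 2 * s)
    (Ω : Set (Pt n)) (hΩo : IsOpen Ω) (hΩb : Bornology.IsBounded Ω) (hΩne : Ω.Nonempty)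
    (L : L2 Ω →ₗ.[ℝ] L2 Ω) (hL : IsNonneg L)
    (G : Pt n → Pt n → ℝ) (hG : GreenBounds s γ Ω G) (hLG : IsGreenFunction L G) :
    -- `L` has a discrete spectrum and an orthonormal basis of eigenfunctions
    (∃ (lam : ℕ → ℝ) (φ : HilbertBasis ℕ ℝ (L2 Ω)), IsEigenSystem L lam φ) ∧
    ∀ (lam : ℕ → ℝ) (φ : HilbertBasis ℕ ℝ (L2 Ω)), IsEigenSystem L lam φ →
    -- existence, uniqueness and representation
    (∀ l : ℝ, (∀ j, l ≠ lam j) → ∀ f : Pt n → ℝ, MemL1w γ Ω f →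
      (∃ u, IsWeakSol γ lam φ l f u ∧ ∀ v, IsWeakSol γ lam φ l f v → v =ᵐ[mu Ω] u) ∧
      (∀ j, Integrable (fun x => f x * φ j x) (mu Ω)) ∧
      (∃ w, IsWeakSol γ lam φ l (perp lam φ l f) w ∧
        ∀ v, IsWeakSol γ lam φ l (perp lam φ l f) v → v =ᵐ[mu Ω] w) ∧
      ∀ u w, IsWeakSol γ lam φ l f u → IsWeakSol γ lam φ l (perp lam φ l f) w →
        u =ᵐ[mu Ω] fun x => (∑ j ∈ Finset.range (lowCount lam l),
          pairing f (φ j) / (lam j - l) * φ j x) + w x) ∧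
    -- estimates of `w = u^⊥`, uniform in `l ≥ -Λ` outside the spectrum with a given `lamBar`
    ∀ lb Λ : ℝ,
      (∃ C : ℝ≥0, ∀ l : ℝ, -Λ ≤ l → (∀ j, l ≠ lam j) → lamBar lam l = lb →
        ∀ f w : Pt n → ℝ, MemL1w γ Ω f → IsWeakSol γ lam φ l (perp lam φ l f) w →
          eLpNorm (fun x => w x * bdist Ω x ^ γ) 1 (mu Ω)
            ≤ C * eLpNorm (fun x => f x * bdist Ω x ^ γ) 1 (mu Ω)) ∧
      (∀ p : ℝ, 1 ≤ p → p < n / (n - 2 * s) →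
        ∃ C : ℝ≥0, ∀ l : ℝ, -Λ ≤ l → (∀ j, l ≠ lam j) → lamBar lam l = lb →
          ∀ f w : Pt n → ℝ, MemLp f 1 (mu Ω) → IsWeakSol γ lam φ l (perp lam φ l f) w →
            eLpNorm w (ENNReal.ofReal p) (mu Ω) ≤ C * eLpNorm f 1 (mu Ω)) ∧
      (∀ p₀ p₁ : ℝ, 1 < p₀ → p₀ < n / (2 * s) → 1 / p₁ = 1 / p₀ - 2 * s / n →
        ∃ C : ℝ≥0, ∀ l : ℝ, -Λ ≤ l → (∀ j, l ≠ lam j) → lamBar lam l = lb →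
          ∀ f w : Pt n → ℝ, MemLp f (ENNReal.ofReal p₀) (mu Ω) →
            IsWeakSol γ lam φ l (perp lam φ l f) w →
            eLpNorm w (ENNReal.ofReal p₁) (mu Ω)
              ≤ C * eLpNorm f (ENNReal.ofReal p₀) (mu Ω)) ∧
      (∀ K K₀ : Set (Pt n), closure K ⊆ interior K₀ → closure K₀ ⊆ Ω →
        ∃ C : ℝ≥0, ∀ l : ℝ, -Λ ≤ l → (∀ j, l ≠ lam j) → lamBar lam l = lb →
          ∀ f w : Pt n → ℝ, MemL1w γ Ω f → MemLinfLoc Ω f →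
            IsWeakSol γ lam φ l (perp lam φ l f) w →
            eLpNorm w ∞ (volume.restrict K)
              ≤ C * (eLpNorm f ∞ (volume.restrict K₀)
                + eLpNorm (fun x => f x * bdist Ω x ^ γ) 1 (mu Ω))) := by
  have H := hG.admissibleKernel hn hs0 hγ0 hγ1 hΩo hΩb
  have hn0 : (0 : ℝ) < n := by exact_mod_cast hn
  refine ⟨H.exists_isEigenSystem hΩne hL hLG, fun lam φ hφ => ?_⟩
  obtain ⟨T, hT, -⟩ := H.exists_greenOp
  have S : GreenSpectrum (max ((n : ℝ) - 2 * s) 0) γ Ω G T lam φ :=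
    ⟨H, hT, hφ.tendsto, fun j => (hφ.greenOp_apply hLG hT j).1,
      fun j => (hφ.greenOp_apply hLG hT j).2⟩
  refine ⟨fun l hl f hf => ⟨?_, fun j => H.integrable_mul hf (S.memWLinf_basis j), ?_,
    fun u w hu hw => S.ae_eq_sum_add hl hu hw⟩, fun lb Λ => ?_⟩
  · obtain ⟨u, hu⟩ := S.exists_isWeakSol hl hf
    exact ⟨u, hu, fun v hv => S.isWeakSol_unique hv hu⟩
  · obtain ⟨w, hw⟩ := S.exists_isWeakSol hl (S.memL1w_perp l hf)
    exact ⟨w, hw, fun v hv => S.isWeakSol_unique hv hw⟩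
  -- These are fixed from lb and Λ before l is introduced, hence every constant below is uniform in
  -- l.
  obtain ⟨I, d, A, hd, hgap⟩ := exists_hasGap hφ.mono hφ.tendsto lb Λ
  obtain ⟨N, C₀, hC₀⟩ := S.exists_enorm_le I hd A
  obtain ⟨C₁, hC₁⟩ := H.exists_lintegral_wt_le
  refine ⟨?_, fun p hp hpn => ?_, fun p₀ p₁ hp₀ hp₀n hp₁ => ?_, fun K K₀ hK hK₀ => ?_⟩
  · obtain ⟨C, hC⟩ := S.exists_lintegral_wt_le I hd A
    refine ⟨C, fun l hΛ hl hlb f w hf hw => ?_⟩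
    rw [eLpNorm_mul_bdist_rpow, eLpNorm_mul_bdist_rpow]
    exact hC l (hgap l hΛ hl hlb) f w hf hw
  -- For n ≤ 2s the bound n / (n - 2s) would be at most 0 (also for a zero denominator), against p ≥
  -- 1.
  · have hb : 0 < (n : ℝ) - 2 * s := by
      by_contra! hb
      linarith [div_nonpos_of_nonneg_of_nonpos hn0.le hb]
    obtain ⟨B, hB⟩ := hC₁ 1 le_rfl
    rw [ENNReal.ofReal_one] at hB
    obtain ⟨C, hC⟩ := H.exists_eLpNorm_le hp
      (fun i => exists_eLpNorm_pot_iterate_le_eLpNorm_one hn H.measurableSet hΩb H.bounds hγ0.le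
        H.β_lt hp (by rw [max_eq_left hb.le]; exact (lt_div_iff₀ hb).1 hpn) i)
      ⟨C₁ * B, fun f hf => by simpa using hB f hf⟩ N C₀
    refine ⟨C, fun l hΛ hl hlb f w hf hw => hC f w hf.1 (hC₀ l (hgap l hΛ hl hlb) f w ?_ hw)⟩
    exact H.memL1w_of_memLp le_rfl (by simpa using hf)
  · have h2s : p₀ * (2 * s) < n := (lt_div_iff₀ (by linarith)).1 hp₀n
    have hb : 0 < (n : ℝ) - 2 * s := by nlinarith
    -- Since n > 2s here, the exponent shift in the Hardy-Littlewood-Sobolev inequality is exactly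
    -- 2s/n.
    have hσ : 1 - max ((n : ℝ) - 2 * s) 0 / n = 2 * s / n := by
      rw [max_eq_left hb.le]; field_simp; ring
    have hp₁0 : 0 < 1 / p₁ := by
      rw [hp₁, sub_pos, div_lt_div_iff₀ hn0 (by linarith)]
      linarith
    have hp₁1 : 1 / p₁ ≤ 1 := by
      have h1 : 1 / p₀ ≤ 1 := by rw [div_le_one (by linarith)]; exact hp₀.le
      have h2 : 0 < 2 * s / n := by positivity
      linarith
    have hp₁pos : 0 < p₁ := one_div_pos.1 hp₁0
    obtain ⟨B, hB⟩ := hC₁ p₀ hp₀.le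
    obtain ⟨C, hC⟩ := H.exists_eLpNorm_le ((div_le_one hp₁pos).1 hp₁1)
      (fun i => exists_eLpNorm_pot_iterate_le_of_one_div_eq hn H.measurableSet hΩb H.bounds hγ0.le
        H.β_lt hp₀ (by rw [hσ, ← mul_div_assoc, div_lt_one hn0]; exact h2s) hp₁pos
        (by rw [hσ]; exact hp₁) i)
      ⟨C₁ * B, fun f hf => by simpa using hB f hf⟩ N C₀
    exact ⟨C, fun l hΛ hl hlb f w hf hw => hC f w hf.1
      (hC₀ l (hgap l hΛ hl hlb) f w (H.memL1w_of_memLp hp₀.le hf) hw)⟩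
  · obtain ⟨C, hC⟩ := H.exists_eLpNorm_top_le hK hK₀ N C₀
    refine ⟨C, fun l hΛ hl hlb f w hf _ hw => ?_⟩
    rw [eLpNorm_mul_bdist_rpow]
    exact hC f w (H.memL1w_iff.1 hf).1 (hC₀ l (hgap l hΛ hl hlb) f w hf hw)
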